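/- **Setting.** Let $l>0$, $I=(-\frac l2,\frac l2)$, $S_\varepsilon=I\times(-\frac\varepsilon2,\frac\varepsilon2)$ for $\varepsilon>0$, and $S=S_1=I\times(-\frac12,\frac12)$. Functions on $I$ are regarded as functions on $S$ that do not depend on $x_2$. Let $Q_W^2$ be a quadratic form on $\mathbb R^{2\times2}$ that depends only on the symmetric part of its argument and is positive definite on $\mathbb R^{2\times 2}_{\rm sym}$. Writing $Q^2_W(q_{11},q_{12},q_{22})$ for its value at the symmetric matrix with these entries, put $$Q_W^1(q_{11},q_{12})=\min_{\alpha\in\mathbb R}Q_W^2(q_{11},q_{12},\alpha),\qquad Q_W^0(q_{11})=\min_{z\in\mathbb R}Q_W^1(q_{11},z).$$ Let $\hat u_1\in W^{1,2}(I)$ and $\hat u_2,\hat v\in W^{2,2}(I)$. **Admissible functions.** $\mathscr S^{2D}_\varepsilon$ is the set of all $(u,v)\in W^{1,2}(S_\varepsilon;\mathbb R^2)\times W^{2,2}(S_\varepsilon)$ such that, in the sense of traces on $\partial I\times(-\frac\varepsilon2,\frac\varepsilon2)$, $$u(x)=\big(\hat u_1(x_1)-\tfrac{x_2}{\varepsilon}\hat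 u_2'(x_1),\ \tfrac1\varepsilon\hat u_2(x_1)\big),\qquad v(x)=\hat v(x_1),\qquad \partial_1v(x)=\hat v'(x_1).$$ $\mathscr S^{1D}$ is the set of all $(y,w,\theta)$ where $w\in W^{2,2}(I)$ with $w=\hat v$, $w'=\hat v'$ on $\partial I$; $\theta\in W^{1,2}_0(I)$; and $y\in W^{1,2}(S;\mathbb R^2)$ satisfies $e(y)_{12}=e(y)_{22}=0$ a.e. in $S$ and, in the sense of traces, $y_1=\hat u_1-x_2\hat u_2'$, $y_2=\hat u_2$ on $\partial I\times(-\frac12,\frac12)$. Here $e(u)=\frac12(\nabla u+\nabla u^T)$. **Energies.** For $f_\varepsilon\in L^2(S_\varepsilon)$, $g_\varepsilon\in L^2(S_\varepsilon;\mathbb R^2)$, $f\in L^2(I)$, $g\in L^2(I;\mathbb R^2)$ let $$\phi_\varepsilon(u,v)=\frac1\varepsilon\int_{S_\varepsilon}\tfrac12Q_W^2\big(e(u)+\tfrac12\nabla v\otimes\nabla v\big)+\frac1\varepsilon\int_{S_\varepsilon}\tfrac1{24}Q_W^2(\nabla^2v)-\frac1\varepsilon\int_{S_\varepsilon}(f_\varepsilon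 v+g_\varepsilon\cdot u),$$ $$\phi_0(y,w,\theta)=\frac12\int_SQ_W^0\big(\partial_1y_1+\tfrac12|w'|^2\big)+\frac1{24}\int_IQ_W^1(w'',\theta')-\int_S(f w+g\cdot y).$$ **Convergence.** For $(u,v)\in\mathscr S^{2D}_\varepsilon$ let $y_1(x)=u_1(x_1,\varepsilon x_2)$, $y_2(x)=\varepsilon u_2(x_1,\varepsilon x_2)$, $w(x)=v(x_1,\varepsilon x_2)$ on $S$ be the scaled displacements, and $$E^\varepsilon y=\begin{pmatrix}\partial_1y_1&\frac1{2\varepsilon}(\partial_1y_2+\partial_2y_1)\\ \frac1{2\varepsilon}(\partial_2y_1+\partial_1y_2)&\frac1{\varepsilon^2}\partial_2y_2\end{pmatrix},\quad \nabla_\varepsilon w=\big(\partial_1w,\tfrac1\varepsilon\partial_2w\big),\quad \nabla^2_\varepsilon w=\begin{pmatrix}\partial^2_{11}w&\frac1\varepsilon\partial^2_{12}w\\ \frac1\varepsilon\partial^2_{21}w&\frac1{\varepsilon^2}\partial^2_{22}w\end{pmatrix}.$$ Let $\varepsilon_n>0$, $\varepsilon_n\to0$, $(u_n,v_n)\in\mathscr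 S^{2D}_{\varepsilon_n}$ with scaled displacements $(y_n,w_n)$, and $(y,w,\theta)\in\mathscr S^{1D}$. We write $(u_n,v_n)\stackrel{\pi\sigma}{\to}(y,w,\theta)$ if there are $\gamma\in L^2(S)$ and $E\in L^2(S;\mathbb R^{2\times2}_{\rm sym})$ with $E_{11}=\partial_1y_1$ such that $$w_n\rightharpoonup w\ \text{in }W^{2,2}(S),\qquad \nabla_{\varepsilon_n}w_n\rightharpoonup(w',\theta)\ \text{in }W^{1,2}(S;\mathbb R^2),\qquad \nabla^2_{\varepsilon_n}w_n\rightharpoonup\begin{pmatrix}w''&\theta'\\ \theta'&\gamma\end{pmatrix}\ \text{in }L^2(S;\mathbb R^{2\times2}),$$ $$y_n\rightharpoonup y\ \text{in }W^{1,2}(S;\mathbb R^2),\qquad E^{\varepsilon_n}y_n\rightharpoonup E\ \text{in }L^2(S;\mathbb R^{2\times2}).$$ We write $(u_n,v_n)\stackrel{\pi\rho}{\to}(y,w,\theta)$ if the same holds with strong convergence in place of weak convergence everywhere. **Lemma.** In this setting, let the forces satisfy $f_{\varepsilon_n}(x_1,\varepsilon_nx_2)\rightharpoonup f$, $(g_{\varepsilon_n})_1(x_1,\varepsilon_nx_2)\rightharpoonup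 g_1$ and $\frac1{\varepsilon_n}(g_{\varepsilon_n})_2(x_1,\varepsilon_nx_2)\rightharpoonup g_2$ weakly in $L^2(S)$ (for instance, let all forces be zero). Let $(u_n,v_n)\in\mathscr S^{2D}_{\varepsilon_n}$ and $(y,w,\theta)\in\mathscr S^{1D}$ be such that $$(u_n,v_n)\stackrel{\pi\sigma}{\to}(y,w,\theta)\qquad\text{and}\qquad\phi_{\varepsilon_n}(u_n,v_n)\to\phi_0(y,w,\theta).$$ Then $(u_n,v_n)\stackrel{\pi\rho}{\to}(y,w,\theta)$. -/

import Mathlib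

open Filter Topology MeasureTheory Set
open scoped ContDiff ENNReal

noncomputable section

namespace Ribbon

/-! ### Weak derivatives, Sobolev spaces, traces and modes of convergence

All function spaces are spaces of real-valued functions on an open subset `Ω` of `E`; below
`E` is `ℝ` or `ℝ × ℝ` with Lebesgue measure. Functions are only relevant almost everywhere in `Ω`. -/

section General

variable {E : Type*} [NormedAddCommGroup E] [NormedSpace ℝ E] [MeasureSpace E]

/-- `g` is a weak derivative of `f` in `Ω` in the direction `e`. -/
def HasWeakDeriv (Ω : Set E) (e : E) (f g : E → ℝ) : Prop :=
  LocallyIntegrableOn f Ω ∧ LocallyIntegrableOn g Ω ∧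
    ∀ φ : E → ℝ, ContDiff ℝ ∞ φ → HasCompactSupport φ → tsupport φ ⊆ Ω →
      ∫ x in Ω, f x * fderiv ℝ φ x e = -∫ x in Ω, g x * φ x

open Classical in
/-- The weak derivative of `f` in `Ω` in the direction `e` (unique almost everywhere in an open set
`Ω`; the value is `0` if there is no weak derivative). -/
def weakDeriv (Ω : Set E) (e : E) (f : E → ℝ) : E → ℝ :=
  if h : ∃ g, HasWeakDeriv Ω e f g then h.choose else 0

/-- `f ∈ L²(Ω)`. -/
def MemL2 (Ω : Set E) (f : E → ℝ) : Prop :=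
  MemLp f 2 (volume.restrict Ω)

/-- `f ∈ W^{1,2}(Ω)`. -/
def MemW12 (Ω : Set E) (f : E → ℝ) : Prop :=
  MemL2 Ω f ∧ ∀ e : E, ∃ g, MemL2 Ω g ∧ HasWeakDeriv Ω e f g

/-- `f ∈ W^{2,2}(Ω)`. -/
def MemW22 (Ω : Set E) (f : E → ℝ) : Prop :=
  MemW12 Ω f ∧ ∀ e : E, MemW12 Ω (weakDeriv Ω e f)

/-- The trace of `f ∈ W^{1,2}(Ω)` vanishes on the part of the boundary that carries the surface
measure `σ`: the pair `(f, 0)` is a limit, in `W^{1,2}(Ω) × L²(σ)`, of pairs `(φ, φ|_Γ)` with `φ`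
smooth up to the boundary. (The trace operator is the continuous extension of the restriction of
smooth functions.) -/
def ZeroTrace (Ω : Set E) (σ : Measure E) (f : E → ℝ) : Prop :=
  ∃ φ : ℕ → E → ℝ, (∀ k, ContDiff ℝ ∞ (φ k)) ∧
    Tendsto (fun k => eLpNorm (fun x => φ k x - f x) 2 (volume.restrict Ω)) atTop (𝓝 0) ∧
    (∀ e : E, Tendsto
      (fun k => eLpNorm (fun x => fderiv ℝ (φ k) x e - weakDeriv Ω e f x) 2 (volume.restrict Ω))
      atTop (𝓝 0)) ∧
    Tendsto (fun k => eLpNorm (φ k) 2 σ) atTop (𝓝 0)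

/-- Weak convergence in `L²(Ω)`. -/
def WeakL2 (Ω : Set E) (F : ℕ → E → ℝ) (G : E → ℝ) : Prop :=
  (∀ n, MemL2 Ω (F n)) ∧ MemL2 Ω G ∧
    ∀ ψ : E → ℝ, MemL2 Ω ψ →
      Tendsto (fun n => ∫ x in Ω, F n x * ψ x) atTop (𝓝 (∫ x in Ω, G x * ψ x))

/-- Strong convergence in `L²(Ω)`. -/
def StrongL2 (Ω : Set E) (F : ℕ → E → ℝ) (G : E → ℝ) : Prop :=
  (∀ n, MemL2 Ω (F n)) ∧ MemL2 Ω G ∧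
    Tendsto (fun n => eLpNorm (fun x => F n x - G x) 2 (volume.restrict Ω)) atTop (𝓝 0)

/-- Convergence in `W^{1,2}(Ω)`, weak or strong according to whether `conv` is weak or strong
convergence in `L²`: the functions and their first weak derivatives converge. -/
def ConvW12 (conv : Set E → (ℕ → E → ℝ) → (E → ℝ) → Prop)
    (Ω : Set E) (F : ℕ → E → ℝ) (G : E → ℝ) : Prop :=
  (∀ n, MemW12 Ω (F n)) ∧ MemW12 Ω G ∧ conv Ω F G ∧
    ∀ e : E, conv Ω (fun n => weakDeriv Ω e (F n)) (weakDeriv Ω e G)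

/-- Convergence in `W^{2,2}(Ω)`, weak or strong as for `ConvW12`. -/
def ConvW22 (conv : Set E → (ℕ → E → ℝ) → (E → ℝ) → Prop)
    (Ω : Set E) (F : ℕ → E → ℝ) (G : E → ℝ) : Prop :=
  ConvW12 conv Ω F G ∧
    ∀ e : E, ConvW12 conv Ω (fun n => weakDeriv Ω e (F n)) (weakDeriv Ω e G)

end General

/-! ### Geometry and differential operators -/

/-- The interval `I = (-l/2, l/2)`. -/
def interval (l : ℝ) : Set ℝ := Ioo (-l / 2) (l / 2)

/-- The rectangle `I × (-h/2, h/2)`; it is `S_ε` for `h = ε` and `S` for `h = 1`. -/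
def rect (l h : ℝ) : Set (ℝ × ℝ) := interval l ×ˢ interval h

/-- The counting measure of `∂I = {-l/2, l/2}`. -/
def endpoints (l : ℝ) : Measure ℝ := Measure.dirac (-l / 2) + Measure.dirac (l / 2)

/-- The length measure of the lateral boundary `∂I × (-h/2, h/2)`. -/
def lateral (l h : ℝ) : Measure (ℝ × ℝ) := (endpoints l).prod (volume.restrict (interval h))

/-- The weak derivative `f'` of a function on the interval `I`. -/
def D (l : ℝ) (f : ℝ → ℝ) : ℝ → ℝ := weakDeriv (interval l) 1 f

/-- The weak partial derivatives in `Ω ⊆ ℝ²`; the coordinates `x₁, x₂` carry the indices `0, 1`. -/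
def pd (Ω : Set (ℝ × ℝ)) (i : Fin 2) (f : ℝ × ℝ → ℝ) : ℝ × ℝ → ℝ :=
  weakDeriv Ω (![((1 : ℝ), (0 : ℝ)), (0, 1)] i) f

/-- The linear strain `e(u) = (∇u + ∇uᵀ)/2` of `u = (u₁, u₂)`. -/
def strain (Ω : Set (ℝ × ℝ)) (u : Fin 2 → ℝ × ℝ → ℝ) (x : ℝ × ℝ) : Matrix (Fin 2) (Fin 2) ℝ :=
  Matrix.of fun i j => (1 / 2) * (pd Ω j (u i) x + pd Ω i (u j) x)

/-- The tensor product `∇v ⊗ ∇v`. -/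
def gradTensor (Ω : Set (ℝ × ℝ)) (v : ℝ × ℝ → ℝ) (x : ℝ × ℝ) : Matrix (Fin 2) (Fin 2) ℝ :=
  Matrix.of fun i j => pd Ω i v x * pd Ω j v x

/-- The Hessian `∇²v`. -/
def hessian (Ω : Set (ℝ × ℝ)) (v : ℝ × ℝ → ℝ) (x : ℝ × ℝ) : Matrix (Fin 2) (Fin 2) ℝ :=
  Matrix.of fun i j => pd Ω i (pd Ω j v) x

/-- The scaled in-plane displacement `y = (u₁(x₁, ε x₂), ε u₂(x₁, ε x₂))`. -/
def scaledU (ε : ℝ) (u : Fin 2 → ℝ × ℝ → ℝ) : Fin 2 → ℝ × ℝ → ℝ :=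
  ![fun x => u 0 (x.1, ε * x.2), fun x => ε * u 1 (x.1, ε * x.2)]

/-- The scaled out-of-plane displacement `w = v(x₁, ε x₂)`. -/
def scaledV (ε : ℝ) (v : ℝ × ℝ → ℝ) : ℝ × ℝ → ℝ := fun x => v (x.1, ε * x.2)

/-- The scaled strain `E^ε y` on `S`. -/
def scaledStrain (l ε : ℝ) (y : Fin 2 → ℝ × ℝ → ℝ) (x : ℝ × ℝ) : Matrix (Fin 2) (Fin 2) ℝ :=
  let S := rect l 1
  !![pd S 0 (y 0) x, 1 / (2 * ε) * (pd S 0 (y 1) x + pd S 1 (y 0) x);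
     1 / (2 * ε) * (pd S 1 (y 0) x + pd S 0 (y 1) x), 1 / ε ^ 2 * pd S 1 (y 1) x]

/-- The scaled gradient `∇_ε w = (∂₁w, ∂₂w / ε)` on `S`. -/
def scaledGrad (l ε : ℝ) (w : ℝ × ℝ → ℝ) : Fin 2 → ℝ × ℝ → ℝ :=
  ![pd (rect l 1) 0 w, fun x => 1 / ε * pd (rect l 1) 1 w x]

/-- The scaled Hessian `∇²_ε w` on `S`. -/
def scaledHessian (l ε : ℝ) (w : ℝ × ℝ → ℝ) (x : ℝ × ℝ) : Matrix (Fin 2) (Fin 2) ℝ :=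
  let H := hessian (rect l 1) w x
  !![H 0 0, 1 / ε * H 0 1; 1 / ε * H 1 0, 1 / ε ^ 2 * H 1 1]

/-! ### Admissible functions -/

/-- `f ∈ W^{1,2}_g(I)`: `f ∈ W^{1,2}(I)` with the boundary values of `g`. -/
def MemW12Bdry (l : ℝ) (g f : ℝ → ℝ) : Prop :=
  MemW12 (interval l) f ∧ ZeroTrace (interval l) (endpoints l) (fun t => f t - g t)

/-- `f ∈ W^{2,2}_g(I)`: `f ∈ W^{2,2}(I)` with the boundary values of `g`, up to first order. -/
def MemW22Bdry (l : ℝ) (g f : ℝ → ℝ) : Prop :=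
  MemW22 (interval l) f ∧ ZeroTrace (interval l) (endpoints l) (fun t => f t - g t) ∧
    ZeroTrace (interval l) (endpoints l) (fun t => D l f t - D l g t)

/-- The two-dimensional admissible set: `u ∈ W^{1,2}(S_ε; ℝ²)`, `v ∈ W^{2,2}(S_ε)` and, on
`∂I × (-ε/2, ε/2)`, `u = (û₁ - (x₂/ε) û₂', û₂/ε)`, `v = v̂`, `∂₁v = v̂'`. -/
def Admissible2D (l ε : ℝ) (uhat₁ uhat₂ vhat : ℝ → ℝ)
    (u : Fin 2 → ℝ × ℝ → ℝ) (v : ℝ × ℝ → ℝ) : Prop :=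
  (∀ i, MemW12 (rect l ε) (u i)) ∧ MemW22 (rect l ε) v ∧
    ZeroTrace (rect l ε) (lateral l ε)
      (fun x => u 0 x - (uhat₁ x.1 - x.2 / ε * D l uhat₂ x.1)) ∧
    ZeroTrace (rect l ε) (lateral l ε) (fun x => u 1 x - 1 / ε * uhat₂ x.1) ∧
    ZeroTrace (rect l ε) (lateral l ε) (fun x => v x - vhat x.1) ∧
    ZeroTrace (rect l ε) (lateral l ε) (fun x => pd (rect l ε) 0 v x - D l vhat x.1)

/-- The Bernoulli–Navier space `BN_{(û₁,û₂)}(S; ℝ²)`. -/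
def BernoulliNavier (l : ℝ) (uhat₁ uhat₂ : ℝ → ℝ) (y : Fin 2 → ℝ × ℝ → ℝ) : Prop :=
  (∀ i, MemW12 (rect l 1) (y i)) ∧
    (∀ᵐ x ∂(volume.restrict (rect l 1)),
      strain (rect l 1) y x 0 1 = 0 ∧ strain (rect l 1) y x 1 1 = 0) ∧
    ZeroTrace (rect l 1) (lateral l 1)
      (fun x => y 0 x - (uhat₁ x.1 - x.2 * D l uhat₂ x.1)) ∧
    ZeroTrace (rect l 1) (lateral l 1) (fun x => y 1 x - uhat₂ x.1)

/-- The one-dimensional admissible set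
`BN_{(û₁,û₂)}(S; ℝ²) × W^{2,2}_{v̂}(I) × W^{1,2}_0(I)`. -/
def Admissible1D (l : ℝ) (uhat₁ uhat₂ vhat : ℝ → ℝ)
    (y : Fin 2 → ℝ × ℝ → ℝ) (w θ : ℝ → ℝ) : Prop :=
  BernoulliNavier l uhat₁ uhat₂ y ∧ MemW22Bdry l vhat w ∧ MemW12Bdry l 0 θ

/-! ### Energies -/

/-- The von Kármán energy `φ_ε(u, v)` with force densities `f` (vertical) and `g` (horizontal). -/
def energy2D (Q : QuadraticForm ℝ (Matrix (Fin 2) (Fin 2) ℝ)) (l ε : ℝ)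
    (f : ℝ × ℝ → ℝ) (g : Fin 2 → ℝ × ℝ → ℝ)
    (u : Fin 2 → ℝ × ℝ → ℝ) (v : ℝ × ℝ → ℝ) : ℝ :=
  let S := rect l ε
  1 / ε * (∫ x in S, 1 / 2 * Q (strain S u x + (1 / 2 : ℝ) • gradTensor S v x))
    + 1 / ε * (∫ x in S, 1 / 24 * Q (hessian S v x))
    - 1 / ε * (∫ x in S, (f x * v x + ∑ i, g i x * u i x))

/-- `Q¹(q₁₁, q₁₂) = min_α Q²(q₁₁, q₁₂, α)`. -/
def reducedQ₁ (Q : QuadraticForm ℝ (Matrix (Fin 2) (Fin 2) ℝ)) (q₁₁ q₁₂ : ℝ) : ℝ :=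
  ⨅ α : ℝ, Q !![q₁₁, q₁₂; q₁₂, α]

/-- `Q⁰(q₁₁) = min_z Q¹(q₁₁, z)`. -/
def reducedQ₀ (Q : QuadraticForm ℝ (Matrix (Fin 2) (Fin 2) ℝ)) (q₁₁ : ℝ) : ℝ :=
  ⨅ z : ℝ, reducedQ₁ Q q₁₁ z

/-- The limiting energy `φ₀(y, w, θ)` with force densities `f`, `g` on `I`; functions on `I` are
regarded as functions on `S` that do not depend on `x₂`. -/
def energy1D (Q : QuadraticForm ℝ (Matrix (Fin 2) (Fin 2) ℝ)) (l : ℝ)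
    (f : ℝ → ℝ) (g : Fin 2 → ℝ → ℝ)
    (y : Fin 2 → ℝ × ℝ → ℝ) (w θ : ℝ → ℝ) : ℝ :=
  1 / 2 * (∫ x in rect l 1, reducedQ₀ Q (pd (rect l 1) 0 (y 0) x + (D l w x.1) ^ 2 / 2))
    + 1 / 24 * (∫ t in interval l, reducedQ₁ Q (D l (D l w) t) (D l θ t))
    - ∫ x in rect l 1, (f x.1 * w x.1 + ∑ i, g i x.1 * y i x)

/-! ### Convergence of displacements to limiting variables -/

/-- Convergence of `(u_ε, v_ε)` along a sequence `ε n → 0` to `(y, w, θ)`, where `conv` is the mode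
of convergence in `L²` (weak or strong). -/
def RibbonConv
    (conv : Set (ℝ × ℝ) → (ℕ → ℝ × ℝ → ℝ) → (ℝ × ℝ → ℝ) → Prop)
    (l : ℝ) (ε : ℕ → ℝ) (u : ℕ → Fin 2 → ℝ × ℝ → ℝ) (v : ℕ → ℝ × ℝ → ℝ)
    (y : Fin 2 → ℝ × ℝ → ℝ) (w θ : ℝ → ℝ) : Prop :=
  let S := rect l 1
  let yε : ℕ → Fin 2 → ℝ × ℝ → ℝ := fun n => scaledU (ε n) (u n)
  let wε : ℕ → ℝ × ℝ → ℝ := fun n => scaledV (ε n) (v n)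
  ConvW22 conv S wε (fun x => w x.1) ∧
  ConvW12 conv S (fun n => scaledGrad l (ε n) (wε n) 0) (fun x => D l w x.1) ∧
  ConvW12 conv S (fun n => scaledGrad l (ε n) (wε n) 1) (fun x => θ x.1) ∧
  (∃ γ : ℝ × ℝ → ℝ, MemL2 S γ ∧ ∀ i j : Fin 2,
    conv S (fun n x => scaledHessian l (ε n) (wε n) x i j)
      (fun x => !![D l (D l w) x.1, D l θ x.1; D l θ x.1, γ x] i j)) ∧
  (∀ i, ConvW12 conv S (fun n => yε n i) (y i)) ∧
  (∃ E : ℝ × ℝ → Matrix (Fin 2) (Fin 2) ℝ,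
    (∀ i j, MemL2 S (fun x => E x i j)) ∧ (∀ x, (E x).IsSymm) ∧
    (∀ᵐ x ∂(volume.restrict S), E x 0 0 = pd S 0 (y 0) x) ∧
    ∀ i j : Fin 2,
      conv S (fun n x => scaledStrain l (ε n) (yε n) x i j) (fun x => E x i j))

/-- Weak convergence `(u_ε, v_ε) → (y, w, θ)` (the convergence `πσ`). -/
def ConvPiSigma (l : ℝ) (ε : ℕ → ℝ) (u : ℕ → Fin 2 → ℝ × ℝ → ℝ) (v : ℕ → ℝ × ℝ → ℝ)
    (y : Fin 2 → ℝ × ℝ → ℝ) (w θ : ℝ → ℝ) : Prop :=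
  RibbonConv WeakL2 l ε u v y w θ

/-- Strong convergence `(u_ε, v_ε) → (y, w, θ)` (the convergence `πρ`). -/
def ConvPiRho (l : ℝ) (ε : ℕ → ℝ) (u : ℕ → Fin 2 → ℝ × ℝ → ℝ) (v : ℕ → ℝ × ℝ → ℝ)
    (y : Fin 2 → ℝ × ℝ → ℝ) (w θ : ℝ → ℝ) : Prop :=
  RibbonConv StrongL2 l ε u v y w θ

end Ribbon

end

open Ribbon

/-!
The energies are quadratic in the scaled strain `K = E + ½ p ⊗ p` and the scaled Hessian
`H`, up to forces that converge by compactness. Expanding a quadratic form,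
`∫ Q(Aₙ) = ∫ Q(A) + 2 ∫ B(Aₙ - A, A) + ∫ Q(Aₙ - A)`, where the middle term vanishes along a weakly
convergent sequence. Since the limit energy is built from the minima of `Q` over the remaining
entries, it is at most `½ ∫ Q(K) + 1/24 ∫ Q(H)`, so convergence of the energies forces
`∫ Q(Kₙ - K)` and `∫ Q(Hₙ - H)` to vanish, and coercivity of `Q` on symmetric matrices makes `Kₙ`
and `Hₙ` converge strongly.

What remains is to recover the displacements. In two dimensions `W^{1,2}` embeds compactly in `L⁴`
(Rellich's theorem in `L²` combined with Ladyzhenskaya's inequality), so `pₙ ⊗ pₙ` converges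
strongly in `L²`, and hence so does `Eₙ`. The second derivatives of `wₙ` are entries of `Hₙ` times
nonnegative powers of `εₙ`. The strain of `yₙ` converges strongly because its entries are those of
`Eₙ` times such powers, and Korn's inequality controls the whole gradient of `yₙ`.

Functions in `W^{1,2}` of a bounded convex domain are approximated by functions smooth up to the
boundary by mollifying a contracted copy, which also gives Rellich's theorem. Korn's inequality for
smooth functions is proved on the quarter plane and transferred to the rectangle by cutting off at
the four corners. On the quarter plane the rotation is controlled through the null Lagrangian
`∂₂a ∂₁b - ∂₁a ∂₂b`, whose integral depends only on the boundary values. Continuing the displacement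
to the other three quarters by Nitsche's extension, which does not increase the strain by more than
a constant factor, makes the four boundary contributions cancel.
-/

noncomputable section

namespace Ribbon

section L2

variable {E : Type*} [MeasureSpace E] {Ω : Set E}

namespace MemL2

variable {f g h : E → ℝ}

lemma add (hf : MemL2 Ω f) (hg : MemL2 Ω g) : MemL2 Ω (fun x => f x + g x) :=
  MemLp.add hf hg

lemma sub (hf : MemL2 Ω f) (hg : MemL2 Ω g) : MemL2 Ω (fun x => f x - g x) :=
  MemLp.sub hf hg

lemma const_mul (hf : MemL2 Ω f) (c : ℝ) : MemL2 Ω (fun x => c * f x) :=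
  MemLp.const_mul hf c

lemma congr_ae (hf : MemL2 Ω f) (hfg : f =ᵐ[volume.restrict Ω] g) : MemL2 Ω g :=
  (memLp_congr_ae hfg).1 hf

lemma integrableOn (hΩ : volume Ω ≠ ⊤) (hf : MemL2 Ω f) : IntegrableOn f Ω := by
  have : IsFiniteMeasure (volume.restrict Ω) := ⟨by simpa using hΩ.lt_top⟩
  exact MemLp.integrable one_le_two hf

lemma integrableOn_sq (hf : MemL2 Ω f) : IntegrableOn (fun x => f x ^ 2) Ω :=
  MemLp.integrable_sq hf

lemma integrableOn_mul (hf : MemL2 Ω f) (hg : MemL2 Ω g) :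
    IntegrableOn (fun x => f x * g x) Ω :=
  MemLp.integrable_mul hf hg

lemma eLpNorm_eq (hf : MemL2 Ω f) :
    eLpNorm f 2 (volume.restrict Ω) = ENNReal.ofReal (√(∫ x in Ω, f x ^ 2)) := by
  rw [MemLp.eLpNorm_eq_integral_rpow_norm two_ne_zero ENNReal.ofNat_ne_top hf, Real.sqrt_eq_rpow]
  norm_num

lemma integral_abs_mul_le (hf : MemL2 Ω f) (hg : MemL2 Ω g) :
    ∫ x in Ω, |f x * g x| ≤ √(∫ x in Ω, f x ^ 2) * √(∫ x in Ω, g x ^ 2) := by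
  have h := integral_mul_norm_le_Lp_mul_Lq (μ := volume.restrict Ω) (f := f) (g := g)
    Real.HolderConjugate.two_two (by simpa [MemL2] using hf) (by simpa [MemL2] using hg)
  simpa [abs_mul, Real.sqrt_eq_rpow] using h

lemma abs_integral_mul_le (hf : MemL2 Ω f) (hg : MemL2 Ω g) :
    |∫ x in Ω, f x * g x| ≤ √(∫ x in Ω, f x ^ 2) * √(∫ x in Ω, g x ^ 2) :=
  abs_integral_le_integral_abs.trans (hf.integral_abs_mul_le hg)

lemma sq_integral_mul_le (hf : MemL2 Ω f) (hg : MemL2 Ω g) :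
    (∫ x in Ω, f x * g x) ^ 2 ≤ (∫ x in Ω, f x ^ 2) * ∫ x in Ω, g x ^ 2 := by
  have hf0 : 0 ≤ ∫ x in Ω, f x ^ 2 := integral_nonneg fun _ => sq_nonneg _
  have hg0 : 0 ≤ ∫ x in Ω, g x ^ 2 := integral_nonneg fun _ => sq_nonneg _
  calc (∫ x in Ω, f x * g x) ^ 2
      = |∫ x in Ω, f x * g x| ^ 2 := (sq_abs _).symm
    _ ≤ (√(∫ x in Ω, f x ^ 2) * √(∫ x in Ω, g x ^ 2)) ^ 2 := by
        gcongr
        exact hf.abs_integral_mul_le hg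
    _ = (∫ x in Ω, f x ^ 2) * ∫ x in Ω, g x ^ 2 := by
        rw [mul_pow, Real.sq_sqrt hf0, Real.sq_sqrt hg0]

lemma integral_add_sq_le (hf : MemL2 Ω f) (hg : MemL2 Ω g) :
    ∫ x in Ω, (f x + g x) ^ 2 ≤ 2 * (∫ x in Ω, f x ^ 2) + 2 * ∫ x in Ω, g x ^ 2 := by
  have hf2 := hf.integrableOn_sq.const_mul 2
  have hg2 := hg.integrableOn_sq.const_mul 2
  rw [← integral_const_mul, ← integral_const_mul, ← integral_add hf2 hg2]
  refine integral_mono (hf.add hg).integrableOn_sq (hf2.add hg2) fun x => ?_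
  simpa [mul_add] using add_sq_le (a := f x) (b := g x)

end MemL2

lemma strongL2_iff {F : ℕ → E → ℝ} {G : E → ℝ} :
    StrongL2 Ω F G ↔ (∀ n, MemL2 Ω (F n)) ∧ MemL2 Ω G ∧
      Tendsto (fun n => ∫ x in Ω, (F n x - G x) ^ 2) atTop (𝓝 0) := by
  refine and_congr_right fun hF => and_congr_right fun hG => ?_
  simp_rw [fun n => ((hF n).sub hG).eLpNorm_eq]
  have h0 : ∀ n, 0 ≤ ∫ x in Ω, (F n x - G x) ^ 2 := fun n => integral_nonneg fun _ => sq_nonneg _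
  constructor <;> intro h
  · simpa [ENNReal.toReal_ofReal, Real.sq_sqrt (h0 _)] using
      ((ENNReal.tendsto_toReal ENNReal.zero_ne_top).comp h).pow 2
  · simpa using ENNReal.tendsto_ofReal h.sqrt

namespace StrongL2

variable {F F' : ℕ → E → ℝ} {G G' : E → ℝ}

lemma congr_ae (h : StrongL2 Ω F G) (hF : ∀ n, F n =ᵐ[volume.restrict Ω] F' n)
    (hG : G =ᵐ[volume.restrict Ω] G') : StrongL2 Ω F' G' :=
  ⟨fun n => (h.1 n).congr_ae (hF n), h.2.1.congr_ae hG,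
    h.2.2.congr fun n => eLpNorm_congr_ae ((hF n).sub hG)⟩

lemma const (hG : MemL2 Ω G) : StrongL2 Ω (fun _ => G) G :=
  ⟨fun _ => hG, hG, by simp⟩

lemma add (h : StrongL2 Ω F G) (h' : StrongL2 Ω F' G') :
    StrongL2 Ω (fun n x => F n x + F' n x) (fun x => G x + G' x) := by
  refine ⟨fun n => (h.1 n).add (h'.1 n), h.2.1.add h'.2.1, ?_⟩
  refine tendsto_of_tendsto_of_tendsto_of_le_of_le tendsto_const_nhds
    (by simpa using h.2.2.add h'.2.2) (fun n => zero_le) fun n => ?_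
  simpa only [Pi.add_def, add_sub_add_comm] using eLpNorm_add_le
    ((h.1 n).sub h.2.1).aestronglyMeasurable ((h'.1 n).sub h'.2.1).aestronglyMeasurable one_le_two

lemma const_mul (h : StrongL2 Ω F G) {c : ℕ → ℝ} {c₀ : ℝ} (hc : Tendsto c atTop (𝓝 c₀)) :
    StrongL2 Ω (fun n x => c n * F n x) (fun x => c₀ * G x) := by
  rw [strongL2_iff] at *
  refine ⟨fun n => (h.1 n).const_mul _, h.2.1.const_mul _, ?_⟩
  have hc2 : Tendsto (fun n => (c n - c₀) ^ 2) atTop (𝓝 0) := by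
    simpa using (hc.sub_const c₀).pow 2
  have hbound := (((hc.pow 2).mul h.2.2).const_mul 2).add
    ((hc2.mul_const (∫ x in Ω, G x ^ 2)).const_mul 2)
  simp only [mul_zero, add_zero, zero_mul] at hbound
  refine squeeze_zero (fun n => integral_nonneg fun _ => sq_nonneg _) (fun n => ?_) hbound
  have hsplit : ∀ x, c n * F n x - c₀ * G x = c n * (F n x - G x) + (c n - c₀) * G x :=
    fun x => by ring
  simpa only [hsplit, mul_pow, integral_const_mul] using
    (((h.1 n).sub h.2.1).const_mul (c n)).integral_add_sq_le (h.2.1.const_mul (c n - c₀))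

lemma sub (h : StrongL2 Ω F G) (h' : StrongL2 Ω F' G') :
    StrongL2 Ω (fun n x => F n x - F' n x) (fun x => G x - G' x) := by
  simpa [sub_eq_add_neg] using h.add (h'.const_mul (tendsto_const_nhds (x := (-1 : ℝ))))

lemma of_forall_approx (hF : ∀ n, MemL2 Ω (F n)) (hG : MemL2 Ω G)
    (happ : ∀ b > 0, ∃ F' G', StrongL2 Ω F' G' ∧ (∀ n, ∫ x in Ω, (F n x - F' n x) ^ 2 ≤ b) ∧
      ∫ x in Ω, (G' x - G x) ^ 2 ≤ b) : StrongL2 Ω F G := by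
  refine strongL2_iff.2 ⟨hF, hG, Metric.tendsto_atTop.2 fun a ha => ?_⟩
  obtain ⟨F', G', h, hFF', hGG'⟩ := happ (a / 12) (by positivity)
  obtain ⟨hF', hG', hlim⟩ := strongL2_iff.1 h
  obtain ⟨N, hN⟩ := eventually_atTop.1 (hlim.eventually (gt_mem_nhds (by positivity : 0 < a / 8)))
  refine ⟨N, fun n hn => ?_⟩
  rw [Real.dist_eq, sub_zero, abs_of_nonneg (integral_nonneg fun _ => sq_nonneg _)]
  have h₁ := ((hF n).sub (hF' n)).integral_add_sq_le ((hF' n).sub hG)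
  have h₂ := ((hF' n).sub hG').integral_add_sq_le (hG'.sub hG)
  simp only [sub_add_sub_cancel] at h₁ h₂
  linarith [hN n hn, hFF' n]

end StrongL2

namespace WeakL2

variable {F F' : ℕ → E → ℝ} {G G' : E → ℝ}

lemma congr_ae (h : WeakL2 Ω F G) (hF : ∀ n, F n =ᵐ[volume.restrict Ω] F' n)
    (hG : G =ᵐ[volume.restrict Ω] G') : WeakL2 Ω F' G' := by
  refine ⟨fun n => (h.1 n).congr_ae (hF n), h.2.1.congr_ae hG, fun ψ hψ => ?_⟩
  have hlim : ∫ x in Ω, G x * ψ x = ∫ x in Ω, G' x * ψ x :=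
    integral_congr_ae (hG.mul (ae_eq_refl ψ))
  rw [← hlim]
  exact (h.2.2 ψ hψ).congr fun n => integral_congr_ae ((hF n).mul (ae_eq_refl ψ))

lemma add (h : WeakL2 Ω F G) (h' : WeakL2 Ω F' G') :
    WeakL2 Ω (fun n x => F n x + F' n x) (fun x => G x + G' x) := by
  refine ⟨fun n => (h.1 n).add (h'.1 n), h.2.1.add h'.2.1, fun ψ hψ => ?_⟩
  simp only [add_mul]
  rw [integral_add (h.2.1.integrableOn_mul hψ) (h'.2.1.integrableOn_mul hψ)]
  refine ((h.2.2 ψ hψ).add (h'.2.2 ψ hψ)).congr fun n => ?_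
  rw [integral_add ((h.1 n).integrableOn_mul hψ) ((h'.1 n).integrableOn_mul hψ)]

lemma const_mul (h : WeakL2 Ω F G) (c : ℝ) :
    WeakL2 Ω (fun n x => c * F n x) (fun x => c * G x) := by
  refine ⟨fun n => (h.1 n).const_mul c, h.2.1.const_mul c, fun ψ hψ => ?_⟩
  simp only [mul_assoc, integral_const_mul]
  exact (h.2.2 ψ hψ).const_mul c

lemma bounded (h : WeakL2 Ω F G) : ∃ C, ∀ n, ∫ x in Ω, F n x ^ 2 ≤ C := by
  have hm : ∀ n, MemLp (F n) 2 (volume.restrict Ω) := h.1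
  have inner_toLp : ∀ (n : ℕ) (ψ : Lp ℝ 2 (volume.restrict Ω)),
      inner ℝ ((hm n).toLp (F n)) ψ = ∫ x in Ω, F n x * ψ x := by
    intro n ψ
    rw [L2.inner_def]
    refine integral_congr_ae ?_
    filter_upwards [(hm n).coeFn_toLp] with x hx
    rw [hx]
    simp [mul_comm]
  obtain ⟨C, hC⟩ := banach_steinhaus (g := fun n => innerSL ℝ ((hm n).toLp (F n))) fun ψ => by
    obtain ⟨C, hC⟩ := (h.2.2 ψ (Lp.memLp ψ)).norm.bddAbove_range
    refine ⟨C, fun n => ?_⟩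
    rw [innerSL_apply_apply, inner_toLp]
    exact hC ⟨n, rfl⟩
  refine ⟨C ^ 2, fun n => (Real.sqrt_le_left ((norm_nonneg _).trans (hC n))).1 ?_⟩
  simpa only [innerSL_apply_norm, Lp.norm_toLp, (h.1 n).eLpNorm_eq,
    ENNReal.toReal_ofReal (Real.sqrt_nonneg _)] using hC n

lemma tendsto_integral_mul (h : WeakL2 Ω F G) (h' : StrongL2 Ω F' G') :
    Tendsto (fun n => ∫ x in Ω, F n x * F' n x) atTop (𝓝 (∫ x in Ω, G x * G' x)) := by
  obtain ⟨C, hC⟩ := h.bounded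
  rw [strongL2_iff] at h'
  have herr : Tendsto (fun n => ∫ x in Ω, F n x * (F' n x - G' x)) atTop (𝓝 0) := by
    refine squeeze_zero_norm (fun n => ?_) (by simpa using h'.2.2.sqrt.const_mul (√C))
    refine ((h.1 n).abs_integral_mul_le ((h'.1 n).sub h'.2.1)).trans ?_
    gcongr
    exact hC n
  refine (add_zero (∫ x in Ω, G x * G' x) ▸ (h.2.2 G' h'.2.1).add herr).congr fun n => ?_
  rw [← integral_add ((h.1 n).integrableOn_mul h'.2.1)
    ((h.1 n).integrableOn_mul ((h'.1 n).sub h'.2.1))]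
  simp only [← mul_add, add_sub_cancel]

lemma ae_unique (h : WeakL2 Ω F G) (h' : WeakL2 Ω F G') : G =ᵐ[volume.restrict Ω] G' := by
  have hd := h.2.1.sub h'.2.1
  have hzero : ∫ x in Ω, (G x - G' x) ^ 2 = 0 := by
    simp only [sq, sub_mul _ _ (G _ - G' _)]
    rw [integral_sub (h.2.1.integrableOn_mul hd) (h'.2.1.integrableOn_mul hd),
      tendsto_nhds_unique (h.2.2 _ hd) (h'.2.2 _ hd), sub_self]
  rw [integral_eq_zero_iff_of_nonneg (fun _ => sq_nonneg _) hd.integrableOn_sq] at hzero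
  filter_upwards [hzero] with x hx
  exact sub_eq_zero.1 (pow_eq_zero_iff two_ne_zero |>.1 hx)

end WeakL2

namespace StrongL2

variable {F F' : ℕ → E → ℝ} {G G' : E → ℝ}

lemma weakL2 (h : StrongL2 Ω F G) : WeakL2 Ω F G := by
  refine ⟨h.1, h.2.1, fun ψ hψ => ?_⟩
  have hconst : WeakL2 Ω (fun _ => ψ) ψ := ⟨fun _ => hψ, hψ, fun _ _ => tendsto_const_nhds⟩
  simpa [mul_comm] using hconst.tendsto_integral_mul h

lemma tendsto_integral_sq (h : StrongL2 Ω F G) :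
    Tendsto (fun n => ∫ x in Ω, F n x ^ 2) atTop (𝓝 (∫ x in Ω, G x ^ 2)) := by
  simpa only [sq] using h.weakL2.tendsto_integral_mul h

end StrongL2

lemma WeakL2.sub_limit {F : ℕ → E → ℝ} {G : E → ℝ} (h : WeakL2 Ω F G) :
    WeakL2 Ω (fun n x => F n x - G x) (fun _ => 0) := by
  simpa [sub_eq_add_neg] using h.add ((StrongL2.const h.2.1).weakL2.const_mul (-1))

lemma WeakL2.strongL2_of_congr_ae {F F' : ℕ → E → ℝ} {G G' : E → ℝ} (h : WeakL2 Ω F G)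
    (h' : StrongL2 Ω F' G') (hF : ∀ n, F' n =ᵐ[volume.restrict Ω] F n) : StrongL2 Ω F G :=
  h'.congr_ae hF ((h'.congr_ae hF (ae_eq_refl _)).weakL2.ae_unique h)

end L2

section WeakDerivative

lemma MemL2.locallyIntegrableOn {E : Type*} [NormedAddCommGroup E] [MeasureSpace E] {Ω : Set E}
    (hΩ : volume Ω ≠ ⊤) {f : E → ℝ} (h : MemL2 Ω f) : LocallyIntegrableOn f Ω :=
  (h.integrableOn hΩ).locallyIntegrableOn

lemma integrableOn_mul_of_tsupport_subset {E : Type*} [NormedAddCommGroup E] [MeasureSpace E]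
    [BorelSpace E] {Ω : Set E} {k φ : E → ℝ} (hk : LocallyIntegrableOn k Ω) (hφ : Continuous φ)
    (hc : HasCompactSupport φ) (hφΩ : tsupport φ ⊆ Ω) :
    IntegrableOn (fun x => k x * φ x) Ω := by
  have hK : IntegrableOn (fun x => k x * φ x) (tsupport φ) :=
    (hk.integrableOn_compact_subset hφΩ hc).mul_continuousOn hφ.continuousOn hc
  exact (hK.integrable_of_forall_notMem_eq_zero fun x hx => by
    simp [image_eq_zero_of_notMem_tsupport hx]).integrableOn

variable {E : Type*} [NormedAddCommGroup E] [NormedSpace ℝ E] {Ω : Set E}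

section TestFunctions

variable {φ : E → ℝ}

lemma tsupport_fderiv_apply_subset_of_subset (e : E) (hφΩ : tsupport φ ⊆ Ω) :
    tsupport (fun x => fderiv ℝ φ x e) ⊆ Ω :=
  (tsupport_fderiv_apply_subset ℝ e).trans hφΩ

lemma contDiff_fderiv_apply (hφ : ContDiff ℝ ∞ φ) (e : E) :
    ContDiff ℝ ∞ fun x => fderiv ℝ φ x e :=
  (hφ.fderiv_right (m := ∞) (by simp)).clm_apply contDiff_const

lemma continuous_fderiv_apply (hφ : ContDiff ℝ ∞ φ) (e : E) :
    Continuous fun x => fderiv ℝ φ x e :=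
  (contDiff_fderiv_apply hφ e).continuous

lemma fderiv_fderiv_apply_comm (hφ : ContDiff ℝ ∞ φ) (e e' x : E) :
    fderiv ℝ (fun x => fderiv ℝ φ x e') x e = fderiv ℝ (fun x => fderiv ℝ φ x e) x e' := by
  have hdiff : DifferentiableAt ℝ (fderiv ℝ φ) x :=
    (hφ.fderiv_right (m := ∞) (by simp)).differentiable (by simp) x
  have hsymm : IsSymmSndFDerivAt ℝ φ x := hφ.contDiffAt.isSymmSndFDerivAt <| by
    rw [minSmoothness_of_isRCLikeNormedField]
    exact WithTop.coe_le_coe.2 (le_top (a := (2 : ℕ∞)))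
  rw [fderiv_clm_apply hdiff (differentiableAt_const _),
    fderiv_clm_apply hdiff (differentiableAt_const _)]
  simpa using hsymm.eq e e'

variable [MeasureSpace E] [BorelSpace E] {k : E → ℝ}

lemma integrableOn_mul_fderiv_of_tsupport_subset (hk : LocallyIntegrableOn k Ω)
    (hφ : ContDiff ℝ ∞ φ) (hc : HasCompactSupport φ) (hφΩ : tsupport φ ⊆ Ω) (e : E) :
    IntegrableOn (fun x => k x * fderiv ℝ φ x e) Ω :=
  integrableOn_mul_of_tsupport_subset hk (continuous_fderiv_apply hφ e)
    (hc.fderiv_apply ℝ e) (tsupport_fderiv_apply_subset_of_subset e hφΩ)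

end TestFunctions

variable [MeasureSpace E]

namespace HasWeakDeriv

variable {e e' : E} {f f' g g' : E → ℝ}

lemma hasWeakDeriv_weakDeriv (h : HasWeakDeriv Ω e f g) :
    HasWeakDeriv Ω e f (weakDeriv Ω e f) := by
  have hex : ∃ g, HasWeakDeriv Ω e f g := ⟨g, h⟩
  rw [weakDeriv, dif_pos hex]
  exact hex.choose_spec

lemma congr_ae (h : HasWeakDeriv Ω e f g) (hf : f =ᵐ[volume.restrict Ω] f')
    (hg : g =ᵐ[volume.restrict Ω] g') (hf' : LocallyIntegrableOn f' Ω)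
    (hg' : LocallyIntegrableOn g' Ω) : HasWeakDeriv Ω e f' g' := by
  refine ⟨hf', hg', fun φ hφ hc hφΩ => ?_⟩
  have hleft : ∫ x in Ω, f x * fderiv ℝ φ x e = ∫ x in Ω, f' x * fderiv ℝ φ x e :=
    integral_congr_ae (hf.mul (ae_eq_refl _))
  have hright : ∫ x in Ω, g x * φ x = ∫ x in Ω, g' x * φ x :=
    integral_congr_ae (hg.mul (ae_eq_refl _))
  rw [← hleft, ← hright]
  exact h.2.2 φ hφ hc hφΩ

lemma const_mul (h : HasWeakDeriv Ω e f g) (c : ℝ) :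
    HasWeakDeriv Ω e (fun x => c * f x) (fun x => c * g x) := by
  refine ⟨h.1.smul c, h.2.1.smul c, fun φ hφ hc hφΩ => ?_⟩
  simp only [mul_assoc, integral_const_mul]
  rw [h.2.2 φ hφ hc hφΩ, mul_neg]

lemma smul_dir (h : HasWeakDeriv Ω e f g) (c : ℝ) :
    HasWeakDeriv Ω (c • e) f (fun x => c * g x) := by
  refine ⟨h.1, h.2.1.smul c, fun φ hφ hc hφΩ => ?_⟩
  simp only [map_smul, smul_eq_mul, mul_left_comm _ c, mul_assoc, integral_const_mul]
  rw [h.2.2 φ hφ hc hφΩ, mul_neg]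

variable [BorelSpace E]

lemma add (h : HasWeakDeriv Ω e f g) (h' : HasWeakDeriv Ω e f' g') :
    HasWeakDeriv Ω e (fun x => f x + f' x) (fun x => g x + g' x) := by
  refine ⟨h.1.add h'.1, h.2.1.add h'.2.1, fun φ hφ hc hφΩ => ?_⟩
  simp only [add_mul]
  rw [integral_add (integrableOn_mul_fderiv_of_tsupport_subset h.1 hφ hc hφΩ e)
      (integrableOn_mul_fderiv_of_tsupport_subset h'.1 hφ hc hφΩ e),
    integral_add (integrableOn_mul_of_tsupport_subset h.2.1 hφ.continuous hc hφΩ)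
      (integrableOn_mul_of_tsupport_subset h'.2.1 hφ.continuous hc hφΩ),
    h.2.2 φ hφ hc hφΩ, h'.2.2 φ hφ hc hφΩ, neg_add]

lemma add_dir (h : HasWeakDeriv Ω e f g) (h' : HasWeakDeriv Ω e' f g') :
    HasWeakDeriv Ω (e + e') f (fun x => g x + g' x) := by
  refine ⟨h.1, h.2.1.add h'.2.1, fun φ hφ hc hφΩ => ?_⟩
  simp only [map_add, mul_add, add_mul]
  rw [integral_add (integrableOn_mul_fderiv_of_tsupport_subset h.1 hφ hc hφΩ e)
      (integrableOn_mul_fderiv_of_tsupport_subset h.1 hφ hc hφΩ e'),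
    integral_add (integrableOn_mul_of_tsupport_subset h.2.1 hφ.continuous hc hφΩ)
      (integrableOn_mul_of_tsupport_subset h'.2.1 hφ.continuous hc hφΩ),
    h.2.2 φ hφ hc hφΩ, h'.2.2 φ hφ hc hφΩ, neg_add]

lemma sub (h : HasWeakDeriv Ω e f g) (h' : HasWeakDeriv Ω e f' g') :
    HasWeakDeriv Ω e (fun x => f x - f' x) (fun x => g x - g' x) := by
  simpa only [neg_mul, one_mul, ← sub_eq_add_neg] using h.add (h'.const_mul (-1))

variable [FiniteDimensional ℝ E]

lemma ae_unique (hΩ : IsOpen Ω) (h : HasWeakDeriv Ω e f g) (h' : HasWeakDeriv Ω e f g') :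
    g =ᵐ[volume.restrict Ω] g' := by
  have htest : ∀ φ : E → ℝ, ContDiff ℝ ∞ φ → HasCompactSupport φ → tsupport φ ⊆ Ω →
      ∫ x, φ x • (g x - g' x) = 0 := by
    intro φ hφ hc hφΩ
    have hzero : ∀ x, x ∉ Ω → φ x = 0 := fun x hx =>
      image_eq_zero_of_notMem_tsupport fun hx' => hx (hφΩ hx')
    rw [← setIntegral_eq_integral_of_forall_compl_eq_zero (s := Ω)
      fun x hx => by simp [hzero x hx]]
    simp only [smul_eq_mul, mul_comm (φ _), sub_mul]
    rw [integral_sub (integrableOn_mul_of_tsupport_subset h.2.1 hφ.continuous hc hφΩ)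
      (integrableOn_mul_of_tsupport_subset h'.2.1 hφ.continuous hc hφΩ), sub_eq_zero, ← neg_inj,
      ← h.2.2 φ hφ hc hφΩ, ← h'.2.2 φ hφ hc hφΩ]
  have hae := hΩ.ae_eq_zero_of_integral_contDiff_smul_eq_zero (h.2.1.sub h'.2.1) htest
  rw [Filter.EventuallyEq, ae_restrict_iff' hΩ.measurableSet]
  filter_upwards [hae] with x hx hxΩ
  exact sub_eq_zero.1 (hx hxΩ)

lemma ae_eq_weakDeriv (hΩ : IsOpen Ω) (h : HasWeakDeriv Ω e f g) :
    g =ᵐ[volume.restrict Ω] weakDeriv Ω e f :=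
  h.ae_unique hΩ h.hasWeakDeriv_weakDeriv

lemma comm (hΩ : IsOpen Ω) {h h' : E → ℝ} (hg : HasWeakDeriv Ω e f g)
    (hg' : HasWeakDeriv Ω e' f g') (hh : HasWeakDeriv Ω e' g h) (hh' : HasWeakDeriv Ω e g' h') :
    h =ᵐ[volume.restrict Ω] h' := by
  refine ae_unique hΩ hh ⟨hg.2.1, hh'.2.1, fun φ hφ hc hφΩ => ?_⟩
  have he' := hg.2.2 _ (contDiff_fderiv_apply hφ e') (hc.fderiv_apply ℝ e')
    (tsupport_fderiv_apply_subset_of_subset e' hφΩ)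
  have he := hg'.2.2 _ (contDiff_fderiv_apply hφ e) (hc.fderiv_apply ℝ e)
    (tsupport_fderiv_apply_subset_of_subset e hφΩ)
  simp_rw [fderiv_fderiv_apply_comm hφ e e'] at he'
  linarith [hh'.2.2 φ hφ hc hφΩ]

end HasWeakDeriv

namespace MemW12

variable {f f' : E → ℝ}

lemma hasWeakDeriv (h : MemW12 Ω f) (e : E) : HasWeakDeriv Ω e f (weakDeriv Ω e f) := by
  obtain ⟨g, -, hg⟩ := h.2 e
  exact hg.hasWeakDeriv_weakDeriv

variable [BorelSpace E] [FiniteDimensional ℝ E]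

lemma memL2_weakDeriv (hΩ : IsOpen Ω) (h : MemW12 Ω f) (e : E) :
    MemL2 Ω (weakDeriv Ω e f) := by
  obtain ⟨g, hg, hfg⟩ := h.2 e
  exact hg.congr_ae (hfg.ae_eq_weakDeriv hΩ)

lemma sub (hΩ : IsOpen Ω) (h : MemW12 Ω f) (h' : MemW12 Ω f') :
    MemW12 Ω (fun x => f x - f' x) :=
  ⟨h.1.sub h'.1, fun e => ⟨_, (h.memL2_weakDeriv hΩ e).sub (h'.memL2_weakDeriv hΩ e),
    (h.hasWeakDeriv e).sub (h'.hasWeakDeriv e)⟩⟩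

end MemW12

lemma weakDeriv_sub_ae [BorelSpace E] [FiniteDimensional ℝ E] (hΩ : IsOpen Ω) {e : E}
    {f f' : E → ℝ} (h : MemW12 Ω f) (h' : MemW12 Ω f') :
    weakDeriv Ω e (fun x => f x - f' x)
      =ᵐ[volume.restrict Ω] fun x => weakDeriv Ω e f x - weakDeriv Ω e f' x :=
  (((h.hasWeakDeriv e).sub (h'.hasWeakDeriv e)).ae_eq_weakDeriv hΩ).symm

end WeakDerivative

section Mollification

lemma norm_sub_le_of_mem_closedBall {E : Type*} [NormedAddCommGroup E]
    [NormedSpace ℝ E] {x z : E} {δ M r : ℝ} (hδ : 0 ≤ δ) (hx : ‖x‖ ≤ M)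
    (hz : z ∈ Metric.closedBall ((1 - δ) • x) r) : ‖z - x‖ ≤ δ * M + r := by
  have hsplit : z - x = (z - (1 - δ) • x) + (-δ) • x := by module
  rw [Metric.mem_closedBall, dist_eq_norm] at hz
  rw [hsplit]
  refine (norm_add_le _ _).trans ?_
  rw [norm_smul, norm_neg, Real.norm_of_nonneg hδ, add_comm]
  gcongr

variable {E : Type*} [NormedAddCommGroup E] [NormedSpace ℝ E] [FiniteDimensional ℝ E]
  [MeasureSpace E]

/-- Mollification of the restriction of `f` to `Ω`. The argument is first contracted by the factor
`1 - δ`, so that no values outside of `Ω` enter if `Ω` is convex and the support of `ρ` is small: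
this is what gives approximations that are smooth up to the boundary. -/
def mollify (ρ : ContDiffBump (0 : E)) (δ : ℝ) (Ω : Set E) (f : E → ℝ) (x : E) : ℝ :=
  ∫ z in Ω, ρ.normed volume ((1 - δ) • x - z) * f z

variable {ρ : ContDiffBump (0 : E)} {δ : ℝ} {Ω : Set E} {f g : E → ℝ} {w x z : E}

lemma contDiff_normed : ContDiff ℝ ∞ (ρ.normed (volume : Measure E)) :=
  ρ.contDiff_normed (n := ⊤)

lemma continuous_normed_sub (w : E) : Continuous fun z => ρ.normed volume (w - z) :=
  ρ.continuous_normed.comp (continuous_const.sub continuous_id)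

lemma fderiv_normed_sub (w z e : E) :
    fderiv ℝ (fun z => ρ.normed volume (w - z)) z e = -fderiv ℝ (ρ.normed volume) (w - z) e := by
  have h := ((contDiff_normed (ρ := ρ)).differentiable (by simp) (w - z)).hasFDerivAt.comp z
    ((hasFDerivAt_id z).const_sub w)
  rw [show (fun z => ρ.normed volume (w - z)) = ρ.normed volume ∘ fun z => w - z from rfl,
    h.fderiv]
  simp

lemma mollify_eq_convolution_comp (hΩ : MeasurableSet Ω) :
    mollify ρ δ Ω f = (convolution (Ω.indicator f) (ρ.normed volume)
      (ContinuousLinearMap.mul ℝ ℝ) volume) ∘ fun x => (1 - δ) • x := by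
  funext x
  rw [Function.comp_apply, convolution_def, mollify, ← integral_indicator hΩ]
  congr 1 with z
  by_cases h : z ∈ Ω <;> simp [h, mul_comm]

variable [BorelSpace E] [(volume : Measure E).IsAddHaarMeasure]

section Kernel

lemma mem_closedBall_of_normed_sub_ne_zero (h : ρ.normed volume (w - z) ≠ 0) :
    z ∈ Metric.closedBall w ρ.rOut := by
  have hmem : w - z ∈ Function.support (ρ.normed volume) := h
  rw [ρ.support_normed_eq, mem_ball_zero_iff] at hmem
  rw [Metric.mem_closedBall, dist_comm, dist_eq_norm]
  exact hmem.le

lemma tsupport_normed_sub_subset (w : E) :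
    tsupport (fun z => ρ.normed volume (w - z)) ⊆ Metric.closedBall w ρ.rOut :=
  closure_minimal (fun _ => mem_closedBall_of_normed_sub_ne_zero) Metric.isClosed_closedBall

lemma hasCompactSupport_normed_sub (w : E) :
    HasCompactSupport fun z => ρ.normed volume (w - z) :=
  HasCompactSupport.of_support_subset_isCompact (isCompact_closedBall w ρ.rOut)
    (subset_closure.trans (tsupport_normed_sub_subset w))

lemma integrable_normed_sub (w : E) : Integrable fun z => ρ.normed volume (w - z) :=
  ρ.integrable_normed.comp_sub_left w

lemma setIntegral_normed_sub_le (w : E) : ∫ z in Ω, ρ.normed volume (w - z) ≤ 1 := by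
  rw [← ρ.integral_normed (μ := volume), ← integral_sub_left_eq_self (ρ.normed volume) volume w]
  exact setIntegral_le_integral (integrable_normed_sub w)
    (Eventually.of_forall fun _ => ρ.nonneg_normed _)

lemma setIntegral_normed_sub_eq (hw : Metric.closedBall w ρ.rOut ⊆ Ω) :
    ∫ z in Ω, ρ.normed volume (w - z) = 1 := by
  rw [setIntegral_eq_integral_of_forall_compl_eq_zero,
    integral_sub_left_eq_self (ρ.normed volume) volume w, ρ.integral_normed]
  exact fun z hz => of_not_not fun h => hz (hw (mem_closedBall_of_normed_sub_ne_zero h))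

lemma exists_forall_normed_le (ρ : ContDiffBump (0 : E)) : ∃ C, ∀ z : E, ρ.normed volume z ≤ C := by
  obtain ⟨C, hC⟩ :=
    ρ.continuous_normed (μ := volume) |>.bounded_above_of_compact_support ρ.hasCompactSupport_normed
  exact ⟨C, fun z => (le_abs_self _).trans (hC z)⟩

lemma integrableOn_normed_sub_mul (hf : IntegrableOn f Ω) (w : E) :
    IntegrableOn (fun z => ρ.normed volume (w - z) * f z) Ω := by
  obtain ⟨C, hC⟩ := exists_forall_normed_le ρ
  refine Integrable.bdd_mul (c := C) hf (continuous_normed_sub w).aestronglyMeasurable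
    (Eventually.of_forall fun z => ?_)
  rw [Real.norm_of_nonneg (ρ.nonneg_normed _)]
  exact hC _

/-- This is Jensen's inequality, obtained by applying the Cauchy-Schwarz inequality to the square
root of the kernel. -/
lemma sq_setIntegral_normed_sub_mul_le (hf : MemL2 Ω f) (w : E) :
    (∫ z in Ω, ρ.normed volume (w - z) * f z) ^ 2
      ≤ ∫ z in Ω, ρ.normed volume (w - z) * f z ^ 2 := by
  have hcont := (continuous_normed_sub (ρ := ρ) w).sqrt
  have hsq : ∀ z, √(ρ.normed volume (w - z)) ^ 2 = ρ.normed volume (w - z) :=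
    fun z => Real.sq_sqrt (ρ.nonneg_normed _)
  have hk : MemL2 Ω fun z => √(ρ.normed volume (w - z)) := by
    refine (memLp_two_iff_integrable_sq hcont.aestronglyMeasurable).2 ?_
    simp only [hsq]
    exact (integrable_normed_sub w).integrableOn
  have hkf : MemL2 Ω fun z => √(ρ.normed volume (w - z)) * f z := by
    refine (memLp_two_iff_integrable_sq (hcont.aestronglyMeasurable.mul hf.1)).2 ?_
    simp only [Pi.mul_apply, mul_pow, hsq]
    exact integrableOn_normed_sub_mul hf.integrableOn_sq w
  have hcs := hk.sq_integral_mul_le hkf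
  simp only [mul_pow, ← mul_assoc, ← sq, hsq] at hcs
  refine hcs.trans (mul_le_of_le_one_left ?_ (setIntegral_normed_sub_le w))
  exact integral_nonneg fun z => mul_nonneg (ρ.nonneg_normed _) (sq_nonneg _)

end Kernel

lemma contDiff_mollify (hΩ : MeasurableSet Ω) (hf : IntegrableOn f Ω) :
    ContDiff ℝ ∞ (mollify ρ δ Ω f) := by
  rw [mollify_eq_convolution_comp hΩ]
  exact (ρ.hasCompactSupport_normed.contDiff_convolution_right (n := ⊤) _
    ((integrable_indicator_iff hΩ).2 hf).locallyIntegrable contDiff_normed).comp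
    (contDiff_const_smul _)

lemma continuous_mollify (hΩ : MeasurableSet Ω) (hf : IntegrableOn f Ω) :
    Continuous (mollify ρ δ Ω f) :=
  (contDiff_mollify hΩ hf).continuous

lemma mollify_sub (hf : IntegrableOn f Ω) (hg : IntegrableOn g Ω) (x : E) :
    mollify ρ δ Ω (fun z => f z - g z) x = mollify ρ δ Ω f x - mollify ρ δ Ω g x := by
  simp only [mollify, mul_sub]
  exact integral_sub (integrableOn_normed_sub_mul hf _) (integrableOn_normed_sub_mul hg _)

lemma mollify_sub_self (hx : Metric.closedBall ((1 - δ) • x) ρ.rOut ⊆ Ω)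
    (hf : IntegrableOn f Ω) :
    mollify ρ δ Ω f x - f x = ∫ z in Ω, ρ.normed volume ((1 - δ) • x - z) * (f z - f x) := by
  simp only [mul_sub]
  rw [integral_sub (integrableOn_normed_sub_mul hf _)
    ((integrable_normed_sub _).integrableOn.mul_const _), integral_mul_const,
    setIntegral_normed_sub_eq hx, one_mul, mollify]

lemma fderiv_mollify_apply (hΩ : MeasurableSet Ω) (hf : IntegrableOn f Ω) (x e : E) :
    fderiv ℝ (mollify ρ δ Ω f) x e
      = (1 - δ) * ∫ z in Ω, f z * fderiv ℝ (ρ.normed volume) ((1 - δ) • x - z) e := by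
  have hloc := ((integrable_indicator_iff hΩ).2 hf).locallyIntegrable
  have hconv := ρ.hasCompactSupport_normed.hasFDerivAt_convolution_right (μ := volume)
    (ContinuousLinearMap.mul ℝ ℝ) hloc (ρ.contDiff_normed (μ := volume) (n := 1)) ((1 - δ) • x)
  have hdil : HasFDerivAt (fun x : E => (1 - δ) • x) ((1 - δ) • ContinuousLinearMap.id ℝ E) x :=
    (hasFDerivAt_id x).const_smul (1 - δ)
  rw [mollify_eq_convolution_comp hΩ, (hconv.comp x hdil).fderiv]
  simp only [ContinuousLinearMap.comp_apply, smul_apply, ContinuousLinearMap.id_apply, map_smul,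
    smul_eq_mul]
  rw [convolution_precompR_apply _ hloc (ρ.hasCompactSupport_normed.fderiv ℝ)
    ((ρ.contDiff_normed (n := 1)).continuous_fderiv (by simp)), convolution_def,
    ← integral_indicator hΩ]
  congr 2 with z
  by_cases h : z ∈ Ω <;> simp [h]

lemma HasWeakDeriv.fderiv_mollify (hΩ : MeasurableSet Ω) {e : E} (h : HasWeakDeriv Ω e f g)
    (hf : IntegrableOn f Ω) (hx : Metric.closedBall ((1 - δ) • x) ρ.rOut ⊆ Ω) :
    fderiv ℝ (mollify ρ δ Ω f) x e = (1 - δ) * mollify ρ δ Ω g x := by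
  have hparts := h.2.2 _ (contDiff_normed.comp (contDiff_const.sub contDiff_id))
    (hasCompactSupport_normed_sub ((1 - δ) • x)) ((tsupport_normed_sub_subset _).trans hx)
  simp only [Function.comp_def, id, fderiv_normed_sub, mul_neg, integral_neg, neg_inj] at hparts
  rw [fderiv_mollify_apply hΩ hf, hparts, mollify]
  simp only [mul_comm]

lemma integral_normed_smul_sub (hδ : δ < 1) (z : E) :
    ∫ x, ρ.normed volume ((1 - δ) • x - z) = ((1 - δ) ^ Module.finrank ℝ E)⁻¹ := by
  have : 0 < 1 - δ := sub_pos.2 hδ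
  rw [Measure.integral_comp_smul volume (fun x => ρ.normed volume (x - z)),
    integral_sub_right_eq_self (fun x => ρ.normed volume x), ρ.integral_normed,
    abs_of_pos (by positivity), smul_eq_mul, mul_one]

lemma setIntegral_normed_smul_sub_le (hδ : δ ≤ 1 / 2) (z : E) :
    ∫ x in Ω, ρ.normed volume ((1 - δ) • x - z) ≤ 2 ^ Module.finrank ℝ E := by
  have hδ1 : δ < 1 := by linarith
  have hint : Integrable fun x => ρ.normed volume ((1 - δ) • x - z) :=
    (ρ.integrable_normed.comp_sub_right z).comp_smul (sub_pos.2 hδ1).ne'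
  refine (setIntegral_le_integral hint (Eventually.of_forall fun _ => ρ.nonneg_normed _)).trans ?_
  rw [integral_normed_smul_sub hδ1, ← inv_pow]
  refine pow_le_pow_left₀ (inv_nonneg.2 (by linarith)) ?_ _
  rw [inv_le_comm₀ (by linarith) two_pos]
  linarith

lemma integrable_normed_smul_sub_mul_sq (hΩ : volume Ω ≠ ⊤) (hf : MemL2 Ω f) :
    Integrable (fun p : E × E => ρ.normed volume ((1 - δ) • p.1 - p.2) * f p.2 ^ 2)
      ((volume.restrict Ω).prod (volume.restrict Ω)) := by
  have : IsFiniteMeasure (volume.restrict Ω) := ⟨by simpa using hΩ.lt_top⟩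
  obtain ⟨C, hC⟩ := exists_forall_normed_le ρ
  have hcont : Continuous fun p : E × E => ρ.normed volume ((1 - δ) • p.1 - p.2) :=
    ρ.continuous_normed.comp ((continuous_fst.const_smul _).sub continuous_snd)
  refine Integrable.bdd_mul (c := C) (hf.integrableOn_sq.comp_snd _) hcont.aestronglyMeasurable
    (Eventually.of_forall fun p => ?_)
  rw [Real.norm_of_nonneg (ρ.nonneg_normed _)]
  exact hC _

lemma MemL2.mollify (hΩ : MeasurableSet Ω) (hΩ' : volume Ω ≠ ⊤) (hf : MemL2 Ω f) :
    MemL2 Ω (mollify ρ δ Ω f) := by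
  have hcont : Continuous (Ribbon.mollify ρ δ Ω f) := continuous_mollify hΩ (hf.integrableOn hΩ')
  refine (memLp_two_iff_integrable_sq hcont.aestronglyMeasurable).2 ?_
  refine (integrable_normed_smul_sub_mul_sq (ρ := ρ) (δ := δ) hΩ' hf).integral_prod_left.mono'
    (hcont.pow 2).aestronglyMeasurable (Eventually.of_forall fun x => ?_)
  rw [Real.norm_of_nonneg (sq_nonneg _)]
  exact sq_setIntegral_normed_sub_mul_le hf _

lemma integral_mollify_sq_le (hΩ : MeasurableSet Ω) (hΩ' : volume Ω ≠ ⊤) (hδ : δ ≤ 1 / 2)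
    (hf : MemL2 Ω f) :
    ∫ x in Ω, mollify ρ δ Ω f x ^ 2 ≤ 2 ^ Module.finrank ℝ E * ∫ x in Ω, f x ^ 2 := by
  have : IsFiniteMeasure (volume.restrict Ω) := ⟨by simpa using hΩ'.lt_top⟩
  have hprod := integrable_normed_smul_sub_mul_sq (ρ := ρ) (δ := δ) hΩ' hf
  calc ∫ x in Ω, mollify ρ δ Ω f x ^ 2
      ≤ ∫ x in Ω, ∫ z in Ω, ρ.normed volume ((1 - δ) • x - z) * f z ^ 2 :=
        integral_mono (hf.mollify hΩ hΩ').integrableOn_sq hprod.integral_prod_left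
          fun x => sq_setIntegral_normed_sub_mul_le hf _
    _ = ∫ z in Ω, ∫ x in Ω, ρ.normed volume ((1 - δ) • x - z) * f z ^ 2 :=
        integral_integral_swap hprod
    _ ≤ ∫ z in Ω, 2 ^ Module.finrank ℝ E * f z ^ 2 := by
        refine integral_mono hprod.integral_prod_right (hf.integrableOn_sq.const_mul _) fun z => ?_
        dsimp only
        rw [integral_mul_const]
        gcongr
        exact setIntegral_normed_smul_sub_le hδ z
    _ = 2 ^ Module.finrank ℝ E * ∫ x in Ω, f x ^ 2 := integral_const_mul _ _

lemma abs_mollify_sub_le (hx : Metric.closedBall ((1 - δ) • x) ρ.rOut ⊆ Ω)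
    (hf : IntegrableOn f Ω) {η : ℝ}
    (hη : ∀ z ∈ Metric.closedBall ((1 - δ) • x) ρ.rOut, |f z - f x| ≤ η) :
    |mollify ρ δ Ω f x - f x| ≤ η := by
  have hk := (integrable_normed_sub (ρ := ρ) ((1 - δ) • x)).integrableOn (s := Ω)
  calc |mollify ρ δ Ω f x - f x|
      = ‖∫ z in Ω, ρ.normed volume ((1 - δ) • x - z) * (f z - f x)‖ := by
        rw [mollify_sub_self hx hf, Real.norm_eq_abs]
    _ ≤ ∫ z in Ω, ρ.normed volume ((1 - δ) • x - z) * η := by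
        refine norm_integral_le_of_norm_le (hk.mul_const η) (Eventually.of_forall fun z => ?_)
        rw [norm_mul, Real.norm_of_nonneg (ρ.nonneg_normed _), Real.norm_eq_abs]
        by_cases hz : ρ.normed volume ((1 - δ) • x - z) = 0
        · simp [hz]
        · exact mul_le_mul_of_nonneg_left (hη z (mem_closedBall_of_normed_sub_ne_zero hz))
            (ρ.nonneg_normed _)
    _ = η := by rw [integral_mul_const, setIntegral_normed_sub_eq hx, one_mul]

end Mollification

section SmoothApproximation

lemma StrongL2.of_tendstoUniformlyOn {E : Type*} [MeasureSpace E] {Ω : Set E}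
    (hΩ : MeasurableSet Ω) (hvol : volume Ω ≠ ⊤) {F : ℕ → E → ℝ} {G : E → ℝ}
    (hF : ∀ n, MemL2 Ω (F n)) (hG : MemL2 Ω G) (h : TendstoUniformlyOn F G atTop Ω) :
    StrongL2 Ω F G := by
  have : IsFiniteMeasure (volume.restrict Ω) := ⟨by simpa using hvol.lt_top⟩
  have hsq_le : ∀ᶠ n in atTop, ∀ᵐ x ∂volume.restrict Ω, ‖(F n x - G x) ^ 2‖ ≤ 1 := by
    filter_upwards [Metric.tendstoUniformlyOn_iff.1 h 1 one_pos] with n hn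
    filter_upwards [ae_restrict_mem hΩ] with x hx
    rw [norm_pow, ← dist_eq_norm, dist_comm]
    exact pow_le_one₀ dist_nonneg (hn x hx).le
  have hlim : ∀ᵐ x ∂volume.restrict Ω, Tendsto (fun n => (F n x - G x) ^ 2) atTop (𝓝 0) := by
    filter_upwards [ae_restrict_mem hΩ] with x hx
    simpa using ((h.tendsto_at hx).sub_const (G x)).pow 2
  refine strongL2_iff.2 ⟨hF, hG, ?_⟩
  simpa using tendsto_integral_filter_of_dominated_convergence (fun _ => (1 : ℝ))
    (Eventually.of_forall fun n => ((hF n).sub hG).integrableOn_sq.aestronglyMeasurable)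
    hsq_le (integrable_const 1) hlim

variable {E : Type*} [NormedAddCommGroup E] [NormedSpace ℝ E]

/-- Vanishing mollification parameters for which `mollify` only sees values of a function inside of
`Ω`. -/
structure MollifierSeq (Ω : Set E) where
  bump : ℕ → ContDiffBump (0 : E)
  contraction : ℕ → ℝ
  contraction_nonneg : ∀ n, 0 ≤ contraction n
  contraction_le : ∀ n, contraction n ≤ 1 / 2
  tendsto_contraction : Tendsto contraction atTop (𝓝 0)
  tendsto_rOut : Tendsto (fun n => (bump n).rOut) atTop (𝓝 0)
  closedBall_subset : ∀ n, ∀ x ∈ Ω,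
    Metric.closedBall ((1 - contraction n) • x) (bump n).rOut ⊆ Ω

/-- Bounded open convex sets containing the origin. The contractions centred at the origin map such
a set into itself and leave room for mollifying up to the boundary. -/
structure IsConvexDomain (Ω : Set E) : Prop where
  convex : Convex ℝ Ω
  isOpen : IsOpen Ω
  zero_mem : (0 : E) ∈ Ω
  isBounded : Bornology.IsBounded Ω

variable {Ω : Set E}

lemma closedBall_smul_subset_of_convex (hΩ : Convex ℝ Ω) {r : ℝ}
    (hr : Metric.closedBall 0 r ⊆ Ω) {δ : ℝ} (hδ : 0 < δ) (hδ1 : δ ≤ 1) {x : E} (hx : x ∈ Ω) :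
    Metric.closedBall ((1 - δ) • x) (δ * r) ⊆ Ω := by
  intro z hz
  have hmem : δ⁻¹ • (z - (1 - δ) • x) ∈ Ω := hr <| by
    rw [Metric.mem_closedBall, dist_eq_norm] at hz
    rw [mem_closedBall_zero_iff, norm_smul, norm_inv, Real.norm_of_nonneg hδ.le]
    exact (inv_mul_le_iff₀ hδ).2 hz
  have hcomb := hΩ hx hmem (sub_nonneg.2 hδ1) hδ.le (sub_add_cancel 1 δ)
  rwa [smul_inv_smul₀ hδ.ne', add_sub_cancel] at hcomb

namespace IsConvexDomain

lemma nonempty_mollifierSeq (h : IsConvexDomain Ω) : Nonempty (MollifierSeq Ω) := by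
  obtain ⟨r, hr, hrΩ⟩ := Metric.nhds_basis_closedBall.mem_iff.1 (h.isOpen.mem_nhds h.zero_mem)
  let δ : ℕ → ℝ := fun n => 1 / (n + 2)
  have hδ : ∀ n, 0 < δ n := fun n => by positivity
  have hδ2 : ∀ n, δ n ≤ 1 / 2 := fun n =>
    one_div_le_one_div_of_le two_pos (le_add_of_nonneg_left n.cast_nonneg)
  have hδ0 : Tendsto δ atTop (𝓝 0) :=
    tendsto_const_nhds.div_atTop (tendsto_atTop_add_const_right _ _ tendsto_natCast_atTop_atTop)
  exact ⟨{
    bump n := ⟨δ n * r / 2, δ n * r, half_pos (mul_pos (hδ n) hr),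
      half_lt_self (mul_pos (hδ n) hr)⟩
    contraction := δ
    contraction_nonneg n := (hδ n).le
    contraction_le := hδ2
    tendsto_contraction := hδ0
    tendsto_rOut := by simpa using hδ0.mul_const r
    closedBall_subset n _ hx := closedBall_smul_subset_of_convex h.convex hrΩ (hδ n)
      ((hδ2 n).trans one_half_lt_one.le) hx }⟩

variable [FiniteDimensional ℝ E] [MeasureSpace E]

lemma volume_ne_top [IsFiniteMeasureOnCompacts (volume : Measure E)] (h : IsConvexDomain Ω) :
    volume Ω ≠ ⊤ :=
  h.isBounded.measure_lt_top.ne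

lemma memL2_of_continuous [BorelSpace E] [IsFiniteMeasureOnCompacts (volume : Measure E)]
    (h : IsConvexDomain Ω) {f : E → ℝ} (hf : Continuous f) : MemL2 Ω f := by
  have : IsFiniteMeasure (volume.restrict Ω) := ⟨by simpa using h.volume_ne_top.lt_top⟩
  obtain ⟨C, hC⟩ := (h.isBounded.isCompact_closure.image hf).isBounded.exists_norm_le
  refine MemLp.of_bound hf.aestronglyMeasurable C ?_
  filter_upwards [ae_restrict_mem h.isOpen.measurableSet] with x hx
  exact hC _ ⟨x, subset_closure hx, rfl⟩

end IsConvexDomain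

namespace MollifierSeq

lemma tendsto_displacement (m : MollifierSeq Ω) (M : ℝ) :
    Tendsto (fun n => m.contraction n * M + (m.bump n).rOut) atTop (𝓝 0) := by
  simpa using (m.tendsto_contraction.mul_const M).add m.tendsto_rOut

variable [FiniteDimensional ℝ E] [MeasureSpace E]

/-- The `n`-th mollification of `f`. -/
def apply (m : MollifierSeq Ω) (f : E → ℝ) (n : ℕ) : E → ℝ :=
  mollify (m.bump n) (m.contraction n) Ω f

variable [BorelSpace E] [(volume : Measure E).IsAddHaarMeasure] {f : E → ℝ}

lemma tendstoUniformlyOn_apply (m : MollifierSeq Ω) (hbdd : Bornology.IsBounded Ω)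
    (hf : IntegrableOn f Ω) (hfc : UniformContinuous f) :
    TendstoUniformlyOn (m.apply f) f atTop Ω := by
  obtain ⟨M, hM⟩ := hbdd.exists_norm_le
  refine Metric.tendstoUniformlyOn_iff.2 fun η hη => ?_
  obtain ⟨τ, hτ, hfτ⟩ := Metric.uniformContinuous_iff.1 hfc (η / 2) (half_pos hη)
  filter_upwards [(m.tendsto_displacement M).eventually (gt_mem_nhds hτ)] with n hn x hx
  rw [dist_comm, Real.dist_eq]
  refine (abs_mollify_sub_le (m.closedBall_subset n x hx) hf fun z hz => ?_).trans_lt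
    (half_lt_self hη)
  refine (hfτ ?_).le
  rw [dist_eq_norm]
  exact (norm_sub_le_of_mem_closedBall (m.contraction_nonneg n) (hM x hx) hz).trans_lt hn

lemma strongL2_apply (m : MollifierSeq Ω) (hΩ : MeasurableSet Ω) (hbdd : Bornology.IsBounded Ω)
    (hf : MemL2 Ω f) : StrongL2 Ω (m.apply f) f := by
  have hvol : volume Ω ≠ ⊤ := hbdd.measure_lt_top.ne
  refine StrongL2.of_forall_approx (fun n => hf.mollify hΩ hvol) hf fun b hb => ?_
  set K : ℝ := 2 ^ Module.finrank ℝ E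
  have hK : 1 ≤ K := one_le_pow₀ one_le_two
  obtain ⟨g, hgc, hfg, hgcont, hg : MemL2 Ω g⟩ := MemLp.exists_hasCompactSupport_eLpNorm_sub_le
    (p := 2) ENNReal.ofNat_ne_top hf (ε := ENNReal.ofReal √(b / K)) (by simpa using by positivity)
  have hfg_le : ∫ x in Ω, (f x - g x) ^ 2 ≤ b / K := by
    rwa [Pi.sub_def, (hf.sub hg).eLpNorm_eq, ENNReal.ofReal_le_ofReal_iff (Real.sqrt_nonneg _),
      Real.sqrt_le_sqrt_iff (by positivity)] at hfg
  refine ⟨m.apply g, g, ?_, fun n => ?_, ?_⟩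
  · exact StrongL2.of_tendstoUniformlyOn hΩ hvol (fun n => hg.mollify hΩ hvol) hg
      (m.tendstoUniformlyOn_apply hbdd (hg.integrableOn hvol)
        (hgc.uniformContinuous_of_continuous hgcont))
  · have hle := integral_mollify_sq_le (ρ := m.bump n) hΩ hvol (m.contraction_le n) (hf.sub hg)
    simp only [mollify_sub (hf.integrableOn hvol) (hg.integrableOn hvol)] at hle
    exact hle.trans ((le_div_iff₀' (by positivity)).1 hfg_le)
  · simp only [sub_sq_comm (g _)]
    exact hfg_le.trans (div_le_self hb.le hK)

end MollifierSeq

variable [FiniteDimensional ℝ E] [MeasureSpace E] [BorelSpace E]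
  [(volume : Measure E).IsAddHaarMeasure] {f : E → ℝ}

lemma IsConvexDomain.exists_smooth_approx (h : IsConvexDomain Ω) (hf : MemW12 Ω f) :
    ∃ φ : ℕ → E → ℝ, (∀ k, ContDiff ℝ ∞ (φ k)) ∧ StrongL2 Ω φ f ∧
      ∀ e, StrongL2 Ω (fun k x => fderiv ℝ (φ k) x e) (weakDeriv Ω e f) := by
  obtain ⟨m⟩ := h.nonempty_mollifierSeq
  have hΩ := h.isOpen.measurableSet
  have hfi := hf.1.integrableOn h.volume_ne_top
  refine ⟨m.apply f, fun n => contDiff_mollify hΩ hfi, m.strongL2_apply hΩ h.isBounded hf.1,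
    fun e => ?_⟩
  have hscaled := (m.strongL2_apply hΩ h.isBounded (hf.memL2_weakDeriv h.isOpen e)).const_mul
    (by simpa using m.tendsto_contraction.const_sub 1)
  refine hscaled.congr_ae (fun n => ?_) (by simp)
  filter_upwards [ae_restrict_mem hΩ] with x hx
  exact ((hf.hasWeakDeriv e).fderiv_mollify hΩ hfi (m.closedBall_subset n x hx)).symm

end SmoothApproximation

section Rellich

variable {E : Type*} [NormedAddCommGroup E] [NormedSpace ℝ E]

lemma sq_sub_le_integral_sq_norm_fderiv {f : E → ℝ} (hf : ContDiff ℝ 1 f) (x z : E) :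
    (f z - f x) ^ 2
      ≤ ‖z - x‖ ^ 2 * ∫ t in Ioc (0 : ℝ) 1, ‖fderiv ℝ f (AffineMap.lineMap x z t)‖ ^ 2 := by
  have hline : Continuous fun t : ℝ => (AffineMap.lineMap x z t : E) := by fun_prop
  have hfderiv : Continuous fun t : ℝ => fderiv ℝ f (AffineMap.lineMap x z t) :=
    (hf.continuous_fderiv one_ne_zero).comp hline
  have hd : ∀ t : ℝ, HasDerivAt (fun t : ℝ => f (AffineMap.lineMap x z t))
      (fderiv ℝ f (AffineMap.lineMap x z t) (z - x)) t := fun t =>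
    (hf.differentiable one_ne_zero _).hasFDerivAt.comp_hasDerivAt t AffineMap.hasDerivAt_lineMap
  have hdc : Continuous fun t : ℝ => fderiv ℝ f (AffineMap.lineMap x z t) (z - x) :=
    hfderiv.clm_apply continuous_const
  have hmem : MemL2 (Ioc (0 : ℝ) 1) fun t => fderiv ℝ f (AffineMap.lineMap x z t) (z - x) :=
    (memLp_two_iff_integrable_sq hdc.aestronglyMeasurable).2
      ((hdc.pow 2).integrableOn_Icc.mono_set Ioc_subset_Icc_self)
  have hftc := intervalIntegral.integral_eq_sub_of_hasDerivAt (a := 0) (b := 1)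
    (fun t _ => hd t) (hdc.intervalIntegrable _ _)
  rw [intervalIntegral.integral_of_le zero_le_one, AffineMap.lineMap_apply_one,
    AffineMap.lineMap_apply_zero] at hftc
  have hcs := hmem.sq_integral_mul_le (g := fun _ => 1) (memLp_const 1)
  simp only [mul_one, one_pow, hftc, setIntegral_const, Real.volume_real_Ioc_of_le zero_le_one,
    sub_zero, smul_eq_mul] at hcs
  rw [← integral_const_mul]
  refine hcs.trans (integral_mono hmem.integrableOn_sq
    (((hfderiv.norm.pow 2).const_mul _).integrableOn_Icc.mono_set Ioc_subset_Icc_self) fun t => ?_)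
  dsimp only
  rw [← sq_abs, ← Real.norm_eq_abs, mul_comm, ← mul_pow]
  gcongr
  exact ContinuousLinearMap.le_opNorm _ _

lemma exists_sq_norm_le_sum_basis {ι : Type*} [Fintype ι] (b : Module.Basis ι ℝ E) :
    ∃ K, 0 ≤ K ∧ ∀ L : E →L[ℝ] ℝ, ‖L‖ ^ 2 ≤ K * ∑ i, L (b i) ^ 2 := by
  obtain ⟨C, -, hC⟩ := b.exists_opNorm_le (F := ℝ)
  refine ⟨C ^ 2, sq_nonneg C, fun L => ?_⟩
  have hsum : 0 ≤ ∑ i, L (b i) ^ 2 := Finset.sum_nonneg fun i _ => sq_nonneg _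
  have hle := hC (u := L) (Real.sqrt_nonneg (∑ i, L (b i) ^ 2)) fun i =>
    Real.le_sqrt_of_sq_le (by
      rw [Real.norm_eq_abs, sq_abs]
      exact Finset.single_le_sum (f := fun i => L (b i) ^ 2) (fun i _ => sq_nonneg _)
        (Finset.mem_univ i))
  calc ‖L‖ ^ 2 ≤ (C * √(∑ i, L (b i) ^ 2)) ^ 2 := by gcongr
    _ = C ^ 2 * ∑ i, L (b i) ^ 2 := by rw [mul_pow, Real.sq_sqrt hsum]

variable [FiniteDimensional ℝ E] [MeasureSpace E] [BorelSpace E]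
  [(volume : Measure E).IsAddHaarMeasure] {Ω : Set E} {f : E → ℝ}

lemma lintegral_comp_smul_add_le {F : E → ℝ≥0∞} (hF : Measurable F) (hΩ : MeasurableSet Ω)
    {c : ℝ} (hc : 1 / 2 ≤ c) (b : E) (hmap : ∀ x ∈ Ω, c • x + b ∈ Ω) :
    ∫⁻ x in Ω, F (c • x + b) ≤ 2 ^ Module.finrank ℝ E * ∫⁻ x in Ω, F x := by
  have hc0 : 0 < c := by linarith
  have hjac : ENNReal.ofReal |(c ^ Module.finrank ℝ E)⁻¹| ≤ 2 ^ Module.finrank ℝ E := by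
    rw [abs_of_pos (by positivity), ← inv_pow, ENNReal.ofReal_pow (by positivity)]
    gcongr
    refine ENNReal.ofReal_le_of_le_toReal ?_
    rw [inv_le_comm₀ hc0 (by simp)]
    simpa using hc
  calc ∫⁻ x in Ω, F (c • x + b) = ∫⁻ x in Ω, Ω.indicator F (c • x + b) :=
        setLIntegral_congr_fun hΩ fun x hx => by rw [indicator_of_mem (hmap x hx)]
    _ ≤ ∫⁻ x, Ω.indicator F (c • x + b) := setLIntegral_le_lintegral _ _
    _ = ∫⁻ y, Ω.indicator F (y + b) ∂(Measure.map (c • ·) volume) :=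
        (lintegral_map (f := fun y => Ω.indicator F (y + b))
          ((hF.indicator hΩ).comp (measurable_add_const b)) (measurable_const_smul c)).symm
    _ = ENNReal.ofReal |(c ^ Module.finrank ℝ E)⁻¹| * ∫⁻ x in Ω, F x := by
        rw [Measure.map_addHaar_smul volume hc0.ne', lintegral_smul_measure, smul_eq_mul,
          lintegral_add_right_eq_self (fun y => Ω.indicator F y) b, lintegral_indicator hΩ]
    _ ≤ 2 ^ Module.finrank ℝ E * ∫⁻ x in Ω, F x := by gcongr

lemma lintegral_sq_comp_smul_add_sub_le (hΩ : MeasurableSet Ω) (hconv : Convex ℝ Ω) {c : ℝ}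
    (hc : 1 / 2 ≤ c) {b : E} (hmap : ∀ x ∈ Ω, c • x + b ∈ Ω) {D : ℝ}
    (hD : ∀ x ∈ Ω, ‖c • x + b - x‖ ≤ D) (hf : ContDiff ℝ 1 f) :
    ∫⁻ x in Ω, ENNReal.ofReal ((f (c • x + b) - f x) ^ 2) ≤ ENNReal.ofReal (D ^ 2) *
      (2 ^ Module.finrank ℝ E * ∫⁻ x in Ω, ENNReal.ofReal (‖fderiv ℝ f x‖ ^ 2)) := by
  have hline : ∀ (x : E) (t : ℝ),
      AffineMap.lineMap x (c • x + b) t = (1 - t * (1 - c)) • x + t • b := fun x t => by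
    rw [AffineMap.lineMap_apply_module]; module
  have hnorm : Continuous fun x => ‖fderiv ℝ f x‖ ^ 2 :=
    (hf.continuous_fderiv one_ne_zero).norm.pow 2
  let H : E → ℝ → ℝ≥0∞ := fun x t =>
    ENNReal.ofReal (‖fderiv ℝ f ((1 - t * (1 - c)) • x + t • b)‖ ^ 2)
  have hH : Measurable (Function.uncurry H) := by
    have hpath : Continuous fun p : E × ℝ => (1 - p.2 * (1 - c)) • p.1 + p.2 • b := by fun_prop
    exact (hnorm.comp hpath).measurable.ennreal_ofReal
  have hpoint : ∀ x ∈ Ω, ENNReal.ofReal ((f (c • x + b) - f x) ^ 2)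
      ≤ ENNReal.ofReal (D ^ 2) * ∫⁻ t in Ioc (0 : ℝ) 1, H x t := by
    intro x hx
    have hcont : Continuous fun t : ℝ => ‖fderiv ℝ f (AffineMap.lineMap x (c • x + b) t)‖ ^ 2 :=
      hnorm.comp (by fun_prop)
    simp only [H, ← hline]
    rw [← ofReal_integral_eq_lintegral_ofReal
      (hcont.integrableOn_Icc.mono_set Ioc_subset_Icc_self)
      (ae_of_all _ fun _ => by positivity), ← ENNReal.ofReal_mul (sq_nonneg D)]
    refine ENNReal.ofReal_le_ofReal ((sq_sub_le_integral_sq_norm_fderiv hf _ _).trans ?_)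
    gcongr
    exact hD x hx
  have hsegment : ∀ t ∈ Ioc (0 : ℝ) 1, ∫⁻ x in Ω, H x t
      ≤ 2 ^ Module.finrank ℝ E * ∫⁻ x in Ω, ENNReal.ofReal (‖fderiv ℝ f x‖ ^ 2) := fun t ht =>
    lintegral_comp_smul_add_le (F := fun x => ENNReal.ofReal (‖fderiv ℝ f x‖ ^ 2))
      hnorm.measurable.ennreal_ofReal hΩ (by nlinarith [ht.1, ht.2]) _ fun x hx =>
        hline x t ▸ hconv.lineMap_mem hx (hmap x hx) ⟨ht.1.le, ht.2⟩
  refine (setLIntegral_mono' hΩ hpoint).trans ?_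
  have hmeas : Measurable fun x => ∫⁻ t in Ioc (0 : ℝ) 1, H x t := hH.lintegral_prod_right'
  rw [lintegral_const_mul _ hmeas, lintegral_lintegral_swap hH.aemeasurable]
  gcongr
  simpa using setLIntegral_mono' (μ := volume) measurableSet_Ioc hsegment

section

variable {ρ : ContDiffBump (0 : E)} {δ : ℝ}

lemma sq_mollify_sub_le_lintegral {x : E} (hx : Metric.closedBall ((1 - δ) • x) ρ.rOut ⊆ Ω)
    (hvol : volume Ω ≠ ⊤) (hf : MemL2 Ω f) :
    ENNReal.ofReal ((mollify ρ δ Ω f x - f x) ^ 2) ≤ ∫⁻ s, ENNReal.ofReal (ρ.normed volume s) *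
      ENNReal.ofReal ((f ((1 - δ) • x + -s) - f x) ^ 2) := by
  have : IsFiniteMeasure (volume.restrict Ω) := ⟨by simpa using hvol.lt_top⟩
  have hfx : MemL2 Ω fun z => f z - f x := hf.sub (memLp_const (f x))
  rw [mollify_sub_self hx (hf.integrableOn hvol)]
  refine (ENNReal.ofReal_le_ofReal (sq_setIntegral_normed_sub_mul_le hfx _)).trans ?_
  rw [ofReal_integral_eq_lintegral_ofReal (integrableOn_normed_sub_mul hfx.integrableOn_sq _)
    (ae_of_all _ fun z => mul_nonneg (ρ.nonneg_normed _) (sq_nonneg _))]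
  refine (setLIntegral_le_lintegral _ _).trans_eq ?_
  rw [← lintegral_sub_left_eq_self (fun s => ENNReal.ofReal (ρ.normed volume s) *
    ENNReal.ofReal ((f ((1 - δ) • x + -s) - f x) ^ 2)) ((1 - δ) • x)]
  simp only [ENNReal.ofReal_mul (ρ.nonneg_normed _), neg_sub, add_sub_cancel]

lemma lintegral_sq_mollify_sub_le (h : IsConvexDomain Ω) (hδ : 0 ≤ δ) (hδ2 : δ ≤ 1 / 2)
    (hball : ∀ x ∈ Ω, Metric.closedBall ((1 - δ) • x) ρ.rOut ⊆ Ω) {M : ℝ}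
    (hM : ∀ x ∈ Ω, ‖x‖ ≤ M) (hf : ContDiff ℝ 1 f) :
    ∫⁻ x in Ω, ENNReal.ofReal ((mollify ρ δ Ω f x - f x) ^ 2)
      ≤ ENNReal.ofReal ((δ * M + ρ.rOut) ^ 2) *
        (2 ^ Module.finrank ℝ E * ∫⁻ x in Ω, ENNReal.ofReal (‖fderiv ℝ f x‖ ^ 2)) := by
  have hΩ := h.isOpen.measurableSet
  set B := ENNReal.ofReal ((δ * M + ρ.rOut) ^ 2) *
    (2 ^ Module.finrank ℝ E * ∫⁻ x in Ω, ENNReal.ofReal (‖fderiv ℝ f x‖ ^ 2))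
  have hρ : Measurable fun s => ENNReal.ofReal (ρ.normed volume s) :=
    ρ.continuous_normed.measurable.ennreal_ofReal
  have hfc := hf.continuous
  have hdiff : Measurable fun p : E × E =>
      ENNReal.ofReal ((f ((1 - δ) • p.1 + -p.2) - f p.1) ^ 2) :=
    Measurable.ennreal_ofReal (by fun_prop)
  have htranslate : ∀ s, ∫⁻ x in Ω, ENNReal.ofReal (ρ.normed volume s) *
      ENNReal.ofReal ((f ((1 - δ) • x + -s) - f x) ^ 2)
        ≤ ENNReal.ofReal (ρ.normed volume s) * B := by
    intro s
    have hslice : Measurable fun x => ENNReal.ofReal ((f ((1 - δ) • x + -s) - f x) ^ 2) :=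
      Measurable.ennreal_ofReal (by fun_prop)
    refine (lintegral_const_mul _ hslice).trans_le ?_
    by_cases hs : ρ.normed volume s = 0
    · simp [hs]
    have hmem : ∀ x, (1 - δ) • x + -s ∈ Metric.closedBall ((1 - δ) • x) ρ.rOut := fun x =>
      mem_closedBall_of_normed_sub_ne_zero (by simpa using hs)
    gcongr
    exact lintegral_sq_comp_smul_add_sub_le hΩ h.convex (by linarith)
      (fun x hx => hball x hx (hmem x))
      (fun x hx => norm_sub_le_of_mem_closedBall hδ (hM x hx) (hmem x)) hf
  calc ∫⁻ x in Ω, ENNReal.ofReal ((mollify ρ δ Ω f x - f x) ^ 2)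
      ≤ ∫⁻ x in Ω, ∫⁻ s, ENNReal.ofReal (ρ.normed volume s) *
          ENNReal.ofReal ((f ((1 - δ) • x + -s) - f x) ^ 2) :=
        setLIntegral_mono' hΩ fun x hx => sq_mollify_sub_le_lintegral (hball x hx)
          h.volume_ne_top (h.memL2_of_continuous hf.continuous)
    _ = ∫⁻ s, ∫⁻ x in Ω, ENNReal.ofReal (ρ.normed volume s) *
          ENNReal.ofReal ((f ((1 - δ) • x + -s) - f x) ^ 2) :=
        lintegral_lintegral_swap ((hρ.comp measurable_snd).mul hdiff).aemeasurable
    _ ≤ ∫⁻ s, ENNReal.ofReal (ρ.normed volume s) * B := lintegral_mono htranslate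
    _ = B := by
        rw [lintegral_mul_const _ hρ, ← ofReal_integral_eq_lintegral_ofReal ρ.integrable_normed
          (ae_of_all _ fun s => ρ.nonneg_normed s), ρ.integral_normed, ENNReal.ofReal_one, one_mul]

end

namespace MollifierSeq

lemma integral_sq_apply_sub_le_of_contDiff (m : MollifierSeq Ω) (h : IsConvexDomain Ω) {M : ℝ}
    (hM : ∀ x ∈ Ω, ‖x‖ ≤ M) (hf : ContDiff ℝ 1 f) (n : ℕ) :
    ∫ x in Ω, (m.apply f n x - f x) ^ 2 ≤ (m.contraction n * M + (m.bump n).rOut) ^ 2 *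
      (2 ^ Module.finrank ℝ E * ∫ x in Ω, ‖fderiv ℝ f x‖ ^ 2) := by
  have hfm := h.memL2_of_continuous hf.continuous
  have hmem : MemL2 Ω (m.apply f n) := hfm.mollify h.isOpen.measurableSet h.volume_ne_top
  have hfderiv := h.memL2_of_continuous (hf.continuous_fderiv one_ne_zero).norm
  have hle : ∫⁻ x in Ω, ENNReal.ofReal ((m.apply f n x - f x) ^ 2) ≤ _ :=
    lintegral_sq_mollify_sub_le h (m.contraction_nonneg n) (m.contraction_le n)
      (m.closedBall_subset n) hM hf
  have htwo : (2 : ℝ≥0∞) ^ Module.finrank ℝ E = ENNReal.ofReal (2 ^ Module.finrank ℝ E) := by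
    rw [ENNReal.ofReal_pow zero_le_two, ENNReal.ofReal_ofNat]
  rwa [← ofReal_integral_eq_lintegral_ofReal (hmem.sub hfm).integrableOn_sq
      (ae_of_all _ fun x => sq_nonneg _),
    ← ofReal_integral_eq_lintegral_ofReal hfderiv.integrableOn_sq
      (ae_of_all _ fun x => sq_nonneg _), htwo, ← ENNReal.ofReal_mul (by positivity),
    ← ENNReal.ofReal_mul (by positivity), ENNReal.ofReal_le_ofReal_iff] at hle
  exact mul_nonneg (sq_nonneg _) (mul_nonneg (by positivity) (integral_nonneg fun _ => sq_nonneg _))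

lemma exists_sq_apply_le (m : MollifierSeq Ω) (n : ℕ) :
    ∃ K, 0 ≤ K ∧ ∀ f, MemL2 Ω f → ∀ x, m.apply f n x ^ 2 ≤ K * ∫ z in Ω, f z ^ 2 := by
  obtain ⟨K, hK⟩ := exists_forall_normed_le (m.bump n)
  refine ⟨K, ((m.bump n).nonneg_normed 0).trans (hK 0), fun f hf x => ?_⟩
  rw [← integral_const_mul]
  exact (sq_setIntegral_normed_sub_mul_le hf _).trans <| integral_mono
    (integrableOn_normed_sub_mul hf.integrableOn_sq _) (hf.integrableOn_sq.const_mul K) fun z =>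
      mul_le_mul_of_nonneg_right (hK _) (sq_nonneg _)

lemma strongL2_apply_of_weakL2 (m : MollifierSeq Ω) (hΩ : MeasurableSet Ω) (hvol : volume Ω ≠ ⊤)
    {F : ℕ → E → ℝ} (hF : WeakL2 Ω F f) (n : ℕ) :
    StrongL2 Ω (fun k => m.apply (F k) n) (m.apply f n) := by
  have : IsFiniteMeasure (volume.restrict Ω) := ⟨by simpa using hvol.lt_top⟩
  have hd := hF.sub_limit
  obtain ⟨C, hC⟩ := hd.bounded
  obtain ⟨K, hK, hKle⟩ := m.exists_sq_apply_le n
  have hsub : ∀ k x, m.apply (F k) n x - m.apply f n x = m.apply (fun z => F k z - f z) n x :=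
    fun k x => (mollify_sub ((hF.1 k).integrableOn hvol) (hF.2.1.integrableOn hvol) x).symm
  have hbound : ∀ k x, m.apply (fun z => F k z - f z) n x ^ 2 ≤ K * C := fun k x =>
    (hKle _ (hd.1 k) x).trans (mul_le_mul_of_nonneg_left (hC k) hK)
  have hlim : ∀ x, Tendsto (fun k => m.apply (fun z => F k z - f z) n x ^ 2) atTop (𝓝 0) := by
    intro x
    have hcont := continuous_normed_sub (ρ := m.bump n) ((1 - m.contraction n) • x)
    obtain ⟨K', hK'⟩ := hcont.bounded_above_of_compact_support (hasCompactSupport_normed_sub _)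
    have hkernel : MemL2 Ω fun z => (m.bump n).normed volume ((1 - m.contraction n) • x - z) :=
      MemLp.of_bound hcont.aestronglyMeasurable K' (ae_of_all _ hK')
    simpa [apply, mollify, mul_comm] using (hd.2.2 _ hkernel).pow 2
  refine strongL2_iff.2 ⟨fun k => (hF.1 k).mollify hΩ hvol, hF.2.1.mollify hΩ hvol, ?_⟩
  simp only [hsub]
  simpa only [integral_zero] using tendsto_integral_of_dominated_convergence
    (F := fun k x => m.apply (fun z => F k z - f z) n x ^ 2) (fun _ => K * C)
    (fun k => ((continuous_mollify hΩ ((hd.1 k).integrableOn hvol)).pow 2).aestronglyMeasurable)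
    (integrable_const _)
    (fun k => ae_of_all _ fun x => (Real.norm_of_nonneg (sq_nonneg _)).trans_le (hbound k x))
    (ae_of_all _ hlim)

end MollifierSeq

lemma exists_integral_sq_mollifierSeq_apply_sub_le (h : IsConvexDomain Ω) {M : ℝ}
    (hM : ∀ x ∈ Ω, ‖x‖ ≤ M) {ι : Type*} [Fintype ι] (b : Module.Basis ι ℝ E) :
    ∃ K, 0 ≤ K ∧ ∀ (m : MollifierSeq Ω) (n : ℕ) (f : E → ℝ), MemW12 Ω f →
      ∫ x in Ω, (m.apply f n x - f x) ^ 2 ≤ (m.contraction n * M + (m.bump n).rOut) ^ 2 *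
        (K * ∑ i, ∫ x in Ω, weakDeriv Ω (b i) f x ^ 2) := by
  obtain ⟨K, hK, hKle⟩ := exists_sq_norm_le_sum_basis b
  refine ⟨2 ^ Module.finrank ℝ E * K, by positivity, fun m n f hf => ?_⟩
  obtain ⟨φ, hφ, hφf, hφd⟩ := h.exists_smooth_approx hf
  refine le_of_tendsto_of_tendsto' ((m.strongL2_apply_of_weakL2 h.isOpen.measurableSet
    h.volume_ne_top hφf.weakL2 n).sub hφf).tendsto_integral_sq (((tendsto_finsetSum _
      fun i _ => (hφd (b i)).tendsto_integral_sq).const_mul _).const_mul _) fun k => ?_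
  have hfderiv := h.memL2_of_continuous ((hφ k).continuous_fderiv (by simp)).norm
  refine (m.integral_sq_apply_sub_le_of_contDiff h hM ((hφ k).of_le (by simp)) n).trans ?_
  rw [mul_assoc (2 ^ _), ← integral_finsetSum _ fun i _ => ((hφd (b i)).1 k).integrableOn_sq,
    ← integral_const_mul K]
  refine mul_le_mul_of_nonneg_left (mul_le_mul_of_nonneg_left ?_ (pow_nonneg zero_le_two _))
    (sq_nonneg _)
  exact integral_mono hfderiv.integrableOn_sq ((integrable_finsetSum _
    fun i _ => ((hφd (b i)).1 k).integrableOn_sq).const_mul K) fun x => hKle _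

theorem ConvW12.strongL2 (h : IsConvexDomain Ω) {F : ℕ → E → ℝ} (hF : ConvW12 WeakL2 Ω F f) :
    StrongL2 Ω F f := by
  obtain ⟨hFm, hfm, hw, hd⟩ := hF
  obtain ⟨m⟩ := h.nonempty_mollifierSeq
  obtain ⟨M, hM⟩ := h.isBounded.exists_norm_le
  let b := Module.finBasis ℝ E
  obtain ⟨K, hK, hKle⟩ := exists_integral_sq_mollifierSeq_apply_sub_le h hM b
  choose C hC using fun i => (hd (b i)).bounded
  let B := K * ∑ i, max (C i) (∫ x in Ω, weakDeriv Ω (b i) f x ^ 2)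
  have hsmall : Tendsto (fun n => (m.contraction n * M + (m.bump n).rOut) ^ 2 * B) atTop (𝓝 0) := by
    simpa using ((m.tendsto_displacement M).pow 2).mul_const B
  refine StrongL2.of_forall_approx hw.1 hw.2.1 fun a ha => ?_
  obtain ⟨n, hn⟩ := (hsmall.eventually (gt_mem_nhds ha)).exists
  have herror : ∀ g, MemW12 Ω g → (∀ i, ∫ x in Ω, weakDeriv Ω (b i) g x ^ 2
      ≤ max (C i) (∫ x in Ω, weakDeriv Ω (b i) f x ^ 2)) →
      ∫ x in Ω, (m.apply g n x - g x) ^ 2 ≤ a := fun g hg hgC => by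
    refine ((hKle m n g hg).trans ?_).trans hn.le
    exact mul_le_mul_of_nonneg_left (mul_le_mul_of_nonneg_left
      (Finset.sum_le_sum fun i _ => hgC i) hK) (sq_nonneg _)
  refine ⟨_, _, m.strongL2_apply_of_weakL2 h.isOpen.measurableSet h.volume_ne_top hw n,
    fun k => ?_, herror f hfm fun i => le_max_right _ _⟩
  simp only [sub_sq_comm (F k _)]
  exact herror (F k) (hFm k) fun i => (hC i k).trans (le_max_left _ _)

end Rellich

section Ladyzhenskaya

lemma isConvexDomain_rect {l h : ℝ} (hl : 0 < l) (hh : 0 < h) : IsConvexDomain (rect l h) where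
  convex := (convex_Ioo _ _).prod (convex_Ioo _ _)
  isOpen := isOpen_Ioo.prod isOpen_Ioo
  zero_mem := ⟨⟨by simp; linarith, by simp; linarith⟩, ⟨by simp; linarith, by simp; linarith⟩⟩
  isBounded := (Metric.isBounded_Ioo _ _).prod (Metric.isBounded_Ioo _ _)

section OneVariable

variable {g g' : ℝ → ℝ} {a b x : ℝ}

lemma sq_sub_sq_le_integral_abs (hg : ∀ t, HasDerivAt g (g' t) t) (hg' : Continuous g') {s : ℝ}
    (hs : s ∈ Ioo a b) (hx : x ∈ Ioo a b) :
    g x ^ 2 - g s ^ 2 ≤ ∫ t in Ioo a b, 2 * |g t * g' t| := by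
  have hgc : Continuous g := continuous_iff_continuousAt.2 fun t => (hg t).continuousAt
  have hftc : ∫ t in s..x, 2 * (g t * g' t) = g x ^ 2 - g s ^ 2 :=
    intervalIntegral.integral_eq_sub_of_hasDerivAt (f := fun t => g t ^ 2)
      (fun t _ => by simpa [mul_assoc] using (hg t).fun_pow 2)
      ((by fun_prop : Continuous fun t => 2 * (g t * g' t)).intervalIntegrable _ _)
  have hcont : Continuous fun t => 2 * |g t * g' t| := by fun_prop
  calc g x ^ 2 - g s ^ 2 ≤ ∫ t in uIoc s x, ‖2 * (g t * g' t)‖ :=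
        hftc ▸ (Real.le_norm_self _).trans intervalIntegral.norm_integral_le_integral_norm_uIoc
    _ = ∫ t in uIoc s x, 2 * |g t * g' t| := by simp [abs_mul]
    _ ≤ ∫ t in Ioo a b, 2 * |g t * g' t| :=
        setIntegral_mono_set (hcont.integrableOn_Icc.mono_set Ioo_subset_Icc_self)
          (Eventually.of_forall fun t => by positivity)
          (uIoc_subset_uIcc.trans (ordConnected_Ioo.uIcc_subset hs hx)).eventuallyLE

lemma sq_le_average_add_integral_abs (hg : ∀ t, HasDerivAt g (g' t) t) (hg' : Continuous g')
    (hx : x ∈ Ioo a b) :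
    g x ^ 2 ≤ (b - a)⁻¹ * (∫ s in Ioo a b, g s ^ 2) + ∫ s in Ioo a b, 2 * |g s * g' s| := by
  have hpos : 0 < b - a := sub_pos.2 (hx.1.trans hx.2)
  have hgc : Continuous g := continuous_iff_continuousAt.2 fun t => (hg t).continuousAt
  have hint : ∀ {k : ℝ → ℝ}, Continuous k → IntegrableOn k (Ioo a b) := fun hk =>
    hk.integrableOn_Icc.mono_set Ioo_subset_Icc_self
  have hg2 : Continuous fun s => g s ^ 2 := hgc.pow 2
  have haverage : ∫ _ in Ioo a b, g x ^ 2
      ≤ ∫ s in Ioo a b, (g s ^ 2 + ∫ s in Ioo a b, 2 * |g s * g' s|) :=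
    setIntegral_mono_on (hint continuous_const) (hint (hg2.add continuous_const))
      measurableSet_Ioo fun s hs =>
        sub_le_iff_le_add'.1 (sq_sub_sq_le_integral_abs hg hg' hs hx)
  rw [integral_add (hint hg2) (hint continuous_const), setIntegral_const,
    setIntegral_const, Real.volume_real_Ioo_of_le (sub_nonneg.1 hpos.le), smul_eq_mul,
    smul_eq_mul] at haverage
  rw [← mul_le_mul_iff_right₀ hpos]
  refine haverage.trans_eq ?_
  field_simp

end OneVariable

lemma sq_le_average_add_integral_abs_line {E : Type*} [NormedAddCommGroup E] [NormedSpace ℝ E]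
    {f : E → ℝ} (hf : ContDiff ℝ ∞ f) {c : ℝ → E} {e : E} (hc : ∀ t, HasDerivAt c e t) {h x : ℝ}
    (hx : x ∈ interval h) :
    f (c x) ^ 2 ≤ h⁻¹ * (∫ s in interval h, f (c s) ^ 2)
      + ∫ s in interval h, 2 * |f (c s) * fderiv ℝ f (c s) e| := by
  have hcont : Continuous c := continuous_iff_continuousAt.2 fun t => (hc t).continuousAt
  have hle := sq_le_average_add_integral_abs
    (fun t => (hf.differentiable (by simp) _).hasFDerivAt.comp_hasDerivAt t (hc t))
    ((continuous_fderiv_apply hf e).comp hcont) hx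
  rwa [show h / 2 - -h / 2 = h by ring] at hle

lemma setIntegral_prod_pow_four_le {s t : Set ℝ} (hs : MeasurableSet s) (ht : MeasurableSet t)
    {f : ℝ × ℝ → ℝ} {A B : ℝ → ℝ} (hf : IntegrableOn (fun x => f x ^ 4) (s ×ˢ t))
    (hA : IntegrableOn A s) (hB : IntegrableOn B t) (hfA : ∀ x ∈ s ×ˢ t, f x ^ 2 ≤ A x.1)
    (hfB : ∀ x ∈ s ×ˢ t, f x ^ 2 ≤ B x.2) :
    ∫ x in s ×ˢ t, f x ^ 4 ≤ (∫ x in s, A x) * ∫ x in t, B x := by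
  have hAB : IntegrableOn (fun x : ℝ × ℝ => A x.1 * B x.2) (s ×ˢ t) := by
    rw [IntegrableOn, Measure.volume_eq_prod, ← Measure.prod_restrict]
    exact hA.mul_prod hB
  rw [← setIntegral_prod_mul A B s t, ← Measure.volume_eq_prod]
  refine setIntegral_mono_on hf hAB (hs.prod ht) fun x hx => ?_
  calc f x ^ 4 = f x ^ 2 * f x ^ 2 := by ring
    _ ≤ A x.1 * B x.2 := mul_le_mul (hfA x hx) (hfB x hx) (sq_nonneg _)
        ((sq_nonneg _).trans (hfA x hx))

variable {l h : ℝ}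

lemma integral_pow_four_le_of_contDiff (hl : 0 < l) (hh : 0 < h) {f : ℝ × ℝ → ℝ}
    (hf : ContDiff ℝ ∞ f) :
    ∫ x in rect l h, f x ^ 4 ≤
      (h⁻¹ * (∫ x in rect l h, f x ^ 2) + ∫ x in rect l h, 2 * |f x * fderiv ℝ f x (0, 1)|) *
      (l⁻¹ * (∫ x in rect l h, f x ^ 2) + ∫ x in rect l h, 2 * |f x * fderiv ℝ f x (1, 0)|) := by
  have hS := isConvexDomain_rect hl hh
  have hfc := hf.continuous
  have hd : ∀ e : ℝ × ℝ, Continuous fun x => fderiv ℝ f x e := continuous_fderiv_apply hf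
  have hres : volume.restrict (rect l h)
      = (volume.restrict (interval l)).prod (volume.restrict (interval h)) :=
    (Measure.prod_restrict _ _).symm
  have hint : ∀ {k : ℝ × ℝ → ℝ}, Continuous k → Integrable k
      ((volume.restrict (interval l)).prod (volume.restrict (interval h))) := fun hk =>
    hres ▸ (hS.memL2_of_continuous hk).integrableOn hS.volume_ne_top
  have hf2 : Integrable (fun x => f x ^ 2) _ := hint (by fun_prop)
  have hfd : ∀ e : ℝ × ℝ, Integrable (fun x => 2 * |f x * fderiv ℝ f x e|) _ := fun e =>
    have := hd e
    hint (by fun_prop)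
  have hline₁ := fun (x₂ t : ℝ) => (hasDerivAt_id t).prodMk (hasDerivAt_const t x₂)
  have hline₂ := fun (x₁ t : ℝ) => (hasDerivAt_const t x₁).prodMk (hasDerivAt_id t)
  refine (setIntegral_prod_pow_four_le (s := interval l) (t := interval h) measurableSet_Ioo
    measurableSet_Ioo
    ((hS.memL2_of_continuous (by fun_prop)).integrableOn hS.volume_ne_top)
    ((hf2.integral_prod_left.const_mul h⁻¹).add (hfd (0, 1)).integral_prod_left)
    ((hf2.integral_prod_right.const_mul l⁻¹).add (hfd (1, 0)).integral_prod_right)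
    (fun x hx => sq_le_average_add_integral_abs_line hf (hline₂ x.1) hx.2)
    fun x hx => sq_le_average_add_integral_abs_line hf (hline₁ x.2) hx.1).trans_eq ?_
  rw [integral_add' (hf2.integral_prod_left.const_mul _) (hfd _).integral_prod_left,
    integral_add' (hf2.integral_prod_right.const_mul _) (hfd _).integral_prod_right,
    integral_const_mul, integral_const_mul, hres, ← integral_prod _ hf2,
    ← integral_prod _ (hfd (0, 1)), ← integral_prod_symm _ hf2, ← integral_prod_symm _ (hfd (1, 0))]

/-- The right-hand side of Ladyzhenskaya's inequality on `rect l h`, as a function of the squared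
`L²` norms of a function and of its partial derivatives. -/
def ladyzhenskayaBound (l h a b c : ℝ) : ℝ :=
  (h⁻¹ * a + 2 * (√a * √c)) * (l⁻¹ * a + 2 * (√a * √b))

lemma continuous_ladyzhenskayaBound (l h : ℝ) :
    Continuous fun p : ℝ × ℝ × ℝ => ladyzhenskayaBound l h p.1 p.2.1 p.2.2 := by
  unfold ladyzhenskayaBound; fun_prop

lemma integral_pow_four_le_ladyzhenskayaBound (hl : 0 < l) (hh : 0 < h) {f : ℝ × ℝ → ℝ}
    (hf : ContDiff ℝ ∞ f) :
    ∫ x in rect l h, f x ^ 4 ≤ ladyzhenskayaBound l h (∫ x in rect l h, f x ^ 2)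
      (∫ x in rect l h, fderiv ℝ f x (1, 0) ^ 2) (∫ x in rect l h, fderiv ℝ f x (0, 1) ^ 2) := by
  have hS := isConvexDomain_rect hl hh
  have hmul : ∀ e : ℝ × ℝ, ∫ x in rect l h, 2 * |f x * fderiv ℝ f x e|
      ≤ 2 * (√(∫ x in rect l h, f x ^ 2) * √(∫ x in rect l h, fderiv ℝ f x e ^ 2)) := fun e => by
    rw [integral_const_mul]
    exact mul_le_mul_of_nonneg_left ((hS.memL2_of_continuous hf.continuous).integral_abs_mul_le
      (hS.memL2_of_continuous (continuous_fderiv_apply hf e))) zero_le_two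
  refine (integral_pow_four_le_of_contDiff hl hh hf).trans (mul_le_mul
    (add_le_add_right (hmul _) _) (add_le_add_right (hmul _) _) ?_ ?_)
  · exact add_nonneg (mul_nonneg (by positivity) (integral_nonneg fun _ => sq_nonneg _))
      (integral_nonneg fun _ => by positivity)
  · exact add_nonneg (mul_nonneg (by positivity) (integral_nonneg fun _ => sq_nonneg _))
      (by positivity)

lemma StrongL2.lintegral_comp_le {E : Type*} [MeasureSpace E] {Ω : Set E} {F : ℕ → E → ℝ}
    {f : E → ℝ} (hF : StrongL2 Ω F f) {g : ℝ → ℝ≥0∞} (hg : Continuous g) {a : ℕ → ℝ≥0∞}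
    {b : ℝ≥0∞} (ha : Tendsto a atTop (𝓝 b)) (hle : ∀ n, ∫⁻ x in Ω, g (F n x) ≤ a n) :
    ∫⁻ x in Ω, g (f x) ≤ b := by
  obtain ⟨ns, hns, hae⟩ := (tendstoInMeasure_of_tendsto_eLpNorm two_ne_zero
    (fun k => (hF.1 k).1) hF.2.1.1 hF.2.2).exists_seq_tendsto_ae
  calc ∫⁻ x in Ω, g (f x) ≤ ∫⁻ x in Ω, liminf (fun k => g (F (ns k) x)) atTop :=
        lintegral_mono_ae <| hae.mono fun x hx => ((hg.tendsto _).comp hx).liminf_eq.ge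
    _ ≤ liminf (fun k => ∫⁻ x in Ω, g (F (ns k) x)) atTop :=
        lintegral_liminf_le' fun k => hg.measurable.comp_aemeasurable (hF.1 _).1.aemeasurable
    _ ≤ liminf (a ∘ ns) atTop := liminf_le_liminf (Eventually.of_forall fun k => hle _)
    _ = b := (ha.comp hns.tendsto_atTop).liminf_eq

lemma MemW12.lintegral_pow_four_le (hl : 0 < l) (hh : 0 < h) {f : ℝ × ℝ → ℝ}
    (hf : MemW12 (rect l h) f) :
    ∫⁻ x in rect l h, ENNReal.ofReal (f x ^ 4)
      ≤ ENNReal.ofReal (ladyzhenskayaBound l h (∫ x in rect l h, f x ^ 2)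
        (∫ x in rect l h, weakDeriv (rect l h) (1, 0) f x ^ 2)
        (∫ x in rect l h, weakDeriv (rect l h) (0, 1) f x ^ 2)) := by
  have hS := isConvexDomain_rect hl hh
  obtain ⟨φ, hφ, hφf, hφd⟩ := hS.exists_smooth_approx hf
  refine hφf.lintegral_comp_le (ENNReal.continuous_ofReal.comp (continuous_pow 4))
    (ENNReal.tendsto_ofReal <| ((continuous_ladyzhenskayaBound l h).tendsto _).comp <|
      hφf.tendsto_integral_sq.prodMk_nhds <| (hφd (1, 0)).tendsto_integral_sq.prodMk_nhds
        (hφd (0, 1)).tendsto_integral_sq) fun k => ?_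
  have hint : IntegrableOn (fun x => φ k x ^ 4) (rect l h) :=
    (hS.memL2_of_continuous ((hφ k).continuous.pow 4)).integrableOn hS.volume_ne_top
  simp only [Function.comp_apply]
  rw [← ofReal_integral_eq_lintegral_ofReal hint (Eventually.of_forall fun x => by positivity)]
  exact ENNReal.ofReal_le_ofReal (integral_pow_four_le_ladyzhenskayaBound hl hh (hφ k))

lemma MemW12.integrableOn_pow_four (hl : 0 < l) (hh : 0 < h) {f : ℝ × ℝ → ℝ}
    (hf : MemW12 (rect l h) f) : IntegrableOn (fun x => f x ^ 4) (rect l h) := by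
  refine ⟨hf.1.1.pow 4, ?_⟩
  rw [hasFiniteIntegral_iff_ofReal (Eventually.of_forall fun x => by positivity)]
  exact (hf.lintegral_pow_four_le hl hh).trans_lt ENNReal.ofReal_lt_top

lemma MemW12.memL2_sq (hl : 0 < l) (hh : 0 < h) {f : ℝ × ℝ → ℝ} (hf : MemW12 (rect l h) f) :
    MemL2 (rect l h) fun x => f x ^ 2 :=
  (memLp_two_iff_integrable_sq (hf.1.1.pow 2)).2 <| by
    simpa [IntegrableOn, ← pow_mul] using hf.integrableOn_pow_four hl hh

theorem MemW12.integral_pow_four_le (hl : 0 < l) (hh : 0 < h) {f : ℝ × ℝ → ℝ}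
    (hf : MemW12 (rect l h) f) :
    ∫ x in rect l h, f x ^ 4 ≤ ladyzhenskayaBound l h (∫ x in rect l h, f x ^ 2)
      (∫ x in rect l h, weakDeriv (rect l h) (1, 0) f x ^ 2)
      (∫ x in rect l h, weakDeriv (rect l h) (0, 1) f x ^ 2) := by
  have hnonneg : ∀ {a b c : ℝ}, 0 ≤ a → 0 ≤ ladyzhenskayaBound l h a b c := fun ha => by
    unfold ladyzhenskayaBound; positivity
  rw [← ENNReal.ofReal_le_ofReal_iff (hnonneg (integral_nonneg fun _ => sq_nonneg _)),
    ofReal_integral_eq_lintegral_ofReal (hf.integrableOn_pow_four hl hh)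
      (Eventually.of_forall fun x => by positivity)]
  exact hf.lintegral_pow_four_le hl hh

section Product

variable {E : Type*} [MeasureSpace E] {Ω : Set E}

lemma MemL2.mul_of_sq {f g : E → ℝ} (hf : MemL2 Ω f) (hg : MemL2 Ω g)
    (hf2 : MemL2 Ω fun x => f x ^ 2) (hg2 : MemL2 Ω fun x => g x ^ 2) :
    MemL2 Ω fun x => f x * g x := by
  refine (memLp_two_iff_integrable_sq (hf.1.mul hg.1)).2 ?_
  simpa [IntegrableOn, mul_pow] using hf2.integrableOn_mul hg2

lemma strongL2_mul_zero {F G : ℕ → E → ℝ} (hF : ∀ n, MemL2 Ω (F n)) (hG : ∀ n, MemL2 Ω (G n))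
    (hF2 : ∀ n, MemL2 Ω fun x => F n x ^ 2) (hG2 : ∀ n, MemL2 Ω fun x => G n x ^ 2)
    (hlim : Tendsto (fun n => (∫ x in Ω, F n x ^ 4) * ∫ x in Ω, G n x ^ 4) atTop (𝓝 0)) :
    StrongL2 Ω (fun n x => F n x * G n x) fun _ => 0 := by
  refine strongL2_iff.2 ⟨fun n => (hF n).mul_of_sq (hG n) (hF2 n) (hG2 n), MemLp.zero', ?_⟩
  have hsqrt := (Real.continuous_sqrt.tendsto 0).comp hlim
  rw [Real.sqrt_zero] at hsqrt
  refine squeeze_zero (fun n => integral_nonneg fun _ => sq_nonneg _) (fun n => ?_) hsqrt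
  have hcs := (le_abs_self _).trans ((hF2 n).abs_integral_mul_le (hG2 n))
  rw [Function.comp_apply, Real.sqrt_mul (integral_nonneg fun _ => by positivity)]
  simpa only [sub_zero, mul_pow, ← pow_mul] using hcs

end Product

lemma ConvW12.tendsto_integral_pow_four (hl : 0 < l) (hh : 0 < h) {F : ℕ → ℝ × ℝ → ℝ}
    {G : ℝ × ℝ → ℝ} (hF : ConvW12 WeakL2 (rect l h) F G) :
    Tendsto (fun n => ∫ x in rect l h, (F n x - G x) ^ 4) atTop (𝓝 0) := by
  have hS := isConvexDomain_rect hl hh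
  have hsq := (strongL2_iff.1 (hF.strongL2 hS)).2.2
  obtain ⟨hFm, hGm, -, hd⟩ := hF
  choose C hC using fun e : ℝ × ℝ => ((hd e).sub_limit.congr_ae
    (fun n => (weakDeriv_sub_ae hS.isOpen (hFm n) hGm).symm) (ae_eq_refl _)).bounded
  have hlim := ((continuous_ladyzhenskayaBound l h).tendsto _).comp
    (hsq.prodMk_nhds (tendsto_const_nhds (x := (C (1, 0), C (0, 1)))))
  simp only [ladyzhenskayaBound, mul_zero, Real.sqrt_zero, zero_mul, add_zero] at hlim
  refine squeeze_zero (fun n => integral_nonneg fun _ => by positivity) (fun n => ?_) hlim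
  refine (((hFm n).sub hS.isOpen hGm).integral_pow_four_le hl hh).trans ?_
  have _ : 0 ≤ ∫ x in rect l h, (F n x - G x) ^ 2 := integral_nonneg fun _ => sq_nonneg _
  simp only [ladyzhenskayaBound, Function.comp_apply]
  gcongr
  exacts [hC _ n, hC _ n]

theorem ConvW12.strongL2_mul (hl : 0 < l) (hh : 0 < h) {F F' : ℕ → ℝ × ℝ → ℝ}
    {G G' : ℝ × ℝ → ℝ} (hF : ConvW12 WeakL2 (rect l h) F G)
    (hF' : ConvW12 WeakL2 (rect l h) F' G') :
    StrongL2 (rect l h) (fun n x => F n x * F' n x) fun x => G x * G' x := by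
  have hΩ := (isConvexDomain_rect hl hh).isOpen
  have hmul : ∀ {A B : ℕ → ℝ × ℝ → ℝ}, (∀ n, MemW12 (rect l h) (A n)) →
      (∀ n, MemW12 (rect l h) (B n)) →
      Tendsto (fun n => (∫ x in rect l h, A n x ^ 4) * ∫ x in rect l h, B n x ^ 4) atTop (𝓝 0) →
      StrongL2 (rect l h) (fun n x => A n x * B n x) fun _ => 0 := fun hA hB =>
    strongL2_mul_zero (fun n => (hA n).1) (fun n => (hB n).1) (fun n => (hA n).memL2_sq hl hh)
      fun n => (hB n).memL2_sq hl hh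
  have hd := fun n => (hF.1 n).sub hΩ hF.2.1
  have hd' := fun n => (hF'.1 n).sub hΩ hF'.2.1
  have ht := hF.tendsto_integral_pow_four hl hh
  have ht' := hF'.tendsto_integral_pow_four hl hh
  have hprod := (((hmul hd hd' (by simpa using ht.mul ht')).add
    (hmul hd (fun _ => hF'.2.1) (by simpa using ht.mul_const _))).add
    (hmul (fun _ => hF.2.1) hd' (by simpa using ht'.const_mul _))).add
    (StrongL2.const (hF.2.1.1.mul_of_sq hF'.2.1.1 (hF.2.1.memL2_sq hl hh)
      (hF'.2.1.memL2_sq hl hh)))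
  refine hprod.congr_ae (fun n => ae_of_all _ fun x => ?_) (ae_of_all _ fun x => ?_) <;>
    simp only <;> ring

end Ladyzhenskaya

section DiagonalMaps

/-- The affine map with diagonal linear part `diag(c, d)` and translation part `p`, the common form
of the dilations of the thin strip and of the reflections of a rectangle. -/
def diagMap (c d : ℝ) (p x : ℝ × ℝ) : ℝ × ℝ := (c * x.1 + p.1, d * x.2 + p.2)

variable {c d : ℝ} {p : ℝ × ℝ}

lemma contDiff_diagMap {n : ℕ∞} : ContDiff ℝ n (diagMap c d p) := by
  unfold diagMap
  fun_prop

lemma fderiv_comp_diagMap {f : ℝ × ℝ → ℝ} (hf : Differentiable ℝ f) (x e : ℝ × ℝ) :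
    fderiv ℝ (fun y => f (diagMap c d p y)) x e
      = fderiv ℝ f (diagMap c d p x) (c * e.1, d * e.2) := by
  have hmap : HasFDerivAt (diagMap c d p) ((c • ContinuousLinearMap.fst ℝ ℝ ℝ).prod
      (d • ContinuousLinearMap.snd ℝ ℝ ℝ)) x :=
    ((hasFDerivAt_fst.const_mul c).add_const p.1).prodMk
      ((hasFDerivAt_snd.const_mul d).add_const p.2)
  exact congr($(((hf _).hasFDerivAt.comp x hmap).fderiv) e)

lemma isHomeomorph_diagMap (hc : c ≠ 0) (hd : d ≠ 0) : IsHomeomorph (diagMap c d p) :=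
  (((Homeomorph.mulLeft₀ c hc).trans (Homeomorph.addRight p.1)).prodCongr
    ((Homeomorph.mulLeft₀ d hd).trans (Homeomorph.addRight p.2))).isHomeomorph

lemma map_diagMap_volume (hc : c ≠ 0) (hd : d ≠ 0) :
    (volume : Measure (ℝ × ℝ)).map (diagMap c d p) = ENNReal.ofReal |c * d|⁻¹ • volume := by
  have hline : ∀ {c : ℝ} (_ : c ≠ 0) (q : ℝ),
      (volume : Measure ℝ).map (fun t => c * t + q) = ENNReal.ofReal |c|⁻¹ • volume := by
    intro c hc q
    have hcomp := Measure.map_map (μ := (volume : Measure ℝ)) (measurable_add_const q)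
      (measurable_const_mul c)
    rw [Real.map_volume_mul_left hc, Measure.map_smul, map_add_right_eq_self, abs_inv] at hcomp
    exact hcomp.symm
  have hprod := Measure.map_prod_map (volume : Measure ℝ) (volume : Measure ℝ)
    ((measurable_const_mul c).add_const p.1) ((measurable_const_mul d).add_const p.2)
  rw [hline hc, hline hd, Measure.prod_smul_left, Measure.prod_smul_right, smul_smul,
    ← ENNReal.ofReal_mul (by positivity), ← mul_inv, ← abs_mul] at hprod
  exact hprod.symm

lemma setIntegral_comp_diagMap (hc : c ≠ 0) (hd : d ≠ 0) (F : ℝ × ℝ → ℝ) (A : Set (ℝ × ℝ)) :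
    ∫ x in diagMap c d p ⁻¹' A, F (diagMap c d p x) = |c * d|⁻¹ * ∫ x in A, F x := by
  rw [← (isHomeomorph_diagMap hc hd).isClosedEmbedding.measurableEmbedding.setIntegral_map F A,
    map_diagMap_volume hc hd, Measure.restrict_smul, integral_smul_measure,
    ENNReal.toReal_ofReal (by positivity), smul_eq_mul]

end DiagonalMaps

section PlaneTestFunctions

/-- The partial derivative in the first variable. -/
def dx (f : ℝ × ℝ → ℝ) (x : ℝ × ℝ) : ℝ := fderiv ℝ f x (1, 0)

/-- The partial derivative in the second variable. -/
def dy (f : ℝ × ℝ → ℝ) (x : ℝ × ℝ) : ℝ := fderiv ℝ f x (0, 1)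

variable {f g : ℝ × ℝ → ℝ} {c d : ℝ} {p : ℝ × ℝ}

lemma fderiv_const_mul_apply (hf : ContDiff ℝ ∞ f) (k : ℝ) (x e : ℝ × ℝ) :
    fderiv ℝ (fun y => k * f y) x e = k * fderiv ℝ f x e := by
  rw [fderiv_const_mul (hf.differentiable (by simp) x)]
  rfl

lemma fderiv_add_apply (hf : ContDiff ℝ ∞ f) (hg : ContDiff ℝ ∞ g) (x e : ℝ × ℝ) :
    fderiv ℝ (fun y => f y + g y) x e = fderiv ℝ f x e + fderiv ℝ g x e := by
  rw [fderiv_fun_add (hf.differentiable (by simp) x) (hg.differentiable (by simp) x)]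
  rfl

lemma fderiv_mul_apply (hf : ContDiff ℝ ∞ f) (hg : ContDiff ℝ ∞ g) (x e : ℝ × ℝ) :
    fderiv ℝ (fun y => f y * g y) x e = fderiv ℝ f x e * g x + f x * fderiv ℝ g x e := by
  rw [fderiv_fun_mul (hf.differentiable (by simp) x) (hg.differentiable (by simp) x)]
  simp only [add_apply, smul_apply, smul_eq_mul]
  ring

lemma contDiff_comp_diagMap (hf : ContDiff ℝ ∞ f) : ContDiff ℝ ∞ fun x => f (diagMap c d p x) :=
  hf.comp contDiff_diagMap

lemma dx_comp_diagMap (hf : ContDiff ℝ ∞ f) (x : ℝ × ℝ) :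
    dx (fun y => f (diagMap c d p y)) x = c * dx f (diagMap c d p x) := by
  have hdir : ((c * 1, d * 0) : ℝ × ℝ) = c • (1, 0) := by simp
  rw [dx, fderiv_comp_diagMap (hf.differentiable (by simp)), hdir, map_smul, smul_eq_mul, dx]

lemma dy_comp_diagMap (hf : ContDiff ℝ ∞ f) (x : ℝ × ℝ) :
    dy (fun y => f (diagMap c d p y)) x = d * dy f (diagMap c d p x) := by
  have hdir : ((c * 0, d * 1) : ℝ × ℝ) = d • (0, 1) := by simp
  rw [dy, fderiv_comp_diagMap (hf.differentiable (by simp)), hdir, map_smul, smul_eq_mul, dy]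

lemma hasDerivAt_fst_slice (hf : ContDiff ℝ ∞ f) (s t : ℝ) :
    HasDerivAt (fun s => f (s, t)) (dx f (s, t)) s :=
  (hf.differentiable (by simp) (s, t)).hasFDerivAt.comp_hasDerivAt s
    ((hasDerivAt_id s).prodMk (hasDerivAt_const s t))

lemma hasDerivAt_snd_slice (hf : ContDiff ℝ ∞ f) (s t : ℝ) :
    HasDerivAt (fun t => f (s, t)) (dy f (s, t)) t :=
  (hf.differentiable (by simp) (s, t)).hasFDerivAt.comp_hasDerivAt t
    ((hasDerivAt_const t s).prodMk (hasDerivAt_id t))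

/-- The smooth functions of compact support in the plane, with no condition at the boundary of the
domain under consideration. -/
def IsTest (f : ℝ × ℝ → ℝ) : Prop := ContDiff ℝ ∞ f ∧ HasCompactSupport f

namespace IsTest

lemma fderiv_apply (hf : IsTest f) (e : ℝ × ℝ) : IsTest fun x => fderiv ℝ f x e :=
  ⟨contDiff_fderiv_apply hf.1 e, hf.2.fderiv_apply ℝ e⟩

lemma dx (hf : IsTest f) : IsTest (dx f) := hf.fderiv_apply _

lemma dy (hf : IsTest f) : IsTest (dy f) := hf.fderiv_apply _

lemma add (hf : IsTest f) (hg : IsTest g) : IsTest fun x => f x + g x :=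
  ⟨hf.1.add hg.1, hf.2.add hg.2⟩

lemma const_mul (hf : IsTest f) (k : ℝ) : IsTest fun x => k * f x :=
  ⟨contDiff_const.mul hf.1, hf.2.mul_left⟩

lemma mul_contDiff (hf : IsTest f) (hg : ContDiff ℝ ∞ g) : IsTest fun x => f x * g x :=
  ⟨hf.1.mul hg, hf.2.mul_right⟩

lemma comp_diagMap (hf : IsTest f) (hc : c ≠ 0) (hd : d ≠ 0) :
    IsTest fun x => f (diagMap c d p x) :=
  ⟨contDiff_comp_diagMap hf.1,
    hf.2.comp_isClosedEmbedding (isHomeomorph_diagMap hc hd).isClosedEmbedding⟩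

lemma memL2 (hf : IsTest f) (Ω : Set (ℝ × ℝ)) : MemL2 Ω f :=
  (hf.1.continuous.memLp_of_hasCompactSupport hf.2).restrict Ω

lemma integrableOn (hf : IsTest f) (Ω : Set (ℝ × ℝ)) : IntegrableOn f Ω :=
  (hf.1.continuous.integrable_of_hasCompactSupport hf.2).integrableOn

end IsTest

end PlaneTestFunctions

section QuarterPlane

/-- The open quarter plane. -/
def quarter : Set (ℝ × ℝ) := Ioi 0 ×ˢ Ioi 0

variable {a b f : ℝ × ℝ → ℝ}

lemma integral_quarter_dx (hf : IsTest f) :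
    ∫ x in quarter, dx f x = -∫ t in Ioi (0 : ℝ), f (0, t) := by
  have hint : IntegrableOn (dx f) (Ioi 0 ×ˢ Ioi 0) (volume.prod volume) := hf.dx.integrableOn _
  rw [← integral_neg]
  calc ∫ x in quarter, dx f x = ∫ t in Ioi (0 : ℝ), ∫ s in Ioi (0 : ℝ), dx f (s, t) := by
        rw [IntegrableOn, ← Measure.prod_restrict] at hint
        rw [← integral_prod_symm _ hint, Measure.prod_restrict]
        rfl
    _ = ∫ t in Ioi (0 : ℝ), -f (0, t) := by
        congr 1
        funext t
        have hcs : HasCompactSupport fun s => f (s, t) := hf.2.comp_isClosedEmbedding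
          (Isometry.of_dist_eq fun a b => by simp [Prod.dist_eq]).isClosedEmbedding
        simpa only [Function.comp_def, id, (hasDerivAt_fst_slice hf.1 _ t).deriv] using
          hcs.integral_Ioi_deriv_eq
            ((hf.1.comp (contDiff_id.prodMk contDiff_const)).of_le (by simp)) 0

lemma integral_quarter_dy (hf : IsTest f) :
    ∫ x in quarter, dy f x = -∫ s in Ioi (0 : ℝ), f (s, 0) := by
  rw [← integral_neg]
  calc ∫ x in quarter, dy f x = ∫ s in Ioi (0 : ℝ), ∫ t in Ioi (0 : ℝ), dy f (s, t) :=
        setIntegral_prod _ (hf.dy.integrableOn _)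
    _ = ∫ s in Ioi (0 : ℝ), -f (s, 0) := by
        congr 1
        funext s
        have hcs : HasCompactSupport fun t => f (s, t) := hf.2.comp_isClosedEmbedding
          (Isometry.of_dist_eq fun a b => by simp [Prod.dist_eq]).isClosedEmbedding
        simpa only [Function.comp_def, id, (hasDerivAt_snd_slice hf.1 s _).deriv] using
          hcs.integral_Ioi_deriv_eq
            ((hf.1.comp (contDiff_const.prodMk contDiff_id)).of_le (by simp)) 0

/-- The integral of the null Lagrangian `∂₂a ∂₁b - ∂₁a ∂₂b` over the quarter plane. -/
def nullLagrangian (a b : ℝ × ℝ → ℝ) : ℝ := ∫ x in quarter, (dy a x * dx b x - dx a x * dy b x)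

lemma nullLagrangian_eq_boundary_integral (ha : IsTest a) (hb : IsTest b) :
    nullLagrangian a b = (∫ t in Ioi (0 : ℝ), a (0, t) * deriv (fun s => b (0, s)) t)
      - ∫ t in Ioi (0 : ℝ), a (t, 0) * deriv (fun s => b (s, 0)) t := by
  have hdiv : ∀ x, dy a x * dx b x - dx a x * dy b x
      = dy (fun x => a x * dx b x) x - dx (fun x => a x * dy b x) x := fun x => by
    have hsymm : dx (dy b) x = dy (dx b) x := fderiv_fderiv_apply_comm hb.1 _ _ x
    have hdy : dy (fun x => a x * dx b x) x = dy a x * dx b x + a x * dy (dx b) x :=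
      fderiv_mul_apply ha.1 hb.dx.1 x _
    have hdx : dx (fun x => a x * dy b x) x = dx a x * dy b x + a x * dx (dy b) x :=
      fderiv_mul_apply ha.1 hb.dy.1 x _
    rw [hdy, hdx, hsymm]
    ring
  simp only [nullLagrangian, hdiv]
  rw [integral_sub ((ha.mul_contDiff hb.dx.1).dy.integrableOn _)
    ((ha.mul_contDiff hb.dy.1).dx.integrableOn _),
    integral_quarter_dy (ha.mul_contDiff hb.dx.1), integral_quarter_dx (ha.mul_contDiff hb.dy.1)]
  simp only [(hasDerivAt_fst_slice hb.1 _ 0).deriv, (hasDerivAt_snd_slice hb.1 0 _).deriv]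
  ring

/-- The combination `α f(x₁, x₂) + β f(c x₁, d x₂)`, from which Nitsche's extension of a
displacement across the sides of the quarter plane is built. -/
def stretch (c d α β : ℝ) (f : ℝ × ℝ → ℝ) (x : ℝ × ℝ) : ℝ := α * f x + β * f (diagMap c d 0 x)

variable {c d : ℝ}

lemma IsTest.stretch (hf : IsTest f) (hc : c ≠ 0) (hd : d ≠ 0) (α β : ℝ) :
    IsTest (stretch c d α β f) :=
  (hf.const_mul α).add ((hf.comp_diagMap hc hd).const_mul β)

lemma dx_stretch (hf : ContDiff ℝ ∞ f) (α β : ℝ) :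
    dx (stretch c d α β f) = stretch c d α (c * β) (dx f) := by
  funext x
  calc dx (stretch c d α β f) x
      = dx (fun y => α * f y) x + dx (fun y => β * f (diagMap c d 0 y)) x :=
        fderiv_add_apply (contDiff_const.mul hf) (contDiff_const.mul (contDiff_comp_diagMap hf)) x _
    _ = α * dx f x + β * dx (fun y => f (diagMap c d 0 y)) x :=
        congr_arg₂ _ (fderiv_const_mul_apply hf α x _)
          (fderiv_const_mul_apply (contDiff_comp_diagMap hf) β x _)
    _ = stretch c d α (c * β) (dx f) x := by
        rw [dx_comp_diagMap hf, stretch]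
        ring

lemma dy_stretch (hf : ContDiff ℝ ∞ f) (α β : ℝ) :
    dy (stretch c d α β f) = stretch c d α (d * β) (dy f) := by
  funext x
  calc dy (stretch c d α β f) x
      = dy (fun y => α * f y) x + dy (fun y => β * f (diagMap c d 0 y)) x :=
        fderiv_add_apply (contDiff_const.mul hf) (contDiff_const.mul (contDiff_comp_diagMap hf)) x _
    _ = α * dy f x + β * dy (fun y => f (diagMap c d 0 y)) x :=
        congr_arg₂ _ (fderiv_const_mul_apply hf α x _)
          (fderiv_const_mul_apply (contDiff_comp_diagMap hf) β x _)
    _ = stretch c d α (d * β) (dy f) x := by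
        rw [dy_comp_diagMap hf, stretch]
        ring

lemma integral_sq_stretch_le (hf : IsTest f) (hc : 1 ≤ c) (hd : 1 ≤ d) (α β : ℝ) :
    ∫ x in quarter, stretch c d α β f x ^ 2
      ≤ (2 * α ^ 2 + 2 * β ^ 2) * ∫ x in quarter, f x ^ 2 := by
  have hc0 : 0 < c := one_pos.trans_le hc
  have hd0 : 0 < d := one_pos.trans_le hd
  have hpre : diagMap c d 0 ⁻¹' quarter = quarter := by
    ext x
    simp [diagMap, quarter, hc0, hd0]
  have hscale : ∫ x in quarter, f (diagMap c d 0 x) ^ 2 ≤ ∫ x in quarter, f x ^ 2 := by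
    have hsub := setIntegral_comp_diagMap (p := 0) hc0.ne' hd0.ne' (fun x => f x ^ 2) quarter
    rw [hpre] at hsub
    rw [hsub]
    refine mul_le_of_le_one_left (integral_nonneg fun x => sq_nonneg _) (inv_le_one_of_one_le₀ ?_)
    exact (one_le_mul_of_one_le_of_one_le hc hd).trans (le_abs_self _)
  have hadd := ((hf.const_mul α).memL2 quarter).integral_add_sq_le
    (((hf.comp_diagMap (p := 0) hc0.ne' hd0.ne').const_mul β).memL2 quarter)
  simp only [mul_pow, integral_const_mul] at hadd
  have := mul_le_mul_of_nonneg_left hscale (sq_nonneg β)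
  unfold stretch
  linarith

end QuarterPlane

section KornQuarterPlane

lemma MemL2.integral_sq_add_sq_add_sq {E : Type*} [MeasureSpace E] {Ω : Set E} {f g h : E → ℝ}
    (hf : MemL2 Ω f) (hg : MemL2 Ω g) (hh : MemL2 Ω h) :
    ∫ x in Ω, (f x ^ 2 + g x ^ 2 + h x ^ 2)
      = (∫ x in Ω, f x ^ 2) + (∫ x in Ω, g x ^ 2) + ∫ x in Ω, h x ^ 2 := by
  have hfg : IntegrableOn (fun x => f x ^ 2 + g x ^ 2) Ω :=
    hf.integrableOn_sq.add hg.integrableOn_sq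
  rw [integral_add hfg hh.integrableOn_sq, integral_add hf.integrableOn_sq hg.integrableOn_sq]

/-- Up to constant factors, the squared norm of the symmetrized gradient of the displacement
`(a, s b)`; the sign `s` distinguishes a displacement from its reflections. -/
def kornDensity (s : ℝ) (a b : ℝ × ℝ → ℝ) (x : ℝ × ℝ) : ℝ :=
  (dy a x + s * dx b x) ^ 2 + dx a x ^ 2 + dy b x ^ 2

variable {a b : ℝ × ℝ → ℝ} {s : ℝ}

lemma kornDensity_nonneg (x : ℝ × ℝ) : 0 ≤ kornDensity s a b x := by
  unfold kornDensity
  positivity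

lemma continuous_kornDensity (ha : ContDiff ℝ ∞ a) (hb : ContDiff ℝ ∞ b) :
    Continuous (kornDensity s a b) := by
  have hdx : ∀ {f}, ContDiff ℝ ∞ f → Continuous (dx f) := fun hf => continuous_fderiv_apply hf _
  have hdy : ∀ {f}, ContDiff ℝ ∞ f → Continuous (dy f) := fun hf => continuous_fderiv_apply hf _
  exact ((((hdy ha).add (continuous_const.mul (hdx hb))).pow 2).add ((hdx ha).pow 2)).add
    ((hdy hb).pow 2)

namespace IsTest

lemma integral_kornDensity (ha : IsTest a) (hb : IsTest b) (s : ℝ) (Ω : Set (ℝ × ℝ)) :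
    ∫ x in Ω, kornDensity s a b x = (∫ x in Ω, (Ribbon.dy a x + s * Ribbon.dx b x) ^ 2)
      + (∫ x in Ω, Ribbon.dx a x ^ 2) + ∫ x in Ω, Ribbon.dy b x ^ 2 :=
  ((ha.dy.add (hb.dx.const_mul s)).memL2 Ω).integral_sq_add_sq_add_sq (ha.dx.memL2 Ω)
    (hb.dy.memL2 Ω)

lemma integrableOn_kornDensity (ha : IsTest a) (hb : IsTest b) (s : ℝ) (Ω : Set (ℝ × ℝ)) :
    IntegrableOn (kornDensity s a b) Ω :=
  (((ha.dy.add (hb.dx.const_mul s)).memL2 Ω).integrableOn_sq.add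
    (ha.dx.memL2 Ω).integrableOn_sq).add (hb.dy.memL2 Ω).integrableOn_sq

end IsTest

lemma mul_nullLagrangian_le (ha : IsTest a) (hb : IsTest b) (hs : s ^ 2 = 1) :
    s * nullLagrangian a b ≤ -(1 / 2) * (∫ x in quarter, dy a x ^ 2)
      + 1 / 2 * ∫ x in quarter, kornDensity s a b x := by
  have hdy := (ha.dy.memL2 quarter).integrableOn_sq.const_mul (-(1 / 2))
  have hden := (ha.integrableOn_kornDensity hb s quarter).const_mul (1 / 2)
  have hnull := ((ha.dy.mul_contDiff hb.dx.1).integrableOn quarter).sub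
    ((ha.dx.mul_contDiff hb.dy.1).integrableOn quarter)
  rw [nullLagrangian, ← integral_const_mul, ← integral_const_mul, ← integral_const_mul,
    ← integral_add hdy hden]
  refine integral_mono (hnull.const_mul s) (hdy.add hden) fun x => ?_
  have hsq : s * (dy a x * dx b x - dx a x * dy b x)
      = -(1 / 2) * dy a x ^ 2 + 1 / 2 * kornDensity s a b x
        - (1 / 2 * (s * dx b x) ^ 2 + 1 / 2 * (s * dx a x + dy b x) ^ 2) := by
    unfold kornDensity
    linear_combination 1 / 2 * dx a x ^ 2 * hs
  rw [hsq]
  exact sub_le_self _ (by positivity)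

lemma integral_kornDensity_stretch_le {c d M : ℝ} (ha : IsTest a) (hb : IsTest b) (hc : 1 ≤ c)
    (hd : 1 ≤ d) {α β β' : ℝ} (hβ : c * β' = -(d * β)) (h₁ : 2 * α ^ 2 + 2 * (d * β) ^ 2 ≤ M)
    (h₂ : 2 * α ^ 2 + 2 * (c * β) ^ 2 ≤ M) (h₃ : 2 * α ^ 2 + 2 * (d * β') ^ 2 ≤ M) :
    ∫ x in quarter, kornDensity (-s) (stretch c d α β a) (stretch c d (-α) β' b) x
      ≤ M * ∫ x in quarter, kornDensity s a b x := by
  have hc0 : c ≠ 0 := (one_pos.trans_le hc).ne'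
  have hd0 : d ≠ 0 := (one_pos.trans_le hd).ne'
  rw [(ha.stretch hc0 hd0 _ _).integral_kornDensity (hb.stretch hc0 hd0 _ _),
    ha.integral_kornDensity hb, dx_stretch ha.1, dx_stretch hb.1, dy_stretch ha.1, dy_stretch hb.1,
    mul_add, mul_add]
  have hstretch : ∀ {f α β}, IsTest f → 2 * α ^ 2 + 2 * β ^ 2 ≤ M →
      ∫ x in quarter, stretch c d α β f x ^ 2 ≤ M * ∫ x in quarter, f x ^ 2 := fun hf hM =>
    (integral_sq_stretch_le hf hc hd _ _).trans
      (mul_le_mul_of_nonneg_right hM (integral_nonneg fun x => sq_nonneg _))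
  have hshear : ∀ x, stretch c d α (d * β) (dy a) x + -s * stretch c d (-α) (c * β') (dx b) x
      = stretch c d α (d * β) (fun x => dy a x + s * dx b x) x := fun x => by
    simp only [stretch, hβ]
    ring
  simp only [hshear]
  exact add_le_add (add_le_add (hstretch (ha.dy.add (hb.dx.const_mul s)) h₁)
    (hstretch ha.dx h₂)) (hstretch hb.dy (by rwa [neg_sq]))

lemma nullLagrangian_stretch_sum (ha : IsTest a) (hb : IsTest b) :
    nullLagrangian a b - nullLagrangian (stretch 3 1 (-2) 3 a) (stretch 3 1 2 (-1) b)
      - nullLagrangian (stretch 1 3 2 (-1) a) (stretch 1 3 (-2) 3 b)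
      + nullLagrangian (stretch 3 1 (-2) 3 (stretch 1 3 2 (-1) a))
        (stretch 3 1 2 (-1) (stretch 1 3 (-2) 3 b)) = 0 := by
  have ha' : IsTest (stretch 1 3 2 (-1) a) := ha.stretch one_ne_zero three_ne_zero _ _
  have hb' : IsTest (stretch 1 3 (-2) 3 b) := hb.stretch one_ne_zero three_ne_zero _ _
  rw [nullLagrangian_eq_boundary_integral ha hb, nullLagrangian_eq_boundary_integral ha' hb',
    nullLagrangian_eq_boundary_integral (ha.stretch three_ne_zero one_ne_zero _ _)
      (hb.stretch three_ne_zero one_ne_zero _ _),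
    nullLagrangian_eq_boundary_integral (ha'.stretch three_ne_zero one_ne_zero _ _)
      (hb'.stretch three_ne_zero one_ne_zero _ _)]
  simp only [stretch, diagMap, Prod.fst_zero, Prod.snd_zero, mul_zero, add_zero, one_mul]
  ring_nf

theorem korn_quarter (ha : IsTest a) (hb : IsTest b) :
    ∫ x in quarter, dy a x ^ 2 ≤ 171 ^ 2 * ∫ x in quarter, kornDensity 1 a b x := by
  have hX : ∀ {f α β}, IsTest f → IsTest (stretch 3 1 α β f) := fun hf =>
    hf.stretch three_ne_zero one_ne_zero _ _
  have hY : ∀ {f α β}, IsTest f → IsTest (stretch 1 3 α β f) := fun hf =>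
    hf.stretch one_ne_zero three_ne_zero _ _
  have hEX : ∀ {f g s}, IsTest f → IsTest g →
      ∫ x in quarter, kornDensity (-s) (stretch 3 1 (-2) 3 f) (stretch 3 1 2 (-1) g) x
        ≤ 170 * ∫ x in quarter, kornDensity s f g x := fun {f g s} hf hg => by
    simpa using integral_kornDensity_stretch_le (s := s) (α := -2) (β := 3) (β' := -1) (c := 3)
      (d := 1) hf hg (by norm_num) le_rfl (by norm_num) (M := 170) (by norm_num) (by norm_num)
      (by norm_num)
  have hEY : ∫ x in quarter, kornDensity (-1) (stretch 1 3 2 (-1) a) (stretch 1 3 (-2) 3 b) x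
      ≤ 170 * ∫ x in quarter, kornDensity 1 a b x :=
    integral_kornDensity_stretch_le ha hb le_rfl (by norm_num) (by norm_num) (by norm_num)
      (by norm_num) (by norm_num)
  have hEXY := hEX (s := -1) (hY (α := 2) (β := -1) ha) (hY (α := -2) (β := 3) hb)
  rw [neg_neg] at hEXY
  have h₀ := mul_nullLagrangian_le ha hb (s := 1) (by norm_num)
  have hNX := mul_nullLagrangian_le (hX (α := -2) (β := 3) ha) (hX (α := 2) (β := -1) hb)
    (s := -1) (by norm_num)
  have hNY := mul_nullLagrangian_le (hY (α := 2) (β := -1) ha) (hY (α := -2) (β := 3) hb)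
    (s := -1) (by norm_num)
  have hNXY := mul_nullLagrangian_le (hX (α := -2) (β := 3) (hY (α := 2) (β := -1) ha))
    (hX (α := 2) (β := -1) (hY (α := -2) (β := 3) hb)) (s := 1) (by norm_num)
  have hpos : ∀ f : ℝ × ℝ → ℝ, 0 ≤ ∫ x in quarter, dy f x ^ 2 := fun f =>
    integral_nonneg fun x => sq_nonneg _
  linarith [nullLagrangian_stretch_sum ha hb, hEX (s := 1) ha hb, hpos (stretch 3 1 (-2) 3 a),
    hpos (stretch 1 3 2 (-1) a), hpos (stretch 3 1 (-2) 3 (stretch 1 3 2 (-1) a))]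

end KornQuarterPlane

section KornRectangle

variable {a b η : ℝ × ℝ → ℝ} {l h : ℝ}

lemma IsTest.exists_sq_fderiv_apply_le (hη : IsTest η) (e : ℝ × ℝ) :
    ∃ K, 0 ≤ K ∧ ∀ x, fderiv ℝ η x e ^ 2 ≤ K := by
  obtain ⟨M, hM⟩ := (hη.fderiv_apply e).1.continuous.bounded_above_of_compact_support
    (hη.fderiv_apply e).2
  refine ⟨M ^ 2, sq_nonneg M, fun x => ?_⟩
  rw [← sq_abs]
  exact pow_le_pow_left₀ (abs_nonneg _) (hM x) 2

/-- A product of two bump functions, which cuts off at distance `l`, `h` from a corner of a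
rectangle of sides `l`, `h`. -/
def cornerCutoff (χ ψ : ContDiffBump (0 : ℝ)) (x : ℝ × ℝ) : ℝ := χ x.1 * ψ x.2

section CornerCutoff

variable (χ ψ : ContDiffBump (0 : ℝ)) {x : ℝ × ℝ}

lemma isTest_cornerCutoff : IsTest (cornerCutoff χ ψ) := by
  refine ⟨(χ.contDiff.comp contDiff_fst).mul (ψ.contDiff.comp contDiff_snd),
    HasCompactSupport.intro (χ.hasCompactSupport.isCompact.prod ψ.hasCompactSupport.isCompact)
      fun x hx => ?_⟩
  by_contra hne
  exact hx ⟨subset_tsupport _ (left_ne_zero_of_mul hne),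
    subset_tsupport _ (right_ne_zero_of_mul hne)⟩

lemma cornerCutoff_nonneg : 0 ≤ cornerCutoff χ ψ x := mul_nonneg χ.nonneg ψ.nonneg

lemma sq_cornerCutoff_le_one : cornerCutoff χ ψ x ^ 2 ≤ 1 :=
  pow_le_one₀ (cornerCutoff_nonneg χ ψ) (mul_le_one₀ χ.le_one ψ.nonneg ψ.le_one)

lemma cornerCutoff_eq_one (hx : x ∈ Ioo 0 χ.rIn ×ˢ Ioo 0 ψ.rIn) : cornerCutoff χ ψ x = 1 := by
  have hone : ∀ (ψ : ContDiffBump (0 : ℝ)) {t}, t ∈ Ioo 0 ψ.rIn → ψ t = 1 := fun ψ t ht =>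
    ψ.one_of_mem_closedBall <| by
      rw [mem_closedBall_zero_iff, Real.norm_of_nonneg ht.1.le]
      exact ht.2.le
  rw [cornerCutoff, hone χ hx.1, hone ψ hx.2, mul_one]

lemma cornerCutoff_eq_zero (hx : x ∈ quarter \ Ioo 0 χ.rOut ×ˢ Ioo 0 ψ.rOut) :
    cornerCutoff χ ψ x = 0 := by
  have hlt : ∀ (ψ : ContDiffBump (0 : ℝ)) {t}, ψ t ≠ 0 → t < ψ.rOut := fun ψ t ht => by
    rw [← Function.mem_support, ψ.support_eq, mem_ball_zero_iff] at ht
    exact (le_abs_self t).trans_lt ht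
  by_contra hne
  exact hx.2 ⟨⟨hx.1.1, hlt χ (left_ne_zero_of_mul hne)⟩, hx.1.2, hlt ψ (right_ne_zero_of_mul hne)⟩

end CornerCutoff

lemma kornDensity_mul (hη : ContDiff ℝ ∞ η) (ha : ContDiff ℝ ∞ a) (hb : ContDiff ℝ ∞ b) (s : ℝ)
    (x : ℝ × ℝ) :
    kornDensity s (fun y => η y * a y) (fun y => η y * b y) x
      = (η x * (dy a x + s * dx b x) + dy η x * a x + dx η x * (s * b x)) ^ 2
        + (η x * dx a x + dx η x * a x) ^ 2 + (η x * dy b x + dy η x * b x) ^ 2 := by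
  simp only [kornDensity, dx, dy, fderiv_mul_apply hη ha, fderiv_mul_apply hη hb]
  ring

lemma kornDensity_mul_eq_zero (hη : ContDiff ℝ ∞ η) (hη0 : ∀ x, 0 ≤ η x) (ha : ContDiff ℝ ∞ a)
    (hb : ContDiff ℝ ∞ b) (s : ℝ) {x : ℝ × ℝ} (hx : η x = 0) :
    kornDensity s (fun y => η y * a y) (fun y => η y * b y) x = 0 := by
  have hfderiv : fderiv ℝ η x = 0 :=
    IsLocalMin.fderiv_eq_zero (Eventually.of_forall fun y => hx ▸ hη0 y)
  rw [kornDensity_mul hη ha hb]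
  simp [dx, dy, hx, hfderiv]

lemma kornDensity_mul_le {K : ℝ} (hη : ContDiff ℝ ∞ η) (ha : ContDiff ℝ ∞ a)
    (hb : ContDiff ℝ ∞ b) {x : ℝ × ℝ} (h₁ : η x ^ 2 ≤ 1) (hdx : dx η x ^ 2 ≤ K)
    (hdy : dy η x ^ 2 ≤ K) :
    kornDensity 1 (fun y => η y * a y) (fun y => η y * b y) x
      ≤ (3 + 5 * K) * (kornDensity 1 a b x + a x ^ 2 + b x ^ 2) := by
  have hthree : ∀ p q r : ℝ, (p + q + r) ^ 2 ≤ 3 * p ^ 2 + 3 * q ^ 2 + 3 * r ^ 2 := fun p q r => by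
    linarith [sq_nonneg (p - q), sq_nonneg (p - r), sq_nonneg (q - r)]
  have htwo : ∀ p q : ℝ, (p + q) ^ 2 ≤ 2 * p ^ 2 + 2 * q ^ 2 := fun p q => by
    linarith [sq_nonneg (p - q)]
  have hmul : ∀ {p M : ℝ} (q : ℝ), p ^ 2 ≤ M → (p * q) ^ 2 ≤ M * q ^ 2 := fun q hp => by
    rw [mul_pow]
    exact mul_le_mul_of_nonneg_right hp (sq_nonneg q)
  have hK : 0 ≤ K := (sq_nonneg _).trans hdx
  have hKden : 0 ≤ K * kornDensity 1 a b x := mul_nonneg hK (kornDensity_nonneg x)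
  rw [kornDensity_mul hη ha hb]
  unfold kornDensity at hKden ⊢
  linarith [hthree (η x * (dy a x + 1 * dx b x)) (dy η x * a x) (dx η x * (1 * b x)),
    htwo (η x * dx a x) (dx η x * a x), htwo (η x * dy b x) (dy η x * b x),
    hmul (dy a x + 1 * dx b x) h₁, hmul (a x) hdy, hmul (1 * b x) hdx, hmul (dx a x) h₁,
    hmul (a x) hdx, hmul (dy b x) h₁, hmul (b x) hdy, sq_nonneg (dx a x), sq_nonneg (dy b x),
    sq_nonneg (a x), sq_nonneg (b x)]

lemma integrableOn_kornDensity_add_sq (ha : ContDiff ℝ ∞ a) (hb : ContDiff ℝ ∞ b) {m n : ℝ} :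
    IntegrableOn (fun x => kornDensity 1 a b x + a x ^ 2 + b x ^ 2) (Ioo 0 m ×ˢ Ioo 0 n) :=
  (((continuous_kornDensity ha hb).add (ha.continuous.pow 2)).add
    (hb.continuous.pow 2)).continuousOn.integrableOn_compact (isCompact_Icc.prod isCompact_Icc)
    |>.mono_set (prod_mono Ioo_subset_Icc_self Ioo_subset_Icc_self)

lemma korn_corner (hl : 0 < l) (hh : 0 < h) :
    ∃ C, 0 ≤ C ∧ ∀ a b : ℝ × ℝ → ℝ, ContDiff ℝ ∞ a → ContDiff ℝ ∞ b →
      ∫ x in Ioo 0 (2 * l / 3) ×ˢ Ioo 0 (2 * h / 3), dy a x ^ 2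
        ≤ C * ∫ x in Ioo 0 l ×ˢ Ioo 0 h, (kornDensity 1 a b x + a x ^ 2 + b x ^ 2) := by
  let χ : ContDiffBump (0 : ℝ) := ⟨2 * l / 3, l, by positivity, by linarith⟩
  let ψ : ContDiffBump (0 : ℝ) := ⟨2 * h / 3, h, by positivity, by linarith⟩
  set η := cornerCutoff χ ψ
  have hη : IsTest η := isTest_cornerCutoff χ ψ
  obtain ⟨K₁, hK₁0, hK₁⟩ := hη.exists_sq_fderiv_apply_le (1, 0)
  obtain ⟨K₂, -, hK₂⟩ := hη.exists_sq_fderiv_apply_le (0, 1)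
  refine ⟨171 ^ 2 * (3 + 5 * max K₁ K₂), by positivity, fun a b ha hb => ?_⟩
  have hηa : IsTest fun x => η x * a x := hη.mul_contDiff ha
  have hηb : IsTest fun x => η x * b x := hη.mul_contDiff hb
  set A : Set (ℝ × ℝ) := Ioo 0 (2 * l / 3) ×ˢ Ioo 0 (2 * h / 3)
  have hA : IsOpen A := isOpen_Ioo.prod isOpen_Ioo
  calc ∫ x in A, dy a x ^ 2
      = ∫ x in A, dy (fun x => η x * a x) x ^ 2 := by
        refine setIntegral_congr_fun hA.measurableSet fun x hx => ?_
        have hev : (fun x => η x * a x) =ᶠ[𝓝 x] a := by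
          filter_upwards [hA.mem_nhds hx] with y hy
          rw [show η y = 1 from cornerCutoff_eq_one χ ψ hy, one_mul]
        simp only [dy, hev.fderiv_eq]
    _ ≤ ∫ x in quarter, dy (fun x => η x * a x) x ^ 2 :=
        setIntegral_mono_set (hηa.dy.memL2 quarter).integrableOn_sq
          (Eventually.of_forall fun x => sq_nonneg _)
          (show A ⊆ quarter from fun x hx => ⟨hx.1.1, hx.2.1⟩).eventuallyLE
    _ ≤ 171 ^ 2 * ∫ x in quarter, kornDensity 1 (fun x => η x * a x) (fun x => η x * b x) x :=
        korn_quarter hηa hηb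
    _ = 171 ^ 2 * ∫ x in Ioo 0 l ×ˢ Ioo 0 h,
          kornDensity 1 (fun x => η x * a x) (fun x => η x * b x) x := by
        rw [setIntegral_eq_of_subset_of_forall_sdiff_eq_zero (s := Ioo 0 l ×ˢ Ioo 0 h)
          (show MeasurableSet quarter from measurableSet_Ioi.prod measurableSet_Ioi)
          (fun x hx => ⟨hx.1.1, hx.2.1⟩) fun x hx => kornDensity_mul_eq_zero hη.1
            (fun y => cornerCutoff_nonneg χ ψ) ha hb 1 (cornerCutoff_eq_zero χ ψ hx)]
    _ ≤ _ := by
        rw [mul_assoc, ← integral_const_mul (3 + 5 * max K₁ K₂)]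
        gcongr 171 ^ 2 * ?_
        exact integral_mono (hηa.integrableOn_kornDensity hηb 1 _)
          ((integrableOn_kornDensity_add_sq ha hb).const_mul _) fun x =>
            kornDensity_mul_le hη.1 ha hb (sq_cornerCutoff_le_one χ ψ)
              ((hK₁ x).trans (le_max_left _ _)) ((hK₂ x).trans (le_max_right _ _))

section Reflection

variable {σ τ : ℝ}

/-- The image of `(0, 2l/3) × (0, 2h/3)` under the reflection, for signs `σ` and `τ`, that maps the
origin to a corner of the centred rectangle of sides `l` and `h`. -/
def cornerRect (l h σ τ : ℝ) : Set (ℝ × ℝ) :=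
  {x | σ * x.1 ∈ Ioo (-(l / 2)) (l / 6) ∧ τ * x.2 ∈ Ioo (-(h / 2)) (h / 6)}

lemma preimage_cornerRect (hσ : σ ^ 2 = 1) (hτ : τ ^ 2 = 1) :
    diagMap σ τ (-(σ * (l / 2)), -(τ * (h / 2))) ⁻¹' cornerRect l h σ τ
      = Ioo 0 (2 * l / 3) ×ˢ Ioo 0 (2 * h / 3) := by
  ext x
  have h₁ : σ * (σ * x.1 + -(σ * (l / 2))) = x.1 - l / 2 := by
    linear_combination (x.1 - l / 2) * hσ
  have h₂ : τ * (τ * x.2 + -(τ * (h / 2))) = x.2 - h / 2 := by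
    linear_combination (x.2 - h / 2) * hτ
  simp only [cornerRect, diagMap, mem_preimage, mem_ofPred_eq, h₁, h₂, mem_prod, mem_Ioo]
  constructor <;> rintro ⟨⟨_, _⟩, _, _⟩ <;> refine ⟨⟨?_, ?_⟩, ?_, ?_⟩ <;> linarith

lemma preimage_rect_diagMap (hσ : σ ^ 2 = 1) (hτ : τ ^ 2 = 1) :
    diagMap σ τ (-(σ * (l / 2)), -(τ * (h / 2))) ⁻¹' rect l h = Ioo 0 l ×ˢ Ioo 0 h := by
  ext x
  simp only [rect, interval, diagMap, mem_preimage, mem_prod, mem_Ioo]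
  rcases sq_eq_one_iff.1 hσ with rfl | rfl <;> rcases sq_eq_one_iff.1 hτ with rfl | rfl <;>
    constructor <;> rintro ⟨⟨_, _⟩, _, _⟩ <;> refine ⟨⟨?_, ?_⟩, ?_, ?_⟩ <;> linarith

lemma kornDensity_reflect (hσ : σ ^ 2 = 1) (hτ : τ ^ 2 = 1) (ha : ContDiff ℝ ∞ a)
    (hb : ContDiff ℝ ∞ b) (p x : ℝ × ℝ) :
    kornDensity 1 (fun y => σ * a (diagMap σ τ p y)) (fun y => τ * b (diagMap σ τ p y)) x
      = kornDensity 1 a b (diagMap σ τ p x) := by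
  have ha' : ContDiff ℝ ∞ fun y => a (diagMap σ τ p y) := contDiff_comp_diagMap ha
  have hb' : ContDiff ℝ ∞ fun y => b (diagMap σ τ p y) := contDiff_comp_diagMap hb
  have hdxa := dx_comp_diagMap (c := σ) (d := τ) (p := p) ha x
  have hdya := dy_comp_diagMap (c := σ) (d := τ) (p := p) ha x
  have hdxb := dx_comp_diagMap (c := σ) (d := τ) (p := p) hb x
  have hdyb := dy_comp_diagMap (c := σ) (d := τ) (p := p) hb x
  simp only [dx, dy] at hdxa hdya hdxb hdyb
  simp only [kornDensity, dx, dy, fderiv_const_mul_apply ha', fderiv_const_mul_apply hb', hdxa,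
    hdya, hdxb, hdyb, mul_pow, ← mul_add, mul_left_comm τ σ, one_mul, hσ, hτ]

lemma korn_cornerRect (hl : 0 < l) (hh : 0 < h) :
    ∃ C, 0 ≤ C ∧ ∀ σ τ : ℝ, σ ^ 2 = 1 → τ ^ 2 = 1 →
      ∀ a b : ℝ × ℝ → ℝ, ContDiff ℝ ∞ a → ContDiff ℝ ∞ b →
      ∫ x in cornerRect l h σ τ, dy a x ^ 2
        ≤ C * ∫ x in rect l h, (kornDensity 1 a b x + a x ^ 2 + b x ^ 2) := by
  obtain ⟨C, hC, hcorner⟩ := korn_corner hl hh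
  refine ⟨C, hC, fun σ τ hσ hτ a b ha hb => ?_⟩
  set p : ℝ × ℝ := (-(σ * (l / 2)), -(τ * (h / 2))) with hp
  have hreflect := hcorner (fun x => σ * a (diagMap σ τ p x)) (fun x => τ * b (diagMap σ τ p x))
    (contDiff_const.mul (contDiff_comp_diagMap ha)) (contDiff_const.mul (contDiff_comp_diagMap hb))
  have hdy : ∀ x, dy (fun x => σ * a (diagMap σ τ p x)) x ^ 2 = dy a (diagMap σ τ p x) ^ 2 :=
    fun x => by
      rw [dy, fderiv_const_mul_apply (contDiff_comp_diagMap ha), ← dy, dy_comp_diagMap ha, mul_pow,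
        mul_pow, hσ, hτ, one_mul, one_mul]
  have hsubst : ∀ (F : ℝ × ℝ → ℝ) (A : Set (ℝ × ℝ)),
      ∫ x in diagMap σ τ p ⁻¹' A, F (diagMap σ τ p x) = ∫ x in A, F x := fun F A => by
    have hdet : |σ * τ| = 1 := (sq_eq_sq₀ (abs_nonneg _) zero_le_one).1 (by
      rw [sq_abs, mul_pow, hσ, hτ, mul_one, one_pow])
    rw [setIntegral_comp_diagMap (by rintro rfl; simp at hσ) (by rintro rfl; simp at hτ), hdet,
      inv_one, one_mul]
  simp only [hdy, kornDensity_reflect hσ hτ ha hb, mul_pow, hσ, hτ, one_mul] at hreflect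
  rw [← preimage_cornerRect hσ hτ, ← preimage_rect_diagMap hσ hτ, ← hp,
    hsubst (fun x => dy a x ^ 2)] at hreflect
  exact hreflect.trans_eq (congr_arg (C * ·)
    (hsubst (fun x => kornDensity 1 a b x + a x ^ 2 + b x ^ 2) _))

lemma setIntegral_le_sum_of_subset_iUnion {E ι : Type*} [MeasureSpace E] [Fintype ι] {Ω : Set E}
    {A : ι → Set E} {F : E → ℝ} (hF : ∀ x, 0 ≤ F x) (hA : ∀ i, IntegrableOn F (A i))
    (hΩ : Ω ⊆ ⋃ i, A i) : ∫ x in Ω, F x ≤ ∑ i, ∫ x in A i, F x := by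
  rw [← integral_finsetSum_measure fun i _ => hA i, ← Measure.sum_fintype]
  exact integral_mono_measure ((Measure.restrict_mono hΩ le_rfl).trans Measure.restrict_iUnion_le)
    (Eventually.of_forall hF) (by
      rw [Measure.sum_fintype]
      exact integrable_finsetSum_measure.2 fun i _ => hA i)

lemma rect_subset_iUnion_cornerRect (hl : 0 < l) (hh : 0 < h) :
    rect l h ⊆ ⋃ s : ℤˣ × ℤˣ, cornerRect l h (s.1 : ℤ) (s.2 : ℤ) := by
  have hsign : ∀ {l t : ℝ}, 0 < l → t ∈ interval l →
      ∃ σ : ℤˣ, ((σ : ℤ) : ℝ) * t ∈ Ioo (-(l / 2)) (l / 6) := by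
    rintro l t _ ⟨h₁, h₂⟩
    rcases le_or_gt t 0 with ht | ht
    · exact ⟨1, by simp; constructor <;> linarith⟩
    · exact ⟨-1, by simp; constructor <;> linarith⟩
  intro x hx
  obtain ⟨σ, hσ⟩ := hsign hl hx.1
  obtain ⟨τ, hτ⟩ := hsign hh hx.2
  exact mem_iUnion.2 ⟨(σ, τ), hσ, hτ⟩

lemma korn_rect_of_contDiff (hl : 0 < l) (hh : 0 < h) :
    ∃ C, 0 ≤ C ∧ ∀ a b : ℝ × ℝ → ℝ, ContDiff ℝ ∞ a → ContDiff ℝ ∞ b →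
      ∫ x in rect l h, dy a x ^ 2
        ≤ C * ∫ x in rect l h, (kornDensity 1 a b x + a x ^ 2 + b x ^ 2) := by
  obtain ⟨C, hC, hcorner⟩ := korn_cornerRect hl hh
  refine ⟨4 * C, by positivity, fun a b ha hb => ?_⟩
  have hsq : ∀ σ : ℤˣ, ((σ : ℤ) : ℝ) ^ 2 = 1 := fun σ => by
    rcases Int.units_eq_one_or σ with rfl | rfl <;> norm_num
  have hint : ∀ s : ℤˣ × ℤˣ, IntegrableOn (fun x => dy a x ^ 2)
      (cornerRect l h (s.1 : ℤ) (s.2 : ℤ)) := by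
    rintro ⟨σ, τ⟩
    refine (((continuous_fderiv_apply ha _).pow 2).continuousOn.integrableOn_compact
      ((isCompact_Icc (a := -l) (b := l)).prod (isCompact_Icc (a := -h) (b := h)))).mono_set ?_
    rintro x ⟨⟨h₁, h₂⟩, h₃, h₄⟩
    rcases Int.units_eq_one_or σ with rfl | rfl <;> rcases Int.units_eq_one_or τ with rfl | rfl <;>
      simp at h₁ h₂ h₃ h₄ <;> exact ⟨⟨by linarith, by linarith⟩, by linarith, by linarith⟩
  calc ∫ x in rect l h, dy a x ^ 2
      ≤ ∑ s : ℤˣ × ℤˣ, ∫ x in cornerRect l h (s.1 : ℤ) (s.2 : ℤ), dy a x ^ 2 :=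
        setIntegral_le_sum_of_subset_iUnion (fun x => sq_nonneg _) hint
          (rect_subset_iUnion_cornerRect hl hh)
    _ ≤ Fintype.card (ℤˣ × ℤˣ) •
          (C * ∫ x in rect l h, (kornDensity 1 a b x + a x ^ 2 + b x ^ 2)) :=
        Finset.sum_le_card_nsmul _ _ _ fun s _ => hcorner _ _ (hsq s.1) (hsq s.2) a b ha hb
    _ = _ := by
        rw [show Fintype.card (ℤˣ × ℤˣ) = 4 from rfl, nsmul_eq_mul, mul_assoc]
        norm_num

end Reflection

theorem korn_rect (hl : 0 < l) (hh : 0 < h) :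
    ∃ C, 0 ≤ C ∧ ∀ a b : ℝ × ℝ → ℝ, MemW12 (rect l h) a → MemW12 (rect l h) b →
      ∫ x in rect l h, pd (rect l h) 1 a x ^ 2 ≤ C *
        ((∫ x in rect l h, (pd (rect l h) 1 a x + pd (rect l h) 0 b x) ^ 2)
          + (∫ x in rect l h, pd (rect l h) 0 a x ^ 2) + (∫ x in rect l h, pd (rect l h) 1 b x ^ 2)
          + (∫ x in rect l h, a x ^ 2) + ∫ x in rect l h, b x ^ 2) := by
  obtain ⟨C, hC, hsmooth⟩ := korn_rect_of_contDiff hl hh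
  have hrect := isConvexDomain_rect hl hh
  refine ⟨C, hC, fun a b ha hb => ?_⟩
  obtain ⟨φ, hφ, hφa, hφd⟩ := hrect.exists_smooth_approx ha
  obtain ⟨ψ, hψ, hψb, hψd⟩ := hrect.exists_smooth_approx hb
  refine le_of_tendsto_of_tendsto' (hφd (0, 1)).tendsto_integral_sq
    (((((((hφd (0, 1)).add (hψd (1, 0))).tendsto_integral_sq.add
      (hφd (1, 0)).tendsto_integral_sq).add (hψd (0, 1)).tendsto_integral_sq).add
      hφa.tendsto_integral_sq).add hψb.tendsto_integral_sq).const_mul C) fun k => ?_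
  have hmem : ∀ {f : ℝ × ℝ → ℝ}, Continuous f → MemL2 (rect l h) f := hrect.memL2_of_continuous
  have hden : IntegrableOn (kornDensity 1 (φ k) (ψ k)) (rect l h) :=
    (hmem (continuous_kornDensity (hφ k) (hψ k))).integrableOn hrect.volume_ne_top
  have hφsq := (hmem (hφ k).continuous).integrableOn_sq
  have hsplit : ∫ x in rect l h, kornDensity 1 (φ k) (ψ k) x
      = (∫ x in rect l h, (dy (φ k) x + dx (ψ k) x) ^ 2) + (∫ x in rect l h, dx (φ k) x ^ 2)
        + ∫ x in rect l h, dy (ψ k) x ^ 2 := by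
    simp only [kornDensity, one_mul]
    exact MemL2.integral_sq_add_sq_add_sq (((hφd (0, 1)).add (hψd (1, 0))).1 k)
      ((hφd (1, 0)).1 k) ((hψd (0, 1)).1 k)
  have hφψ := hsmooth (φ k) (ψ k) (hφ k) (hψ k)
  have hden_sq : IntegrableOn (fun x => kornDensity 1 (φ k) (ψ k) x + φ k x ^ 2) (rect l h) :=
    hden.add hφsq
  rwa [integral_add hden_sq (hmem (hψ k).continuous).integrableOn_sq, integral_add hden hφsq,
    hsplit] at hφψ

end KornRectangle

section Scaling

section DiagonalMaps

variable {Ω : Set (ℝ × ℝ)} {f g : ℝ × ℝ → ℝ} {c d : ℝ} {p : ℝ × ℝ}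

lemma diagMap_diagMap_inv (hc : c ≠ 0) (hd : d ≠ 0) (x : ℝ × ℝ) :
    diagMap c d p (diagMap c⁻¹ d⁻¹ (-(c⁻¹ * p.1), -(d⁻¹ * p.2)) x) = x := by
  ext <;> simp only [diagMap] <;> field

lemma diagMap_inv_diagMap (hc : c ≠ 0) (hd : d ≠ 0) (x : ℝ × ℝ) :
    diagMap c⁻¹ d⁻¹ (-(c⁻¹ * p.1), -(d⁻¹ * p.2)) (diagMap c d p x) = x := by
  ext <;> simp only [diagMap] <;> field

lemma volume_preimage_diagMap_ne_top (hc : c ≠ 0) (hd : d ≠ 0) (hΩ : volume Ω ≠ ⊤) :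
    volume (diagMap c d p ⁻¹' Ω) ≠ ⊤ := by
  rw [← (isHomeomorph_diagMap hc hd).isClosedEmbedding.measurableEmbedding.map_apply,
    map_diagMap_volume hc hd]
  exact ENNReal.mul_ne_top ENNReal.ofReal_ne_top hΩ

lemma MemL2.comp_diagMap (hc : c ≠ 0) (hd : d ≠ 0) (hf : MemL2 Ω f) :
    MemL2 (diagMap c d p ⁻¹' Ω) fun x => f (diagMap c d p x) := by
  have hemb : MeasurableEmbedding (diagMap c d p) :=
    (isHomeomorph_diagMap hc hd).isClosedEmbedding.measurableEmbedding
  refine (hemb.memLp_map_measure_iff (g := f)).1 ?_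
  rw [← hemb.restrict_map, map_diagMap_volume hc hd, Measure.restrict_smul]
  exact MemLp.smul_measure hf ENNReal.ofReal_ne_top

lemma HasWeakDeriv.comp_diagMap (hc : c ≠ 0) (hd : d ≠ 0) (hΩ : volume Ω ≠ ⊤) {e : ℝ × ℝ}
    (hf : MemL2 Ω f) (hg : MemL2 Ω g) (h : HasWeakDeriv Ω (c * e.1, d * e.2) f g) :
    HasWeakDeriv (diagMap c d p ⁻¹' Ω) e (fun x => f (diagMap c d p x))
      (fun x => g (diagMap c d p x)) := by
  have hfin := volume_preimage_diagMap_ne_top (p := p) hc hd hΩ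
  refine ⟨(hf.comp_diagMap hc hd).locallyIntegrableOn hfin,
    (hg.comp_diagMap hc hd).locallyIntegrableOn hfin, fun φ hφ hφc hφs => ?_⟩
  set inv := diagMap c⁻¹ d⁻¹ (-(c⁻¹ * p.1), -(d⁻¹ * p.2))
  have hinv : IsHomeomorph inv := isHomeomorph_diagMap (inv_ne_zero hc) (inv_ne_zero hd)
  have hψ : ContDiff ℝ ∞ fun x => φ (inv x) := contDiff_comp_diagMap hφ
  have hψs : tsupport (fun x => φ (inv x)) ⊆ Ω := fun x hx => by
    have hmem := hφs (tsupport_comp_subset_preimage φ hinv.continuous hx)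
    rwa [mem_preimage, diagMap_diagMap_inv hc hd] at hmem
  have hfderiv : ∀ x, fderiv ℝ (fun y => φ (inv y)) (diagMap c d p x) (c * e.1, d * e.2)
      = fderiv ℝ φ x e := fun x => by
    rw [← fderiv_comp_diagMap (hψ.differentiable (by simp))]
    simp only [inv, diagMap_inv_diagMap hc hd]
  have hleft := setIntegral_comp_diagMap (p := p) hc hd
    (fun x => f x * fderiv ℝ (fun y => φ (inv y)) x (c * e.1, d * e.2)) Ω
  have hright := setIntegral_comp_diagMap (p := p) hc hd (fun x => g x * φ (inv x)) Ω
  simp only [hfderiv] at hleft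
  simp only [inv, diagMap_inv_diagMap hc hd] at hright
  rw [hleft, hright, h.2.2 _ hψ (hφc.comp_isClosedEmbedding hinv.isClosedEmbedding) hψs, mul_neg]

end DiagonalMaps

/-- The factors `1`, `ε` by which the scaling `x ↦ (x₁, ε x₂)` acts on the partial derivatives. -/
def scaleFactor (ε : ℝ) : Fin 2 → ℝ := ![1, ε]

lemma diagMap_one_zero (ε : ℝ) : diagMap 1 ε 0 = fun x => (x.1, ε * x.2) := by
  funext x
  simp [diagMap]

variable {l ε : ℝ} {v : ℝ × ℝ → ℝ}

lemma preimage_rect_scaling (hε : 0 < ε) : diagMap 1 ε 0 ⁻¹' rect l ε = rect l 1 := by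
  ext x
  have hlow : -ε / 2 < ε * x.2 ↔ -1 / 2 < x.2 := by
    rw [show -ε / 2 = ε * (-1 / 2) by ring, mul_lt_mul_iff_right₀ hε]
  have hup : ε * x.2 < ε / 2 ↔ x.2 < 1 / 2 := by
    rw [show ε / 2 = ε * (1 / 2) by ring, mul_lt_mul_iff_right₀ hε]
  simp only [diagMap_one_zero, rect, interval, mem_preimage, mem_prod, mem_Ioo, hlow, hup]

lemma integral_rect_scaling (hε : 0 < ε) (F : ℝ × ℝ → ℝ) :
    ∫ x in rect l 1, F (x.1, ε * x.2) = 1 / ε * ∫ x in rect l ε, F x := by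
  have hsubst := setIntegral_comp_diagMap (p := 0) one_ne_zero hε.ne' F (rect l ε)
  rwa [preimage_rect_scaling hε, one_mul, abs_of_pos hε, diagMap_one_zero, ← one_div] at hsubst

lemma pd_comp_scaling (hl : 0 < l) (hε : 0 < ε) (hv : MemW12 (rect l ε) v) (i : Fin 2) (c : ℝ) :
    pd (rect l 1) i (fun x => c * v (x.1, ε * x.2)) =ᵐ[volume.restrict (rect l 1)]
      fun x => c * (scaleFactor ε i * pd (rect l ε) i v (x.1, ε * x.2)) := by
  have hrect := isConvexDomain_rect hl hε
  set e : ℝ × ℝ := ![((1 : ℝ), (0 : ℝ)), (0, 1)] i with he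
  have hdir : ((1 * e.1, ε * e.2) : ℝ × ℝ) = scaleFactor ε i • e := by
    fin_cases i <;> simp [e, scaleFactor]
  have hscaled := HasWeakDeriv.comp_diagMap (p := 0) one_ne_zero hε.ne' hrect.volume_ne_top hv.1
    ((hv.memL2_weakDeriv hrect.isOpen e).const_mul _)
    (hdir ▸ (hv.hasWeakDeriv e).smul_dir (scaleFactor ε i))
  rw [preimage_rect_scaling hε, diagMap_one_zero] at hscaled
  exact ((hscaled.const_mul c).ae_eq_weakDeriv (isConvexDomain_rect hl one_pos).isOpen).symm

lemma pd_scaledV (hl : 0 < l) (hε : 0 < ε) (hv : MemW12 (rect l ε) v) (i : Fin 2) :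
    pd (rect l 1) i (scaledV ε v) =ᵐ[volume.restrict (rect l 1)]
      fun x => scaleFactor ε i * pd (rect l ε) i v (x.1, ε * x.2) := by
  have h := pd_comp_scaling hl hε hv i 1
  simp only [one_mul] at h
  exact h

lemma weakDeriv_congr_ae {Ω : Set (ℝ × ℝ)} (hΩ : IsOpen Ω) (hΩ' : volume Ω ≠ ⊤)
    {f f' : ℝ × ℝ → ℝ} (h : f =ᵐ[volume.restrict Ω] f') (hf : MemW12 Ω f) (e : ℝ × ℝ) :
    weakDeriv Ω e f =ᵐ[volume.restrict Ω] weakDeriv Ω e f' :=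
  ((hf.hasWeakDeriv e).congr_ae h (ae_eq_refl _) ((hf.1.congr_ae h).locallyIntegrableOn hΩ')
    (hf.hasWeakDeriv e).2.1).ae_eq_weakDeriv hΩ

lemma pd_pd_scaledV (hl : 0 < l) (hε : 0 < ε) (hv : MemW22 (rect l ε) v)
    (hw : MemW22 (rect l 1) (scaledV ε v)) (i j : Fin 2) :
    pd (rect l 1) i (pd (rect l 1) j (scaledV ε v)) =ᵐ[volume.restrict (rect l 1)]
      fun x => scaleFactor ε j * (scaleFactor ε i *
        pd (rect l ε) i (pd (rect l ε) j v) (x.1, ε * x.2)) := by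
  have hrect := isConvexDomain_rect hl one_pos
  exact (weakDeriv_congr_ae hrect.isOpen hrect.volume_ne_top (pd_scaledV hl hε hv.1 j) (hw.2 _)
    _).trans (pd_comp_scaling hl hε (hv.2 _) i (scaleFactor ε j))

lemma strain_scaling (hl : 0 < l) (hε : 0 < ε) {u : Fin 2 → ℝ × ℝ → ℝ}
    (hu : ∀ i, MemW12 (rect l ε) (u i)) :
    ∀ᵐ x ∂volume.restrict (rect l 1), strain (rect l ε) u (x.1, ε * x.2)
      = scaledStrain l ε (scaledU ε u) x := by
  have hpd₀ : ∀ i, pd (rect l 1) i (scaledU ε u 0) =ᵐ[volume.restrict (rect l 1)] _ :=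
    pd_scaledV hl hε (hu 0)
  have hpd₁ : ∀ i, pd (rect l 1) i (scaledU ε u 1) =ᵐ[volume.restrict (rect l 1)] _ := fun i =>
    pd_comp_scaling hl hε (hu 1) i ε
  filter_upwards [hpd₀ 0, hpd₀ 1, hpd₁ 0, hpd₁ 1] with x h₀₀ h₀₁ h₁₀ h₁₁
  ext i j
  simp only [scaledStrain, h₀₀, h₀₁, h₁₀, h₁₁]
  fin_cases i <;> fin_cases j <;> simp [strain, scaleFactor] <;> field

lemma pd_scaling_eq_scaledGrad (hl : 0 < l) (hε : 0 < ε) (hv : MemW12 (rect l ε) v) :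
    ∀ᵐ x ∂volume.restrict (rect l 1), ∀ i,
      pd (rect l ε) i v (x.1, ε * x.2) = scaledGrad l ε (scaledV ε v) i x := by
  filter_upwards [pd_scaledV hl hε hv 0, pd_scaledV hl hε hv 1] with x h₀ h₁ i
  fin_cases i <;> simp [scaledGrad, h₀, h₁, scaleFactor, hε.ne']

lemma hessian_scaling (hl : 0 < l) (hε : 0 < ε) (hv : MemW22 (rect l ε) v)
    (hw : MemW22 (rect l 1) (scaledV ε v)) :
    ∀ᵐ x ∂volume.restrict (rect l 1),
      hessian (rect l ε) v (x.1, ε * x.2) = scaledHessian l ε (scaledV ε v) x := by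
  have h := pd_pd_scaledV hl hε hv hw
  filter_upwards [h 0 0, h 0 1, h 1 0, h 1 1] with x h₀₀ h₀₁ h₁₀ h₁₁
  ext i j
  fin_cases i <;> fin_cases j <;>
    simp [scaledHessian, hessian, h₀₀, h₀₁, h₁₀, h₁₁, scaleFactor] <;> field

/-- The von Kármán strain `E + ½ p ⊗ p` of an in-plane strain `E` and an out-of-plane gradient
`p`. -/
def karmanStrain (E : Matrix (Fin 2) (Fin 2) ℝ) (p : Fin 2 → ℝ) : Matrix (Fin 2) (Fin 2) ℝ :=
  E + (1 / 2 : ℝ) • Matrix.vecMulVec p p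

lemma energy2D_eq (hl : 0 < l) (hε : 0 < ε) (Q : QuadraticForm ℝ (Matrix (Fin 2) (Fin 2) ℝ))
    (f : ℝ × ℝ → ℝ) (g : Fin 2 → ℝ × ℝ → ℝ) {u : Fin 2 → ℝ × ℝ → ℝ}
    (hu : ∀ i, MemW12 (rect l ε) (u i)) (hv : MemW22 (rect l ε) v)
    (hw : MemW22 (rect l 1) (scaledV ε v)) :
    energy2D Q l ε f g u v
      = 1 / 2 * (∫ x in rect l 1, Q (karmanStrain (scaledStrain l ε (scaledU ε u) x)
          fun i => scaledGrad l ε (scaledV ε v) i x))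
        + 1 / 24 * (∫ x in rect l 1, Q (scaledHessian l ε (scaledV ε v) x))
        - ∫ x in rect l 1, (f (x.1, ε * x.2) * scaledV ε v x
          + g 0 (x.1, ε * x.2) * scaledU ε u 0 x
          + 1 / ε * g 1 (x.1, ε * x.2) * scaledU ε u 1 x) := by
  simp only [energy2D]
  rw [← integral_rect_scaling hε, ← integral_rect_scaling hε, ← integral_rect_scaling hε,
    integral_const_mul, integral_const_mul]
  congr 2
  · congr 1
    refine integral_congr_ae ?_
    filter_upwards [strain_scaling hl hε hu, pd_scaling_eq_scaledGrad hl hε hv.1]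
      with x hstrain hgrad
    simp only [hstrain, gradTensor, hgrad, karmanStrain, Matrix.vecMulVec]
  · congr 1
    refine integral_congr_ae ?_
    filter_upwards [hessian_scaling hl hε hv hw] with x hhess
    rw [hhess]
  · funext x
    simp only [Fin.sum_univ_two, scaledV, scaledU, Matrix.cons_val_zero, Matrix.cons_val_one]
    field

end Scaling

section QuadraticForms

lemma exists_pos_mul_sq_le_of_posDef {V : Type*} [AddCommGroup V] [Module ℝ V]
    [FiniteDimensional ℝ V] {Q : QuadraticForm ℝ V} (hQ : Q.PosDef) (ℓ : Module.Dual ℝ V) :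
    ∃ κ > 0, ∀ v, κ * ℓ v ^ 2 ≤ Q v := by
  set B : LinearMap.BilinForm ℝ V := QuadraticMap.associated Q
  have hBQ : ∀ v, B v v = Q v := QuadraticMap.associated_eq_self_apply ℝ Q
  have hsymm : LinearMap.IsSymm B := QuadraticForm.associated_isSymm ℝ Q
  have hnondeg : B.Nondegenerate := hsymm.isRefl.nondegenerate_iff_separatingLeft.2
    (QuadraticMap.separatingLeft_of_anisotropic Q hQ.anisotropic)
  obtain ⟨r, rfl⟩ := (B.toDual hnondeg).surjective ℓ
  refine ⟨(Q r + 1)⁻¹, inv_pos.2 (by linarith [hQ.nonneg r]), fun v => ?_⟩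
  have hcauchy : B r v ^ 2 ≤ Q r * Q v := by
    simpa only [hBQ] using B.apply_sq_le_of_symm (fun v => (hBQ v).symm ▸ hQ.nonneg v) hsymm r v
  rw [LinearMap.BilinForm.toDual_def, inv_mul_le_iff₀ (by linarith [hQ.nonneg r])]
  linarith [hQ.nonneg v]

lemma bilinForm_eq_sum {m n : Type*} [Fintype m] [Fintype n] [DecidableEq m] [DecidableEq n]
    (B : LinearMap.BilinForm ℝ (Matrix m n ℝ)) (A C : Matrix m n ℝ) :
    B A C = ∑ p : m × n, ∑ q : m × n,
      B (Matrix.single p.1 p.2 1) (Matrix.single q.1 q.2 1) * (A p.1 p.2 * C q.1 q.2) := by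
  have hexpand : ∀ A : Matrix m n ℝ, A = ∑ p : m × n, A p.1 p.2 • Matrix.single p.1 p.2 (1 : ℝ) :=
    fun A => by
      conv_lhs => rw [Matrix.matrix_eq_sum_single A]
      simp [Fintype.sum_prod_type]
  conv_lhs => rw [hexpand A, hexpand C]
  simp only [map_sum, map_smul, LinearMap.sum_apply, LinearMap.smul_apply, smul_eq_mul,
    Finset.mul_sum]
  rw [Finset.sum_comm]
  exact Finset.sum_congr rfl fun p _ => Finset.sum_congr rfl fun q _ => by ring

section Integrals

variable {E m n : Type*} [MeasureSpace E] {Ω : Set E} [Finite m] [Finite n]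

lemma integrableOn_bilinForm (B : LinearMap.BilinForm ℝ (Matrix m n ℝ)) {A C : E → Matrix m n ℝ}
    (hA : ∀ i j, MemL2 Ω fun x => A x i j) (hC : ∀ i j, MemL2 Ω fun x => C x i j) :
    IntegrableOn (fun x => B (A x) (C x)) Ω := by
  classical
  cases nonempty_fintype m
  cases nonempty_fintype n
  simp only [fun x => bilinForm_eq_sum B (A x) (C x)]
  exact integrable_finsetSum _ fun p _ => integrable_finsetSum _ fun q _ =>
    ((hA p.1 p.2).integrableOn_mul (hC q.1 q.2)).const_mul _

lemma tendsto_integral_bilinForm (B : LinearMap.BilinForm ℝ (Matrix m n ℝ))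
    {A : ℕ → E → Matrix m n ℝ} {A₀ C : E → Matrix m n ℝ}
    (hA : ∀ i j, WeakL2 Ω (fun k x => A k x i j) fun x => A₀ x i j)
    (hC : ∀ i j, MemL2 Ω fun x => C x i j) :
    Tendsto (fun k => ∫ x in Ω, B (A k x) (C x)) atTop (𝓝 (∫ x in Ω, B (A₀ x) (C x))) := by
  classical
  cases nonempty_fintype m
  cases nonempty_fintype n
  have hsum : ∀ A : E → Matrix m n ℝ, (∀ i j, MemL2 Ω fun x => A x i j) →
      ∫ x in Ω, B (A x) (C x) = ∑ p : m × n, ∑ q : m × n,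
        B (Matrix.single p.1 p.2 1) (Matrix.single q.1 q.2 1) *
          ∫ x in Ω, A x p.1 p.2 * C x q.1 q.2 := fun A hA => by
    have hint : ∀ p q : m × n, IntegrableOn (fun x =>
        B (Matrix.single p.1 p.2 1) (Matrix.single q.1 q.2 1) * (A x p.1 p.2 * C x q.1 q.2)) Ω :=
      fun p q => ((hA p.1 p.2).integrableOn_mul (hC q.1 q.2)).const_mul _
    simp only [fun x => bilinForm_eq_sum B (A x) (C x), ← integral_const_mul]
    rw [integral_finsetSum _ fun p _ => integrable_finsetSum _ fun q _ => hint p q]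
    exact Finset.sum_congr rfl fun p _ => integral_finsetSum _ fun q _ => hint p q
  simp only [fun k => hsum _ fun i j => (hA i j).1 k, hsum _ fun i j => (hA i j).2.1]
  exact tendsto_finsetSum _ fun p _ => tendsto_finsetSum _ fun q _ =>
    ((hA p.1 p.2).2.2 _ (hC q.1 q.2)).const_mul _

lemma integrableOn_quadraticForm (Q : QuadraticForm ℝ (Matrix m n ℝ)) {A : E → Matrix m n ℝ}
    (hA : ∀ i j, MemL2 Ω fun x => A x i j) : IntegrableOn (fun x => Q (A x)) Ω := by
  simpa only [QuadraticMap.associated_eq_self_apply] using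
    integrableOn_bilinForm (QuadraticMap.associated Q) hA hA

lemma tendsto_integral_quadraticForm_sub (Q : QuadraticForm ℝ (Matrix m n ℝ))
    {A : ℕ → E → Matrix m n ℝ} {A₀ : E → Matrix m n ℝ}
    (hA : ∀ i j, WeakL2 Ω (fun k x => A k x i j) fun x => A₀ x i j) :
    Tendsto (fun k => (∫ x in Ω, Q (A k x)) - ∫ x in Ω, Q (A k x - A₀ x)) atTop
      (𝓝 (∫ x in Ω, Q (A₀ x))) := by
  set B : LinearMap.BilinForm ℝ (Matrix m n ℝ) := QuadraticMap.associated Q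
  have hBQ : ∀ X, B X X = Q X := QuadraticMap.associated_eq_self_apply ℝ Q
  have hexpand : ∀ X Y, Q X - Q (X - Y) = 2 * B X Y - Q Y := fun X Y => by
    have hsymm : B Y X = B X Y := (QuadraticForm.associated_isSymm ℝ Q).eq Y X
    simp only [← hBQ, map_sub, LinearMap.sub_apply, hsymm]
    ring
  have hA₀ : ∀ i j, MemL2 Ω fun x => A₀ x i j := fun i j => (hA i j).2.1
  have hlim := ((tendsto_integral_bilinForm B hA hA₀).const_mul 2).sub_const (∫ x in Ω, Q (A₀ x))
  simp only [hBQ, two_mul, add_sub_cancel_right] at hlim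
  refine hlim.congr fun k => ?_
  have hAk : ∀ i j, MemL2 Ω fun x => A k x i j := fun i j => (hA i j).1 k
  have hsub : IntegrableOn (fun x => Q (A k x - A₀ x)) Ω :=
    integrableOn_quadraticForm Q fun i j => (hAk i j).sub (hA₀ i j)
  rw [← integral_sub (integrableOn_quadraticForm Q hAk) hsub]
  simp only [hexpand]
  rw [integral_sub ((integrableOn_bilinForm B hAk hA₀).const_mul 2)
    (integrableOn_quadraticForm Q hA₀), integral_const_mul, two_mul]

end Integrals

section Symmetric

variable {m : Type*} {Q : QuadraticForm ℝ (Matrix m m ℝ)}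

lemma nonneg_of_isSymm (hQ : ∀ A : Matrix m m ℝ, A.IsSymm → A ≠ 0 → 0 < Q A)
    {A : Matrix m m ℝ} (hA : A.IsSymm) : 0 ≤ Q A := by
  rcases eq_or_ne A 0 with rfl | h
  · exact (map_zero Q).ge
  · exact (hQ A hA h).le

lemma exists_pos_mul_sq_le_of_isSymm [Finite m]
    (hQ : ∀ A : Matrix m m ℝ, A.IsSymm → A ≠ 0 → 0 < Q A) (i j : m) :
    ∃ κ > 0, ∀ A : Matrix m m ℝ, A.IsSymm → κ * A i j ^ 2 ≤ Q A := by
  let W : Submodule ℝ (Matrix m m ℝ) :=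
    { carrier := {A | A.IsSymm}
      add_mem' := Matrix.IsSymm.add
      zero_mem' := Matrix.isSymm_zero
      smul_mem' := fun c _ hA => hA.smul c }
  have hpos : (Q.comp W.subtype).PosDef := fun A hA => hQ A A.2 fun h => hA (Subtype.ext h)
  obtain ⟨κ, hκ, hcoercive⟩ := exists_pos_mul_sq_le_of_posDef hpos
    (Matrix.entryLinearMap ℝ ℝ i j ∘ₗ W.subtype)
  exact ⟨κ, hκ, fun A hA => hcoercive ⟨A, hA⟩⟩

lemma strongL2_of_tendsto_integral_quadraticForm [Finite m] {E : Type*} [MeasureSpace E]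
    {Ω : Set E}
    (hQ : ∀ A : Matrix m m ℝ, A.IsSymm → A ≠ 0 → 0 < Q A)
    {A : ℕ → E → Matrix m m ℝ} {A₀ : E → Matrix m m ℝ}
    (hA : ∀ k i j, MemL2 Ω fun x => A k x i j) (hA₀ : ∀ i j, MemL2 Ω fun x => A₀ x i j)
    (hsymm : ∀ k, ∀ᵐ x ∂volume.restrict Ω, (A k x - A₀ x).IsSymm)
    (h : Tendsto (fun k => ∫ x in Ω, Q (A k x - A₀ x)) atTop (𝓝 0)) (i j : m) :
    StrongL2 Ω (fun k x => A k x i j) fun x => A₀ x i j := by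
  obtain ⟨κ, hκ, hcoercive⟩ := exists_pos_mul_sq_le_of_isSymm hQ i j
  have hsub : ∀ k i j, MemL2 Ω fun x => (A k x - A₀ x) i j := fun k i j =>
    (hA k i j).sub (hA₀ i j)
  refine strongL2_iff.2 ⟨fun k => hA k i j, hA₀ i j, ?_⟩
  refine squeeze_zero (fun k => integral_nonneg fun x => sq_nonneg _) (fun k => ?_)
    (by simpa only [mul_zero] using h.const_mul κ⁻¹)
  rw [← integral_const_mul]
  refine integral_mono_ae (hsub k i j).integrableOn_sq
    ((integrableOn_quadraticForm Q (hsub k)).const_mul κ⁻¹) ?_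
  filter_upwards [hsymm k] with x hx
  rw [← div_eq_inv_mul, le_div_iff₀' hκ]
  exact hcoercive _ hx

end Symmetric

section Reduced

lemma isSymm_of (a b c : ℝ) : (!![a, b; b, c] : Matrix (Fin 2) (Fin 2) ℝ).IsSymm :=
  Matrix.IsSymm.ext fun i j => by fin_cases i <;> fin_cases j <;> rfl

lemma eq_of_isSymm {A : Matrix (Fin 2) (Fin 2) ℝ} (hA : A.IsSymm) :
    A = !![A 0 0, A 0 1; A 0 1, A 1 1] := by
  conv_lhs => rw [A.eta_fin_two, hA.apply 0 1]

variable {Q : QuadraticForm ℝ (Matrix (Fin 2) (Fin 2) ℝ)}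

lemma reducedQ₁_le (hQ : ∀ A : Matrix (Fin 2) (Fin 2) ℝ, A.IsSymm → A ≠ 0 → 0 < Q A)
    (a b c : ℝ) : reducedQ₁ Q a b ≤ Q !![a, b; b, c] :=
  ciInf_le ⟨0, by rintro _ ⟨c, rfl⟩; exact nonneg_of_isSymm hQ (isSymm_of a b c)⟩ c

lemma reducedQ₁_nonneg (hQ : ∀ A : Matrix (Fin 2) (Fin 2) ℝ, A.IsSymm → A ≠ 0 → 0 < Q A)
    (a b : ℝ) : 0 ≤ reducedQ₁ Q a b :=
  Real.iInf_nonneg fun c => nonneg_of_isSymm hQ (isSymm_of a b c)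

lemma reducedQ₀_le (hQ : ∀ A : Matrix (Fin 2) (Fin 2) ℝ, A.IsSymm → A ≠ 0 → 0 < Q A)
    (a b c : ℝ) : reducedQ₀ Q a ≤ Q !![a, b; b, c] :=
  (ciInf_le ⟨0, by rintro _ ⟨b, rfl⟩; exact reducedQ₁_nonneg hQ a b⟩ b).trans
    (reducedQ₁_le hQ a b c)

lemma reducedQ₀_nonneg (hQ : ∀ A : Matrix (Fin 2) (Fin 2) ℝ, A.IsSymm → A ≠ 0 → 0 < Q A)
    (a : ℝ) : 0 ≤ reducedQ₀ Q a :=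
  Real.iInf_nonneg fun b => reducedQ₁_nonneg hQ a b

end Reduced

end QuadraticForms

section StrongConvergence

variable {Ω : Set (ℝ × ℝ)}

lemma MemW12.weakDeriv_ae_eq_pd (hΩ : IsOpen Ω) {f : ℝ × ℝ → ℝ} (hf : MemW12 Ω f) (e : ℝ × ℝ) :
    (fun x => e.1 * pd Ω 0 f x + e.2 * pd Ω 1 f x) =ᵐ[volume.restrict Ω] weakDeriv Ω e f := by
  have hcomb := ((hf.hasWeakDeriv (1, 0)).smul_dir e.1).add_dir
    ((hf.hasWeakDeriv (0, 1)).smul_dir e.2)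
  have he : e.1 • ((1, 0) : ℝ × ℝ) + e.2 • ((0, 1) : ℝ × ℝ) = e := by ext <;> simp
  rw [he] at hcomb
  exact hcomb.ae_eq_weakDeriv hΩ

lemma ConvW12.conv_pd {conv : Set (ℝ × ℝ) → (ℕ → ℝ × ℝ → ℝ) → (ℝ × ℝ → ℝ) → Prop}
    {F : ℕ → ℝ × ℝ → ℝ} {f : ℝ × ℝ → ℝ} (h : ConvW12 conv Ω F f) (i : Fin 2) :
    conv Ω (fun n => pd Ω i (F n)) (pd Ω i f) :=
  h.2.2.2 _

lemma ConvW12.strongL2_of_pd (hΩ : IsConvexDomain Ω) {F : ℕ → ℝ × ℝ → ℝ} {f : ℝ × ℝ → ℝ}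
    (h : ConvW12 WeakL2 Ω F f) (hpd : ∀ i, ∃ g, StrongL2 Ω (fun n => pd Ω i (F n)) g) :
    ConvW12 StrongL2 Ω F f := by
  refine ⟨h.1, h.2.1, h.strongL2 hΩ, fun e => ?_⟩
  obtain ⟨g₀, h₀⟩ := hpd 0
  obtain ⟨g₁, h₁⟩ := hpd 1
  exact (h.2.2.2 e).strongL2_of_congr_ae ((h₀.const_mul tendsto_const_nhds).add
    (h₁.const_mul tendsto_const_nhds)) fun n => (h.1 n).weakDeriv_ae_eq_pd hΩ.isOpen e

lemma ConvW22.strongL2_of_pd_pd (hΩ : IsConvexDomain Ω) {F : ℕ → ℝ × ℝ → ℝ} {f : ℝ × ℝ → ℝ}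
    (h : ConvW22 WeakL2 Ω F f)
    (hpd : ∀ i j, ∃ g, StrongL2 Ω (fun n => pd Ω i (pd Ω j (F n))) g) :
    ConvW22 StrongL2 Ω F f := by
  refine ⟨h.1.strongL2_of_pd hΩ fun i => ⟨_, (h.2 _).strongL2 hΩ⟩, fun e =>
    (h.2 e).strongL2_of_pd hΩ fun i => ?_⟩
  obtain ⟨g₀, h₀⟩ := hpd i 0
  obtain ⟨g₁, h₁⟩ := hpd i 1
  refine ⟨_, ((h₀.const_mul (tendsto_const_nhds (x := e.1))).add
    (h₁.const_mul (tendsto_const_nhds (x := e.2)))).congr_ae (fun n => ?_) (ae_eq_refl _)⟩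
  have hsecond : ∀ j, HasWeakDeriv Ω _ (pd Ω j (F n)) (pd Ω i (pd Ω j (F n))) := fun j =>
    ((h.2 _).1 n).hasWeakDeriv _
  have hcomb := (((hsecond 0).const_mul e.1).add ((hsecond 1).const_mul e.2)).ae_eq_weakDeriv
    hΩ.isOpen
  exact hcomb.trans (weakDeriv_congr_ae hΩ.isOpen hΩ.volume_ne_top
    ((h.1.1 n).weakDeriv_ae_eq_pd hΩ.isOpen e).symm ((h.2 e).1 n) _).symm

lemma strongL2_pd_of_korn {l h : ℝ} (hl : 0 < l) (hh : 0 < h) {a b : ℕ → ℝ × ℝ → ℝ}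
    {a₀ b₀ : ℝ × ℝ → ℝ} (ha : ConvW12 WeakL2 (rect l h) a a₀) (hb : ConvW12 WeakL2 (rect l h) b b₀)
    (ha₀ : StrongL2 (rect l h) (fun n => pd (rect l h) 0 (a n)) (pd (rect l h) 0 a₀))
    (hb₁ : StrongL2 (rect l h) (fun n => pd (rect l h) 1 (b n)) (pd (rect l h) 1 b₀))
    (hab : StrongL2 (rect l h) (fun n x => pd (rect l h) 1 (a n) x + pd (rect l h) 0 (b n) x)
      fun x => pd (rect l h) 1 a₀ x + pd (rect l h) 0 b₀ x) :
    StrongL2 (rect l h) (fun n => pd (rect l h) 1 (a n)) (pd (rect l h) 1 a₀) := by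
  have hrect := isConvexDomain_rect hl hh
  obtain ⟨C, -, hkorn⟩ := korn_rect hl hh
  have hlim := ((((strongL2_iff.1 hab).2.2.add (strongL2_iff.1 ha₀).2.2).add
    (strongL2_iff.1 hb₁).2.2).add (strongL2_iff.1 (ha.strongL2 hrect)).2.2).add
    (strongL2_iff.1 (hb.strongL2 hrect)).2.2 |>.const_mul C
  simp only [add_zero, mul_zero] at hlim
  refine strongL2_iff.2 ⟨(ha.conv_pd 1).1, (ha.conv_pd 1).2.1,
    squeeze_zero (fun n => integral_nonneg fun x => sq_nonneg _) (fun n => ?_) hlim⟩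
  have hpd_sub : ∀ {F : ℕ → ℝ × ℝ → ℝ} {f : ℝ × ℝ → ℝ}, ConvW12 WeakL2 (rect l h) F f → ∀ i,
      pd (rect l h) i (fun x => F n x - f x) =ᵐ[volume.restrict (rect l h)]
        fun x => pd (rect l h) i (F n) x - pd (rect l h) i f x := fun hF _ =>
    weakDeriv_sub_ae hrect.isOpen (hF.1 n) hF.2.1
  have hpd_sq : ∀ {F : ℕ → ℝ × ℝ → ℝ} {f : ℝ × ℝ → ℝ}, ConvW12 WeakL2 (rect l h) F f → ∀ i,
      ∫ x in rect l h, pd (rect l h) i (fun x => F n x - f x) x ^ 2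
        = ∫ x in rect l h, (pd (rect l h) i (F n) x - pd (rect l h) i f x) ^ 2 := fun hF i =>
    integral_congr_ae ((hpd_sub hF i).fun_comp (· ^ 2))
  have hshear : ∫ x in rect l h, (pd (rect l h) 1 (fun x => a n x - a₀ x) x
        + pd (rect l h) 0 (fun x => b n x - b₀ x) x) ^ 2
      = ∫ x in rect l h, (pd (rect l h) 1 (a n) x + pd (rect l h) 0 (b n) x
        - (pd (rect l h) 1 a₀ x + pd (rect l h) 0 b₀ x)) ^ 2 := by
    refine integral_congr_ae ?_
    filter_upwards [hpd_sub ha 1, hpd_sub hb 0] with x hax hbx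
    rw [hax, hbx]
    ring
  simpa only [hpd_sq ha, hpd_sq hb, hshear] using
    hkorn _ _ ((ha.1 n).sub hrect.isOpen ha.2.1) ((hb.1 n).sub hrect.isOpen hb.2.1)

end StrongConvergence

section ScaledDerivatives

variable {l : ℝ} {ε : ℕ → ℝ}

lemma strongL2_pd_of_scaledStrain (hl : 0 < l) (hεpos : ∀ n, 0 < ε n)
    (hε : Tendsto ε atTop (𝓝 0)) {Y : ℕ → Fin 2 → ℝ × ℝ → ℝ} {y : Fin 2 → ℝ × ℝ → ℝ}
    (hY : ∀ i, ConvW12 WeakL2 (rect l 1) (fun n => Y n i) (y i))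
    {E : ℝ × ℝ → Matrix (Fin 2) (Fin 2) ℝ}
    (hE : ∀ i j, StrongL2 (rect l 1) (fun n x => scaledStrain l (ε n) (Y n) x i j)
      fun x => E x i j) (i j : Fin 2) :
    StrongL2 (rect l 1) (fun n => pd (rect l 1) i (Y n j)) (pd (rect l 1) i (y j)) := by
  have h₀₀ : StrongL2 (rect l 1) (fun n => pd (rect l 1) 0 (Y n 0)) (pd (rect l 1) 0 (y 0)) :=
    ((hY 0).conv_pd 0).strongL2_of_congr_ae (hE 0 0) fun n => ae_eq_refl _
  have h₁₁ : StrongL2 (rect l 1) (fun n => pd (rect l 1) 1 (Y n 1)) (pd (rect l 1) 1 (y 1)) := by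
    refine ((hY 1).conv_pd 1).strongL2_of_congr_ae ((hE 1 1).const_mul (c := fun n => ε n ^ 2)
      (hε.pow 2)) fun n => ae_of_all _ fun x => ?_
    simp [scaledStrain, (hεpos n).ne']
  have hshear : StrongL2 (rect l 1)
      (fun n x => pd (rect l 1) 1 (Y n 0) x + pd (rect l 1) 0 (Y n 1) x)
      fun x => pd (rect l 1) 1 (y 0) x + pd (rect l 1) 0 (y 1) x := by
    refine (((hY 0).conv_pd 1).add ((hY 1).conv_pd 0)).strongL2_of_congr_ae
      ((hE 1 0).const_mul (c := fun n => 2 * ε n) (hε.const_mul 2)) fun n => ae_of_all _ fun x => ?_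
    have hεn := (hεpos n).ne'
    simp [scaledStrain]
    field_simp
  have h₁₀ := strongL2_pd_of_korn hl one_pos (hY 0) (hY 1) h₀₀ h₁₁ hshear
  have h₀₁ := hshear.sub h₁₀
  simp only [add_sub_cancel_left] at h₀₁
  fin_cases i <;> fin_cases j
  exacts [h₀₀, h₀₁, h₁₀, h₁₁]

lemma tendsto_scaleFactor (hε : Tendsto ε atTop (𝓝 0)) (i : Fin 2) :
    Tendsto (fun n => scaleFactor (ε n) i) atTop (𝓝 (scaleFactor 0 i)) := by
  fin_cases i <;> simp [scaleFactor, hε]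

lemma scaleFactor_mul_scaledHessian {ε : ℝ} (hε : ε ≠ 0) (w : ℝ × ℝ → ℝ) (x : ℝ × ℝ)
    (i j : Fin 2) : scaleFactor ε i * (scaleFactor ε j * scaledHessian l ε w x i j)
      = pd (rect l 1) i (pd (rect l 1) j w) x := by
  fin_cases i <;> fin_cases j <;> simp [scaleFactor, scaledHessian, hessian] <;> field_simp

lemma scaledGrad_eq (ε : ℝ) (w : ℝ × ℝ → ℝ) (j : Fin 2) :
    scaledGrad l ε w j = fun x => (scaleFactor ε j)⁻¹ * pd (rect l 1) j w x := by
  fin_cases j <;> simp [scaledGrad, scaleFactor]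

lemma scaleFactor_ne_zero {ε : ℝ} (hε : ε ≠ 0) (i : Fin 2) : scaleFactor ε i ≠ 0 := by
  fin_cases i <;> simp [scaleFactor, hε]

variable {W : ℕ → ℝ × ℝ → ℝ} {H : ℝ × ℝ → Matrix (Fin 2) (Fin 2) ℝ}

lemma strongL2_pd_pd_of_scaledHessian (hεpos : ∀ n, 0 < ε n) (hε : Tendsto ε atTop (𝓝 0))
    (hH : ∀ i j, StrongL2 (rect l 1) (fun n x => scaledHessian l (ε n) (W n) x i j)
      fun x => H x i j) (i j : Fin 2) :
    ∃ g, StrongL2 (rect l 1) (fun n => pd (rect l 1) i (pd (rect l 1) j (W n))) g :=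
  ⟨_, (((hH i j).const_mul (tendsto_scaleFactor hε j)).const_mul
    (tendsto_scaleFactor hε i)).congr_ae (fun n => ae_of_all _ fun x =>
      scaleFactor_mul_scaledHessian (hεpos n).ne' (W n) x i j) (ae_eq_refl _)⟩

lemma strongL2_pd_scaledGrad_of_scaledHessian (hl : 0 < l) (hεpos : ∀ n, 0 < ε n)
    (hε : Tendsto ε atTop (𝓝 0)) (hW : ∀ n, MemW22 (rect l 1) (W n))
    (hH : ∀ i j, StrongL2 (rect l 1) (fun n x => scaledHessian l (ε n) (W n) x i j)
      fun x => H x i j) (i j : Fin 2) :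
    ∃ g, StrongL2 (rect l 1) (fun n => pd (rect l 1) i (scaledGrad l (ε n) (W n) j)) g := by
  refine ⟨_, ((hH i j).const_mul (tendsto_scaleFactor hε i)).congr_ae (fun n => ?_) (ae_eq_refl _)⟩
  have hpd : HasWeakDeriv (rect l 1) _ (pd (rect l 1) j (W n))
      (pd (rect l 1) i (pd (rect l 1) j (W n))) := ((hW n).2 _).hasWeakDeriv _
  rw [scaledGrad_eq]
  refine EventuallyEq.trans (ae_of_all _ fun x => ?_)
    ((hpd.const_mul (scaleFactor (ε n) j)⁻¹).ae_eq_weakDeriv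
      (isConvexDomain_rect hl one_pos).isOpen)
  have hj := scaleFactor_ne_zero (hεpos n).ne' j
  simp only [← scaleFactor_mul_scaledHessian (hεpos n).ne']
  field_simp

end ScaledDerivatives

section EnergyConvergence

lemma tendsto_zero_of_add_mul {s t : ℕ → ℝ} {a b c : ℝ} (hs : ∀ n, 0 ≤ s n) (ht : ∀ n, 0 ≤ t n)
    (ha : 0 < a) (hb : 0 ≤ b) (h : Tendsto (fun n => a * s n + b * t n) atTop (𝓝 c)) (hc : c ≤ 0) :
    Tendsto s atTop (𝓝 0) := by
  have hc₀ : c = 0 := hc.antisymm (ge_of_tendsto' h fun n =>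
    add_nonneg (mul_nonneg ha.le (hs n)) (mul_nonneg hb (ht n)))
  refine squeeze_zero hs (fun n => ?_) (by simpa [hc₀] using h.const_mul a⁻¹)
  rw [inv_mul_eq_div, le_div_iff₀' ha]
  exact le_add_of_nonneg_right (mul_nonneg hb (ht n))

lemma strongL2_of_tendsto_energy {E m : Type*} [MeasureSpace E] [Finite m]
    {Ω : Set E} {Q : QuadraticForm ℝ (Matrix m m ℝ)}
    (hQ : ∀ A : Matrix m m ℝ, A.IsSymm → A ≠ 0 → 0 < Q A)
    {A H : ℕ → E → Matrix m m ℝ} {A₀ H₀ : E → Matrix m m ℝ}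
    (hA : ∀ i j, WeakL2 Ω (fun n x => A n x i j) fun x => A₀ x i j)
    (hH : ∀ i j, WeakL2 Ω (fun n x => H n x i j) fun x => H₀ x i j)
    (hAsymm : ∀ n, ∀ᵐ x ∂volume.restrict Ω, (A n x - A₀ x).IsSymm)
    (hHsymm : ∀ n, ∀ᵐ x ∂volume.restrict Ω, (H n x - H₀ x).IsSymm)
    {a b c : ℝ} (ha : 0 < a) (hb : 0 < b)
    (hlim : Tendsto (fun n => a * (∫ x in Ω, Q (A n x)) + b * ∫ x in Ω, Q (H n x)) atTop (𝓝 c))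
    (hc : c ≤ a * (∫ x in Ω, Q (A₀ x)) + b * ∫ x in Ω, Q (H₀ x)) :
    (∀ i j, StrongL2 Ω (fun n x => A n x i j) fun x => A₀ x i j) ∧
      ∀ i j, StrongL2 Ω (fun n x => H n x i j) fun x => H₀ x i j := by
  classical
  obtain ⟨_⟩ := nonempty_fintype m
  have hA_nonneg : ∀ n, 0 ≤ ∫ x in Ω, Q (A n x - A₀ x) := fun n =>
    integral_nonneg_of_ae ((hAsymm n).mono fun _ hx => nonneg_of_isSymm hQ hx)
  have hH_nonneg : ∀ n, 0 ≤ ∫ x in Ω, Q (H n x - H₀ x) := fun n =>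
    integral_nonneg_of_ae ((hHsymm n).mono fun _ hx => nonneg_of_isSymm hQ hx)
  have hdiff : Tendsto (fun n => a * (∫ x in Ω, Q (A n x - A₀ x))
      + b * ∫ x in Ω, Q (H n x - H₀ x)) atTop
      (𝓝 (c - (a * (∫ x in Ω, Q (A₀ x)) + b * ∫ x in Ω, Q (H₀ x)))) := by
    refine (hlim.sub (((tendsto_integral_quadraticForm_sub Q hA).const_mul a).add
      ((tendsto_integral_quadraticForm_sub Q hH).const_mul b))).congr fun n => ?_
    ring
  have hc₀ := sub_nonpos.2 hc
  exact ⟨strongL2_of_tendsto_integral_quadraticForm hQ (fun n i j => (hA i j).1 n)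
      (fun i j => (hA i j).2.1) hAsymm
      (tendsto_zero_of_add_mul hA_nonneg hH_nonneg ha hb.le hdiff hc₀),
    strongL2_of_tendsto_integral_quadraticForm hQ (fun n i j => (hH i j).1 n)
      (fun i j => (hH i j).2.1) hHsymm
      (tendsto_zero_of_add_mul hH_nonneg hA_nonneg hb ha.le
        (by simpa only [add_comm] using hdiff) (by simpa only [add_comm] using hc₀))⟩

end EnergyConvergence

section Strains

variable {l h : ℝ}

lemma karmanStrain_isSymm {E : Matrix (Fin 2) (Fin 2) ℝ} (hE : E.IsSymm) (p : Fin 2 → ℝ) :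
    (karmanStrain E p).IsSymm :=
  hE.add (Matrix.IsSymm.smul (Matrix.transpose_vecMulVec p p) _)

lemma scaledStrain_isSymm (ε : ℝ) (y : Fin 2 → ℝ × ℝ → ℝ) (x : ℝ × ℝ) :
    (scaledStrain l ε y x).IsSymm := by
  simp only [scaledStrain, add_comm (pd (rect l 1) 1 (y 0) x)]
  exact isSymm_of _ _ _

lemma scaledHessian_isSymm (hl : 0 < l) (ε : ℝ) {w : ℝ × ℝ → ℝ} (hw : MemW22 (rect l 1) w) :
    ∀ᵐ x ∂volume.restrict (rect l 1), (scaledHessian l ε w x).IsSymm := by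
  have hcomm : pd (rect l 1) 1 (pd (rect l 1) 0 w) =ᵐ[volume.restrict (rect l 1)]
      pd (rect l 1) 0 (pd (rect l 1) 1 w) :=
    HasWeakDeriv.comm (isConvexDomain_rect hl one_pos).isOpen (hw.1.hasWeakDeriv _)
      (hw.1.hasWeakDeriv _) ((hw.2 _).hasWeakDeriv _) ((hw.2 _).hasWeakDeriv _)
  filter_upwards [hcomm] with x hx
  have hsymm : hessian (rect l 1) w x 1 0 = hessian (rect l 1) w x 0 1 := hx
  simp only [scaledHessian, hsymm]
  exact isSymm_of _ _ _

variable {A : ℕ → ℝ × ℝ → Matrix (Fin 2) (Fin 2) ℝ} {A₀ : ℝ × ℝ → Matrix (Fin 2) (Fin 2) ℝ}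
  {P : ℕ → Fin 2 → ℝ × ℝ → ℝ} {p : Fin 2 → ℝ × ℝ → ℝ}

lemma weakL2_karmanStrain (hl : 0 < l) (hh : 0 < h)
    (hA : ∀ i j, WeakL2 (rect l h) (fun n x => A n x i j) fun x => A₀ x i j)
    (hp : ∀ i, ConvW12 WeakL2 (rect l h) (fun n => P n i) (p i)) (i j : Fin 2) :
    WeakL2 (rect l h) (fun n x => karmanStrain (A n x) (P n · x) i j)
      fun x => karmanStrain (A₀ x) (p · x) i j :=
  (hA i j).add (((hp i).strongL2_mul hl hh (hp j)).weakL2.const_mul (1 / 2))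

lemma strongL2_of_strongL2_karmanStrain (hl : 0 < l) (hh : 0 < h)
    (hp : ∀ i, ConvW12 WeakL2 (rect l h) (fun n => P n i) (p i))
    (hA : ∀ i j, StrongL2 (rect l h) (fun n x => karmanStrain (A n x) (P n · x) i j)
      fun x => karmanStrain (A₀ x) (p · x) i j) (i j : Fin 2) :
    StrongL2 (rect l h) (fun n x => A n x i j) fun x => A₀ x i j := by
  simpa [karmanStrain, Matrix.vecMulVec_apply] using
    (hA i j).sub (((hp i).strongL2_mul hl hh (hp j)).const_mul
      (tendsto_const_nhds (x := (1 / 2 : ℝ))))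

end Strains

section LimitEnergy

variable {l : ℝ} {Q : QuadraticForm ℝ (Matrix (Fin 2) (Fin 2) ℝ)}

lemma integral_rect_fst (k : ℝ → ℝ) : ∫ x in rect l 1, k x.1 = ∫ t in interval l, k t := by
  have hfubini := setIntegral_prod_mul (μ := (volume : Measure ℝ)) (ν := (volume : Measure ℝ)) k
    (fun _ => (1 : ℝ)) (interval l) (interval 1)
  have hwidth : volume.real (interval 1) = 1 := by
    simp only [interval, Measure.real, Real.volume_Ioo]
    norm_num
  simpa [rect, hwidth, ← Measure.volume_eq_prod] using hfubini

variable {E : Type*} [MeasureSpace E] {Ω : Set E} {A : E → Matrix (Fin 2) (Fin 2) ℝ}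

lemma integral_reducedQ₀_le (hQ : ∀ A : Matrix (Fin 2) (Fin 2) ℝ, A.IsSymm → A ≠ 0 → 0 < Q A)
    (hA : ∀ i j, MemL2 Ω fun x => A x i j) (hsymm : ∀ x, (A x).IsSymm) :
    ∫ x in Ω, reducedQ₀ Q (A x 0 0) ≤ ∫ x in Ω, Q (A x) := by
  refine integral_mono_of_nonneg (ae_of_all _ fun x => reducedQ₀_nonneg hQ _)
    (integrableOn_quadraticForm Q hA) (ae_of_all _ fun x => ?_)
  simpa only [← eq_of_isSymm (hsymm x)] using reducedQ₀_le hQ (A x 0 0) (A x 0 1) (A x 1 1)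

lemma integral_reducedQ₁_le (hQ : ∀ A : Matrix (Fin 2) (Fin 2) ℝ, A.IsSymm → A ≠ 0 → 0 < Q A)
    (hA : ∀ i j, MemL2 Ω fun x => A x i j) (hsymm : ∀ x, (A x).IsSymm) :
    ∫ x in Ω, reducedQ₁ Q (A x 0 0) (A x 0 1) ≤ ∫ x in Ω, Q (A x) := by
  refine integral_mono_of_nonneg (ae_of_all _ fun x => reducedQ₁_nonneg hQ _ _)
    (integrableOn_quadraticForm Q hA) (ae_of_all _ fun x => ?_)
  simpa only [← eq_of_isSymm (hsymm x)] using reducedQ₁_le hQ (A x 0 0) (A x 0 1) (A x 1 1)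

/-- The limit `(w', θ)` of the scaled gradients, as a function on `S`. -/
def limitGrad (l : ℝ) (w θ : ℝ → ℝ) : Fin 2 → ℝ × ℝ → ℝ :=
  ![fun x => D l w x.1, fun x => θ x.1]

/-- The limit of the scaled Hessians; its entry `γ` is not determined by `(w, θ)`. -/
def limitHessian (l : ℝ) (w θ : ℝ → ℝ) (γ : ℝ × ℝ → ℝ) (x : ℝ × ℝ) :
    Matrix (Fin 2) (Fin 2) ℝ :=
  !![D l (D l w) x.1, D l θ x.1; D l θ x.1, γ x]

lemma energy1D_add_forces_le
    (hQ : ∀ A : Matrix (Fin 2) (Fin 2) ℝ, A.IsSymm → A ≠ 0 → 0 < Q A)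
    (f : ℝ → ℝ) (g : Fin 2 → ℝ → ℝ) {y : Fin 2 → ℝ × ℝ → ℝ} {w θ : ℝ → ℝ} {γ : ℝ × ℝ → ℝ}
    {A : ℝ × ℝ → Matrix (Fin 2) (Fin 2) ℝ} (hAsymm : ∀ x, (A x).IsSymm)
    (hA₀₀ : ∀ᵐ x ∂volume.restrict (rect l 1), A x 0 0 = pd (rect l 1) 0 (y 0) x)
    (hA : ∀ i j, MemL2 (rect l 1) fun x => karmanStrain (A x) (limitGrad l w θ · x) i j)
    (hH : ∀ i j, MemL2 (rect l 1) fun x => limitHessian l w θ γ x i j) :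
    energy1D Q l f g y w θ + ∫ x in rect l 1, (f x.1 * w x.1 + ∑ i, g i x.1 * y i x)
      ≤ 1 / 2 * (∫ x in rect l 1, Q (karmanStrain (A x) (limitGrad l w θ · x)))
        + 1 / 24 * ∫ x in rect l 1, Q (limitHessian l w θ γ x) := by
  have hmembrane : ∫ x in rect l 1, reducedQ₀ Q (pd (rect l 1) 0 (y 0) x + D l w x.1 ^ 2 / 2)
      = ∫ x in rect l 1, reducedQ₀ Q (karmanStrain (A x) (limitGrad l w θ · x) 0 0) := by
    refine integral_congr_ae (hA₀₀.mono fun x hx => ?_)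
    simp only [karmanStrain, limitGrad, Matrix.add_apply, Matrix.smul_apply,
      Matrix.vecMulVec_apply, Matrix.cons_val_zero, hx, smul_eq_mul]
    ring_nf
  rw [energy1D, sub_add_cancel, hmembrane, ← integral_rect_fst]
  have hstretch := integral_reducedQ₀_le hQ hA fun x => karmanStrain_isSymm (hAsymm x) _
  have hbend := integral_reducedQ₁_le (A := limitHessian l w θ γ) hQ hH fun x => isSymm_of _ _ _
  simp only [limitHessian, Matrix.of_apply, Matrix.cons_val_zero, Matrix.cons_val_one] at hbend ⊢
  linarith only [hstretch, hbend]

end LimitEnergy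

section Forces

lemma integral_add_mul_add_mul {E : Type*} [MeasureSpace E] {Ω : Set E}
    {f₁ f₂ f₃ k₁ k₂ k₃ : E → ℝ} (hf₁ : MemL2 Ω f₁) (hf₂ : MemL2 Ω f₂) (hf₃ : MemL2 Ω f₃)
    (hk₁ : MemL2 Ω k₁) (hk₂ : MemL2 Ω k₂) (hk₃ : MemL2 Ω k₃) :
    ∫ x in Ω, (f₁ x * k₁ x + f₂ x * k₂ x + f₃ x * k₃ x)
      = (∫ x in Ω, f₁ x * k₁ x) + (∫ x in Ω, f₂ x * k₂ x) + ∫ x in Ω, f₃ x * k₃ x := by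
  have h₁ := hf₁.integrableOn_mul hk₁
  have h₂ := hf₂.integrableOn_mul hk₂
  rw [integral_add (h₁.fun_add h₂) (hf₃.integrableOn_mul hk₃), integral_add h₁ h₂]

lemma tendsto_integral_forces {l : ℝ} {ε : ℕ → ℝ} {f : ℕ → ℝ × ℝ → ℝ}
    {g : ℕ → Fin 2 → ℝ × ℝ → ℝ} {f₁ : ℝ → ℝ} {g₁ : Fin 2 → ℝ → ℝ}
    (hf : WeakL2 (rect l 1) (fun n x => f n (x.1, ε n * x.2)) fun x => f₁ x.1)
    (hg₀ : WeakL2 (rect l 1) (fun n x => g n 0 (x.1, ε n * x.2)) fun x => g₁ 0 x.1)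
    (hg₁ : WeakL2 (rect l 1) (fun n x => 1 / ε n * g n 1 (x.1, ε n * x.2)) fun x => g₁ 1 x.1)
    {W : ℕ → ℝ × ℝ → ℝ} {Y : ℕ → Fin 2 → ℝ × ℝ → ℝ} {w : ℝ → ℝ} {y : Fin 2 → ℝ × ℝ → ℝ}
    (hW : StrongL2 (rect l 1) W fun x => w x.1)
    (hY : ∀ i, StrongL2 (rect l 1) (fun n => Y n i) (y i)) :
    Tendsto (fun n => ∫ x in rect l 1, (f n (x.1, ε n * x.2) * W n x
      + g n 0 (x.1, ε n * x.2) * Y n 0 x + 1 / ε n * g n 1 (x.1, ε n * x.2) * Y n 1 x)) atTop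
      (𝓝 (∫ x in rect l 1, (f₁ x.1 * w x.1 + ∑ i, g₁ i x.1 * y i x))) := by
  simp only [Fin.sum_univ_two, ← add_assoc]
  rw [integral_add_mul_add_mul hf.2.1 hg₀.2.1 hg₁.2.1 hW.2.1 (hY 0).2.1 (hY 1).2.1]
  refine (((hf.tendsto_integral_mul hW).add (hg₀.tendsto_integral_mul (hY 0))).add
    (hg₁.tendsto_integral_mul (hY 1))).congr fun n => ?_
  exact (integral_add_mul_add_mul (hf.1 n) (hg₀.1 n) (hg₁.1 n) (hW.1 n) ((hY 0).1 n)
    ((hY 1).1 n)).symm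

end Forces

end Ribbon

end

theorem lemma5p8_general {l : ℝ} (hl : 0 < l) {Q : QuadraticForm ℝ (Matrix (Fin 2) (Fin 2) ℝ)}
    (hQpos : ∀ A : Matrix (Fin 2) (Fin 2) ℝ, A.IsSymm → A ≠ 0 → 0 < Q A)
    {ε : ℕ → ℝ} (hεpos : ∀ n, 0 < ε n) (hε : Tendsto ε atTop (𝓝 0))
    {f : ℕ → ℝ × ℝ → ℝ} {g : ℕ → Fin 2 → ℝ × ℝ → ℝ} {f₁ : ℝ → ℝ} {g₁ : Fin 2 → ℝ → ℝ}
    (hfconv : WeakL2 (rect l 1) (fun n x => f n (x.1, ε n * x.2)) (fun x => f₁ x.1))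
    (hgconv₁ : WeakL2 (rect l 1) (fun n x => g n 0 (x.1, ε n * x.2)) (fun x => g₁ 0 x.1))
    (hgconv₂ : WeakL2 (rect l 1) (fun n x => 1 / ε n * g n 1 (x.1, ε n * x.2))
      (fun x => g₁ 1 x.1))
    {u : ℕ → Fin 2 → ℝ × ℝ → ℝ} {v : ℕ → ℝ × ℝ → ℝ}
    (hu : ∀ n i, MemW12 (rect l (ε n)) (u n i)) (hv : ∀ n, MemW22 (rect l (ε n)) (v n))
    {y : Fin 2 → ℝ × ℝ → ℝ} {w θ : ℝ → ℝ} (hσ : ConvPiSigma l ε u v y w θ)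
    (hφ : Tendsto (fun n => energy2D Q l (ε n) (f n) (g n) (u n) (v n)) atTop
      (𝓝 (energy1D Q l f₁ g₁ y w θ))) :
    ConvPiRho l ε u v y w θ := by
  have hrect := isConvexDomain_rect hl one_pos
  obtain ⟨hw, hp₀, hp₁, ⟨γ, hγ, hH⟩, hy, E, hE2, hEsymm, hE₀₀, hE⟩ := hσ
  have hp : ∀ i, ConvW12 WeakL2 (rect l 1)
      (fun n => scaledGrad l (ε n) (scaledV (ε n) (v n)) i) (limitGrad l w θ i) :=
    Fin.forall_fin_two.2 ⟨hp₀, hp₁⟩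
  have hW : ∀ n, MemW22 (rect l 1) (scaledV (ε n) (v n)) := fun n =>
    ⟨hw.1.1 n, fun e => (hw.2 e).1 n⟩
  have hK := weakL2_karmanStrain hl one_pos hE hp
  have hforces := tendsto_integral_forces hfconv hgconv₁ hgconv₂ (hw.1.strongL2 hrect)
    fun i => (hy i).strongL2 hrect
  have helastic := (hφ.add hforces).congr fun n => by
    rw [energy2D_eq hl (hεpos n) Q (f n) (g n) (hu n) (hv n) (hW n), sub_add_cancel]
  obtain ⟨hKstrong, hHstrong⟩ := strongL2_of_tendsto_energy hQpos hK hH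
    (fun n => ae_of_all _ fun x => (karmanStrain_isSymm (scaledStrain_isSymm _ _ _) _).sub
      (karmanStrain_isSymm (hEsymm x) _))
    (fun n => (scaledHessian_isSymm hl (ε n) (hW n)).mono fun x hx => hx.sub (isSymm_of _ _ _))
    (by norm_num) (by norm_num) helastic
    (energy1D_add_forces_le hQpos f₁ g₁ hEsymm hE₀₀ (fun i j => (hK i j).2.1)
      fun i j => (hH i j).2.1)
  have hEstrong := strongL2_of_strongL2_karmanStrain hl one_pos hp hKstrong
  have hgrad := strongL2_pd_scaledGrad_of_scaledHessian hl hεpos hε hW hHstrong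
  exact ⟨hw.strongL2_of_pd_pd hrect (strongL2_pd_pd_of_scaledHessian hεpos hε hHstrong),
    hp₀.strongL2_of_pd hrect fun i => hgrad i 0, hp₁.strongL2_of_pd hrect fun i => hgrad i 1,
    ⟨γ, hγ, hHstrong⟩, fun j => (hy j).strongL2_of_pd hrect fun i =>
      ⟨_, strongL2_pd_of_scaledStrain hl hεpos hε hy hEstrong i j⟩,
    E, hE2, hEsymm, hE₀₀, hEstrong⟩

theorem lemma5p8
    -- length of the ribbon
    (l : ℝ) (hl : 0 < l)
    -- elastic quadratic form
    (Q : QuadraticForm ℝ (Matrix (Fin 2) (Fin 2) ℝ))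
    (hQsymm : ∀ A : Matrix (Fin 2) (Fin 2) ℝ, Q A = Q ((1 / 2 : ℝ) • (A + A.transpose)))
    (hQpos : ∀ A : Matrix (Fin 2) (Fin 2) ℝ, A.IsSymm → A ≠ 0 → 0 < Q A)
    -- boundary data
    (uhat₁ uhat₂ vhat : ℝ → ℝ)
    (huhat₁ : MemW12 (interval l) uhat₁)
    (huhat₂ : MemW22 (interval l) uhat₂)
    (hvhat : MemW22 (interval l) vhat)
    -- null sequence of widths
    (ε : ℕ → ℝ) (hεpos : ∀ n, 0 < ε n) (hε : Tendsto ε atTop (𝓝 0))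
    -- forces
    (f : ℕ → ℝ × ℝ → ℝ) (g : ℕ → Fin 2 → ℝ × ℝ → ℝ)
    (hf : ∀ n, MemL2 (rect l (ε n)) (f n))
    (hg : ∀ n i, MemL2 (rect l (ε n)) (g n i))
    (f₁ : ℝ → ℝ) (g₁ : Fin 2 → ℝ → ℝ)
    (hf₁ : MemL2 (interval l) f₁) (hg₁ : ∀ i, MemL2 (interval l) (g₁ i))
    (hfconv : WeakL2 (rect l 1) (fun n x => f n (x.1, ε n * x.2)) (fun x => f₁ x.1))
    (hgconv₁ : WeakL2 (rect l 1) (fun n x => g n 0 (x.1, ε n * x.2)) (fun x => g₁ 0 x.1))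
    (hgconv₂ : WeakL2 (rect l 1) (fun n x => 1 / ε n * g n 1 (x.1, ε n * x.2))
      (fun x => g₁ 1 x.1))
    -- displacements and limiting variables
    (u : ℕ → Fin 2 → ℝ × ℝ → ℝ) (v : ℕ → ℝ × ℝ → ℝ)
    (huv : ∀ n, Admissible2D l (ε n) uhat₁ uhat₂ vhat (u n) (v n))
    (y : Fin 2 → ℝ × ℝ → ℝ) (w θ : ℝ → ℝ)
    (hlim : Admissible1D l uhat₁ uhat₂ vhat y w θ)
    -- weak convergence and convergence of the energies
    (hσ : ConvPiSigma l ε u v y w θ)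
    (hφ : Tendsto (fun n => energy2D Q l (ε n) (f n) (g n) (u n) (v n)) atTop
      (𝓝 (energy1D Q l f₁ g₁ y w θ))) :
    ConvPiRho l ε u v y w θ :=
  lemma5p8_general hl hQpos hεpos hε hfconv hgconv₁ hgconv₂ (fun n => (huv n).1)
    (fun n => (huv n).2.1) hσ hφ
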